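/- Let $J=\begin{pmatrix}0&-1\\1&0\end{pmatrix}$ and let $V_{per},u:\mathbb R\to\mathbb R^{2\times2}$ be measurable bounded functions with values in the real symmetric matrices, with $V_{per}$ $1$-periodic and $u$ vanishing outside $[-1/2,1/2]$. Let $(\lambda_n)_{n\in\mathbb Z}$ be independent identically distributed real random variables on a probability space $(\Omega,P)$, almost surely bounded by a constant, and put $$W_\omega(x)=V_{per}(x)+\sum_{n\in\mathbb Z}\lambda_n(\omega)\,u(x-n).$$ Let $H_\omega=J\frac{d}{dx}+W_\omega$ on $L^2(\mathbb R,\mathbb C^2)$ with domain $H^1(\mathbb R,\mathbb C^2)$. For $L>0$ let $H_{\omega,L}$ be the restriction of $H_\omega$ to $(-L/2,L/2)$ with Dirichlet boundary conditions, that is, the operator acting as $J\frac{d}{dx}+W_\omega$ on $L^2((-L/2,L/2),\mathbb C^2)$ with domain $$\Big\{\psi=\begin{pmatrix}\psi^\uparrow\\\psi^\downarrow\end{pmatrix}\in H^1((-L/2,L/2),\mathbb C^2):\ \psi^\uparrow(-L/2)=\psi^\uparrow(L/2)=0\Big\}.$$ Let $\chi_L$ be the operator of multiplication by the characteristic function of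 $[-L/2,L/2]$. Let $\varphi:\mathbb R\to\mathbb C$ be a measurable function with at most countably many points of discontinuity and such that $\sum_{k\in\mathbb Z}\sup_{[k,k+1)}|\varphi|<\infty$ (for example, a continuous function with $\varphi(E)=O(|E|^{-a})$ at infinity for some $a>1$, or the characteristic function of a bounded interval). Then there is a (deterministic) number $\tilde\nu(\varphi)\in\mathbb C$ such that, almost surely: $H_\omega$ and all the $H_{\omega,L}$, $L>0$, are self-adjoint (so that $\varphi(H_\omega)$ and $\varphi(H_{\omega,L})$ are defined by the functional calculus), the operators $\chi_L\varphi(H_\omega)\chi_L$ and $\varphi(H_{\omega,L})$ are trace class for all $L>0$, and $$\lim_{L\to\infty}\frac1L\,\mathrm{tr}\big(\chi_L\varphi(H_\omega)\chi_L\big)=\tilde\nu(\varphi)=\lim_{L\to\infty}\frac1L\,\mathrm{tr}\big(\varphi(H_{\omega,L})\big),$$ where $L\to\infty$ through the real numbers. -/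

import Mathlib

open MeasureTheory ProbabilityTheory Filter Topology Set

noncomputable section

namespace RandomDirac

/-! ### Traces of bounded operators on a Hilbert space -/

section Trace

variable {H : Type*} [NormedAddCommGroup H] [InnerProductSpace ℂ H] [CompleteSpace H]

/-- `T` is trace class: `∑ ⟨eᵢ, |T| eᵢ⟩ < ∞` for every orthonormal basis `(eᵢ)`, where
`|T| = (T* T)^{1/2}`. -/
def IsTraceClass (T : H →L[ℂ] H) : Prop :=
  ∀ (w : Set H) (b : HilbertBasis w ℂ H),
    Summable fun i => inner ℂ (b i) (CFC.abs T (b i))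

/-- The trace `∑ ⟨eᵢ, T eᵢ⟩` of a (trace class) operator, computed in an orthonormal basis. -/
def trace (T : H →L[ℂ] H) : ℂ :=
  ∑' i, inner ℂ ((exists_hilbertBasis ℂ H).choose_spec.choose i)
    (T ((exists_hilbertBasis ℂ H).choose_spec.choose i))

/-! ### Borel functional calculus of an unbounded self-adjoint operator -/

/-- `μ` is the spectral measure of the operator `A` at the vector `x`: the finite Borel measure on
`ℝ` such that `⟨x, (A - z)⁻¹ x⟩ = ∫ (t - z)⁻¹ dμ(t)` for all non-real `z`. -/
def IsSpectralMeasure (A : H →ₗ.[ℂ] H) (x : H) (μ : Measure ℝ) : Prop :=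
  IsFiniteMeasure μ ∧ ∀ z : ℂ, z.im ≠ 0 →
    ∃ y : A.domain, A y - z • (y : H) = x ∧ inner ℂ x (y : H) = ∫ t : ℝ, ((t : ℂ) - z)⁻¹ ∂μ

/-- `T = φ(A)` for the self-adjoint operator `A` and the bounded Borel function `φ`: the bounded
operator `T` with `⟨x, T x⟩ = ∫ φ dμ_x` for every `x`, where `μ_x` is the spectral measure of `A`
at `x`. -/
def IsFunctionOf (A : H →ₗ.[ℂ] H) (φ : ℝ → ℂ) (T : H →L[ℂ] H) : Prop :=
  IsSelfAdjoint A ∧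
    ∀ x : H, ∃ μ : Measure ℝ, IsSpectralMeasure A x μ ∧ inner ℂ x (T x) = ∫ t, φ t ∂μ

open scoped Classical in
/-- The operator `φ(A)` of the Borel functional calculus (with value `0` where it is not
defined). -/
def borelFC (A : H →ₗ.[ℂ] H) (φ : ℝ → ℂ) : H →L[ℂ] H :=
  if h : ∃ T, IsFunctionOf A φ T then h.choose else 0

end Trace

/-! ### One-dimensional Dirac operators -/

/-- The space `L²(μ; ℂ²)` of spinors. -/
abbrev Spinor (μ : Measure ℝ) : Type := Lp (EuclideanSpace ℂ (Fin 2)) 2 μ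

/-- The matrix `J = (0, -1; 1, 0)`. -/
def J : Matrix (Fin 2) (Fin 2) ℂ := !![0, -1; 1, 0]

/-- Action of a complex matrix on `ℂ²`. -/
def act (M : Matrix (Fin 2) (Fin 2) ℂ) (v : EuclideanSpace ℂ (Fin 2)) :
    EuclideanSpace ℂ (Fin 2) := Matrix.toEuclideanLin M v

lemma intervalIntegrable_spinor {μ : Measure ℝ} [IsLocallyFiniteMeasure μ] (g : Spinor μ)
    (c d : ℝ) : IntervalIntegrable g μ c d := by
  have h1 : LocallyIntegrable (g : ℝ → EuclideanSpace ℂ (Fin 2)) μ :=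
    MemLp.locallyIntegrable (Lp.memLp g) (by norm_num)
  have h2 : IntegrableOn (g : ℝ → EuclideanSpace ℂ (Fin 2)) (uIcc c d) μ :=
    h1.integrableOn_isCompact isCompact_uIcc
  exact intervalIntegrable_iff.2 (h2.mono_set uIoc_subset_uIcc)

/-- The graph of the operator `ψ ↦ J ψ' + W ψ` in `L²(μ; ℂ²)`. Here `μ` is the Lebesgue measure of
an open interval, `s` is the closure of this interval and `bdry` is a set of points of `s`. The
domain consists of the `ψ` in the Sobolev space `H¹` (`ψ` has an absolutely continuous
representative `f` on `s` whose derivative `g` is in `L²`) such that the upper component of `f`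
vanishes on `bdry`. -/
def diracGraph (μ : Measure ℝ) [IsLocallyFiniteMeasure μ] (s bdry : Set ℝ)
    (W : ℝ → Matrix (Fin 2) (Fin 2) ℝ) : Submodule ℂ (Spinor μ × Spinor μ) where
  carrier := {p | ∃ (f : ℝ → EuclideanSpace ℂ (Fin 2)) (g : Spinor μ),
    p.1 =ᵐ[μ] f ∧
    (∀ c ∈ s, ∀ d ∈ s, f d - f c = ∫ x in c..d, g x ∂μ) ∧
    (∀ x ∈ bdry, f x 0 = 0) ∧
    p.2 =ᵐ[μ] fun x => act J (g x) + act ((W x).map (fun r : ℝ => (r : ℂ))) (f x)}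
  zero_mem' := by
    refine ⟨0, 0, Lp.coeFn_zero _ _ _, ?_, by simp, ?_⟩
    · intro c _ d _
      have h : ∀ᵐ x ∂μ, (0 : Spinor μ) x = 0 := Lp.coeFn_zero _ _ _
      rw [intervalIntegral.integral_congr_ae (g := fun _ => 0)
        (h.mono fun x hx _ => hx)]
      simp
    · filter_upwards [Lp.coeFn_zero (EuclideanSpace ℂ (Fin 2)) 2 μ] with x hx
      rw [Prod.snd_zero, hx]
      simp [act]
  add_mem' := by
    rintro p q ⟨f, g, h1, h2, h3, h4⟩ ⟨f', g', h1', h2', h3', h4'⟩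
    refine ⟨f + f', g + g', ?_, ?_, ?_, ?_⟩
    · filter_upwards [Lp.coeFn_add p.1 q.1, h1, h1'] with x hx k k'
      rw [Prod.fst_add, hx, Pi.add_apply, Pi.add_apply, k, k']
    · intro c hc d hd
      rw [intervalIntegral.integral_congr_ae (g := fun x => g x + g' x)
          ((Lp.coeFn_add g g').mono fun x hx _ => hx),
        intervalIntegral.integral_add (intervalIntegrable_spinor g c d)
          (intervalIntegrable_spinor g' c d), ← h2 c hc d hd, ← h2' c hc d hd]
      simp only [Pi.add_apply]
      abel
    · intro x hx
      simp [h3 x hx, h3' x hx]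
    · filter_upwards [Lp.coeFn_add p.2 q.2, Lp.coeFn_add g g', h4, h4'] with x hx hg k k'
      simp only [Prod.snd_add, hx, hg, Pi.add_apply, k, k', act, map_add]
      abel
  smul_mem' := by
    rintro a p ⟨f, g, h1, h2, h3, h4⟩
    refine ⟨a • f, a • g, ?_, ?_, ?_, ?_⟩
    · filter_upwards [Lp.coeFn_smul a p.1, h1] with x hx k
      rw [Prod.smul_fst, hx, Pi.smul_apply, Pi.smul_apply, k]
    · intro c hc d hd
      rw [intervalIntegral.integral_congr_ae (g := fun x => a • g x)
          ((Lp.coeFn_smul a g).mono fun x hx _ => hx),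
        intervalIntegral.integral_smul, ← h2 c hc d hd, smul_sub]
      rfl
    · intro x hx
      simp [h3 x hx]
    · filter_upwards [Lp.coeFn_smul a p.2, Lp.coeFn_smul a g, h4] with x hx hg k
      simp only [Prod.smul_snd, hx, hg, Pi.smul_apply, k, act, map_smul, smul_add]

/-- The operator `D₀ + W` on `L²(ℝ; ℂ²)`, `D₀ = J d/dx`, with domain `H¹(ℝ; ℂ²)` (for bounded
`W`). -/
def diracLine (W : ℝ → Matrix (Fin 2) (Fin 2) ℝ) : Spinor volume →ₗ.[ℂ] Spinor volume :=
  (diracGraph volume univ ∅ W).toLinearPMap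

/-- The Lebesgue measure of the box `(-L/2, L/2)`. -/
abbrev boxMeasure (L : ℝ) : Measure ℝ := volume.restrict (Ioo (-(L / 2)) (L / 2))

/-- The restriction of `D₀ + W` to `(-L/2, L/2)` with Dirichlet boundary conditions: its domain
consists of the `ψ` in `H¹((-L/2, L/2); ℂ²)` whose upper component vanishes at `-L/2` and at
`L/2`. -/
def diracBox (L : ℝ) (W : ℝ → Matrix (Fin 2) (Fin 2) ℝ) :
    Spinor (boxMeasure L) →ₗ.[ℂ] Spinor (boxMeasure L) :=
  (diracGraph (boxMeasure L) (Icc (-(L / 2)) (L / 2)) {-(L / 2), L / 2} W).toLinearPMap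

/-- The function `χ_L f` as an element of `L²(ℝ; ℂ²)`, where `χ_L` is the characteristic function
of `[-L/2, L/2]`. -/
def chiFun (L : ℝ) (f : Spinor volume) : Spinor volume :=
  ((Lp.memLp f).indicator (measurableSet_Icc (a := -(L / 2)) (b := L / 2))).toLp

lemma coeFn_chiFun (L : ℝ) (f : Spinor volume) :
    chiFun L f =ᵐ[volume] (Icc (-(L / 2)) (L / 2)).indicator f :=
  MemLp.coeFn_toLp _

/-- The operator of multiplication by the characteristic function `χ_L` of `[-L/2, L/2]` on
`L²(ℝ; ℂ²)`. -/
def chi (L : ℝ) : Spinor volume →L[ℂ] Spinor volume :=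
  LinearMap.mkContinuous
    { toFun := chiFun L
      map_add' := fun f g => by
        apply Lp.ext
        filter_upwards [coeFn_chiFun L (f + g), coeFn_chiFun L f, coeFn_chiFun L g,
          Lp.coeFn_add f g, Lp.coeFn_add (chiFun L f) (chiFun L g)] with x h1 h2 h3 h4 h5
        rw [h1, h5, Pi.add_apply, h2, h3]
        by_cases hx : x ∈ Icc (-(L / 2)) (L / 2)
        · rw [indicator_of_mem hx, indicator_of_mem hx, indicator_of_mem hx, h4, Pi.add_apply]
        · rw [indicator_of_notMem hx, indicator_of_notMem hx, indicator_of_notMem hx, add_zero]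
      map_smul' := fun a f => by
        apply Lp.ext
        filter_upwards [coeFn_chiFun L (a • f), coeFn_chiFun L f,
          Lp.coeFn_smul a f, Lp.coeFn_smul a (chiFun L f)] with x h1 h2 h4 h5
        rw [h1, RingHom.id_apply, h5, Pi.smul_apply, h2]
        by_cases hx : x ∈ Icc (-(L / 2)) (L / 2)
        · rw [indicator_of_mem hx, indicator_of_mem hx, h4, Pi.smul_apply]
        · rw [indicator_of_notMem hx, indicator_of_notMem hx, smul_zero] }
    1
    (fun f => by
      rw [one_mul]
      apply Lp.norm_le_norm_of_ae_le
      filter_upwards [coeFn_chiFun L f] with x hx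
      change ‖chiFun L f x‖ ≤ _
      rw [hx]
      exact norm_indicator_le_norm_self _ _)

/-! ### The random operator -/

/-- The space of matrix-valued functions that are admissible as potentials: measurable, bounded,
with values in the real symmetric matrices. -/
structure IsPotential (V : ℝ → Matrix (Fin 2) (Fin 2) ℝ) : Prop where
  symm : ∀ x, (V x).IsSymm
  measurable : ∀ i j, Measurable fun x => V x i j
  bounded : ∃ C : ℝ, ∀ x i j, |V x i j| ≤ C

/-- The potential `x ↦ V_per(x) + ∑_{n ∈ ℤ} λ_n u(x - n)` for given values `(λ_n)` of the coupling
constants. -/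
def potential (Vper u : ℝ → Matrix (Fin 2) (Fin 2) ℝ) (lam : ℤ → ℝ) (x : ℝ) :
    Matrix (Fin 2) (Fin 2) ℝ :=
  Vper x + ∑' n : ℤ, lam n • u (x - n)

/-- The test functions on which the density of states is defined: measurable functions with at most
countably many discontinuities and such that `∑_k sup_{[k, k+1)} |φ| < ∞`. -/
structure IsTestFunction (φ : ℝ → ℂ) : Prop where
  measurable : Measurable φ
  countable_discontinuities : {x | ¬ ContinuousAt φ x}.Countable
  decay : ∃ c : ℤ → ℝ, Summable c ∧ ∀ x, ‖φ x‖ ≤ c ⌊x⌋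

end RandomDirac

end

noncomputable section
set_option linter.unusedSectionVars false
namespace RandomDirac
open scoped ENNReal NNReal ComplexConjugate

/-! For a self-adjoint `A` and a bounded `X`, the map φ ↦ tr(X* φ(A) X) is integration against a
positive measure, the sum of the spectral measures of `A` at the vectors `X eᵢ` (`traceMeasure`).
With `X = χ_L` for the operator on the line and `X = 1` for the operator on the box, both normalized
traces have the form ∫ φ dm_L, and the theorem becomes a statement on convergence of measures. By
`IsTestFunction.exists_tendsto_integral` three facts suffice: the m_L are bounded on unit intervals,
uniformly in L and in the position of the interval; their Poisson integrals at the heights 1/(n+1)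
converge for a dense set of energies; small neighbourhoods of the discontinuities of φ, and of the
integers, eventually carry little mass.

The Poisson integral of m_L at z = s + iy is y/L times the squared Hilbert–Schmidt norm of (A -
z)⁻¹X. This norm is the mass of [-L/2, L/2] under a measure on the line (`density`), hence additive
over intervals. On a cell of length ℓ it differs from the norm for the Dirichlet operator of that
cell by at most 4/y², whatever ℓ is (`density_comparison`): the difference of the two resolvents
takes values in the solutions of a homogeneous first order 2×2 system, so it has rank at most 2 and
norm at most 2/|y|, and Im⟨x, Rx⟩ = y‖Rx‖². The cell operators are the same function of disjoint
blocks of independent variables, so the strong law (`strong_law_blocks`) gives the averages over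
cells. The total error per unit length is O(1/ℓ); letting ℓ → ∞ makes the Poisson integrals Cauchy.
No subadditive ergodic theorem enters, and the limits for the line and for the box agree because
both are compared with the same cells.

Point masses are excluded in the same way. As y → 0, y²‖(A - E - iy)⁻¹‖² in Hilbert–Schmidt norm
tends to the mass at E, which is at most 2 for a cell operator; hence the limiting mass near E per
unit length is O(1/ℓ) for every ℓ. Uniformity in the energy comes from `density_resolv_le`: since
`J` is antisymmetric, the term with E does not contribute to the derivative of |ψ|².

The operator theory behind this is a Borel functional calculus: existence of spectral measures
(`exists_isSpectralMeasure`) from the continuous functional calculus of the normal operator (A -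
i)⁻¹, uniqueness (`ext_of_integral_resolvent`) from Poisson kernels, and polarization.
Self-adjointness of the Dirac operators rests on Green's identity and the lemma of du Bois-Reymond.
-/

lemma enorm_conj (c : ℂ) : ‖conj c‖ₑ = ‖c‖ₑ := by simp [← ofReal_norm]

lemma enorm_I : ‖Complex.I‖ₑ = 1 := by simp [← ofReal_norm]

/-! ### Hilbert–Schmidt norms and criteria for trace class operators. -/

section HilbertSchmidt

variable {H K G : Type*} [NormedAddCommGroup H] [InnerProductSpace ℂ H] [CompleteSpace H]
  [NormedAddCommGroup K] [InnerProductSpace ℂ K] [CompleteSpace K]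
  [NormedAddCommGroup G] [InnerProductSpace ℂ G] [CompleteSpace G]

variable (H) in
/-- The Hilbert basis in which traces are computed. -/
def stdBasis : HilbertBasis (exists_hilbertBasis ℂ H).choose ℂ H :=
  (exists_hilbertBasis ℂ H).choose_spec.choose

/-- The square of the Hilbert–Schmidt norm. -/
def hsq (T : H →L[ℂ] K) : ℝ≥0∞ := ∑' i, ‖T (stdBasis H i)‖ₑ ^ 2

lemma tsum_enorm_inner_sq {ι : Type*} (b : HilbertBasis ι ℂ H) (x : H) :
    ∑' i, ‖inner ℂ (b i) x‖ₑ ^ 2 = ‖x‖ₑ ^ 2 := by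
  have h := b.hasSum_inner_mul_inner x x
  have h2 : HasSum (fun i => ‖inner ℂ (b i) x‖ ^ 2) (‖x‖ ^ 2) := by
    have h3 := Complex.hasSum_re h
    convert! h3 using 1
    · ext i
      rw [← inner_conj_symm x (b i), ← Complex.normSq_eq_conj_mul_self, Complex.ofReal_re,
        Complex.normSq_eq_norm_sq]
    · rw [inner_self_eq_norm_sq_to_K]; norm_cast
  have h4 := h2.tsum_eq ▸ ENNReal.ofReal_tsum_of_nonneg (fun i => by positivity) h2.summable
  simpa [ENNReal.ofReal_pow, ofReal_norm] using h4.symm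

lemma tsum_enorm_sq_adjoint {ι κ : Type*} (b : HilbertBasis ι ℂ H) (c : HilbertBasis κ ℂ K)
    (T : H →L[ℂ] K) :
    ∑' i, ‖T (b i)‖ₑ ^ 2 = ∑' j, ‖ContinuousLinearMap.adjoint T (c j)‖ₑ ^ 2 := by
  calc ∑' i, ‖T (b i)‖ₑ ^ 2 = ∑' i, ∑' j, ‖inner ℂ (c j) (T (b i))‖ₑ ^ 2 := by
        simp_rw [tsum_enorm_inner_sq]
    _ = ∑' j, ∑' i, ‖inner ℂ (c j) (T (b i))‖ₑ ^ 2 := ENNReal.tsum_comm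
    _ = ∑' j, ∑' i, ‖inner ℂ (b i) (ContinuousLinearMap.adjoint T (c j))‖ₑ ^ 2 := by
        refine tsum_congr fun j => tsum_congr fun i => ?_
        rw [ContinuousLinearMap.adjoint_inner_right, ← inner_conj_symm (T (b i)), enorm_conj]
    _ = _ := by simp_rw [tsum_enorm_inner_sq]

lemma hsq_adjoint (T : H →L[ℂ] K) : hsq (ContinuousLinearMap.adjoint T) = hsq T :=
  (tsum_enorm_sq_adjoint (stdBasis H) (stdBasis K) T).symm

lemma hsq_eq {ι : Type*} (b : HilbertBasis ι ℂ H) (T : H →L[ℂ] K) :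
    hsq T = ∑' i, ‖T (b i)‖ₑ ^ 2 := by
  rw [tsum_enorm_sq_adjoint b (stdBasis K), ← tsum_enorm_sq_adjoint (stdBasis H) (stdBasis K)]
  rfl

lemma hsq_comp_le (S : K →L[ℂ] G) (T : H →L[ℂ] K) : hsq (S ∘L T) ≤ ‖S‖ₑ ^ 2 * hsq T := by
  rw [hsq, hsq, ← ENNReal.tsum_mul_left]
  refine ENNReal.tsum_le_tsum fun i => ?_
  rw [← mul_pow]
  gcongr
  exact S.le_opENorm _

lemma hsq_comp_le' (S : K →L[ℂ] G) (T : H →L[ℂ] K) : hsq (S ∘L T) ≤ ‖T‖ₑ ^ 2 * hsq S := by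
  rw [← hsq_adjoint, ContinuousLinearMap.adjoint_comp, ← hsq_adjoint S]
  refine (hsq_comp_le _ _).trans (le_of_eq ?_)
  congr 2
  simp [enorm, nnnorm]

/-- Polarization without loss: the dominating form `q` obeys the parallelogram law and is invariant
under multiplication by `i`, so its values at x ± y and x ± iy add up to 4(q x + q y), which cancels
the factor 1/4. -/
lemma norm_inner_le_add_of_quadratic {ι : Type*} (T : H →L[ℂ] H) (a : ι → ℝ≥0∞)
    (B : ι → H →L[ℂ] K)
    (h : ∀ x, ‖inner ℂ x (T x)‖ₑ ≤ ∑' k, a k * ‖B k x‖ₑ ^ 2) (x y : H) :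
    ‖inner ℂ x (T y)‖ₑ ≤ ∑' k, a k * ‖B k x‖ₑ ^ 2 + ∑' k, a k * ‖B k y‖ₑ ^ 2 := by
  set q : H → ℝ≥0∞ := fun x => ∑' k, a k * ‖B k x‖ₑ ^ 2 with hq
  have par : ∀ u v : H, q (u + v) + q (u - v) = 2 * (q u + q v) := by
    intro u v
    simp only [hq]
    rw [← ENNReal.tsum_add, ← ENNReal.tsum_add, ← ENNReal.tsum_mul_left]
    refine tsum_congr fun k => ?_
    rw [← mul_add, ← mul_add, mul_left_comm]
    congr 1
    have := parallelogram_law_with_norm ℂ (B k u) (B k v)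
    rw [map_add, map_sub]
    simp only [← ofReal_norm, ← ENNReal.ofReal_pow (norm_nonneg _)]
    rw [← ENNReal.ofReal_add (by positivity) (by positivity),
      ← ENNReal.ofReal_add (by positivity) (by positivity),
      show (2 : ℝ≥0∞) = ENNReal.ofReal 2 by simp, ← ENNReal.ofReal_mul (by norm_num)]
    congr 1
  have hI : ∀ u : H, q (Complex.I • u) = q u := by
    intro u
    simp [hq, map_smul, enorm_smul, enorm_I]
  have key : inner ℂ x (T y) = (inner ℂ (x + y) (T (x + y)) - inner ℂ (x - y) (T (x - y)) -
      Complex.I * inner ℂ (x + Complex.I • y) (T (x + Complex.I • y)) +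
      Complex.I * inner ℂ (x - Complex.I • y) (T (x - Complex.I • y))) / 4 := by
    simp only [map_add, map_sub, map_smul, inner_add_left, inner_add_right, inner_sub_left,
      inner_sub_right, inner_smul_left, inner_smul_right, Complex.conj_I]
    ring_nf
    simp only [Complex.I_sq]
    ring
  have e4 : ‖(4 : ℂ)⁻¹‖ₑ = (4 : ℝ≥0∞)⁻¹ := by
    rw [enorm_inv (by norm_num)]
    congr 1
    rw [← ofReal_norm]; simp
  have h1 : ‖inner ℂ x (T y)‖ₑ ≤ 4⁻¹ * (q (x + y) + q (x - y) + q (x + Complex.I • y)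
      + q (x - Complex.I • y)) := by
    rw [key, div_eq_inv_mul, enorm_mul, e4]
    gcongr
    refine (enorm_add_le _ _).trans (add_le_add ((enorm_sub_le).trans (add_le_add
      ((enorm_sub_le).trans (add_le_add (h _) (h _))) ?_)) ?_)
    · rw [enorm_mul, enorm_I, one_mul]; exact h _
    · rw [enorm_mul, enorm_I, one_mul]; exact h _
  refine h1.trans (le_of_eq ?_)
  rw [add_assoc, par x y, par x (Complex.I • y), hI, ← mul_add, ← two_mul, ← mul_assoc, ← mul_assoc,
    mul_assoc 4⁻¹]
  norm_num
  rw [ENNReal.inv_mul_cancel (by norm_num) (by norm_num), one_mul]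

/-- Take V = (S + ε)⁻¹; the order relation is t - t²/(t + ε) ≤ ε on the spectrum. Applied to S =
|T|, it stands in for the inverse that the polar decomposition would need. -/
lemma exists_regularized_inverse {A : Type*} [CStarAlgebra A] [PartialOrder A] [StarOrderedRing A]
    (S : A) (hS0 : 0 ≤ S) {ε : ℝ} (hε : 0 < ε) :
    ∃ V : A, IsSelfAdjoint V ∧ ‖S * V‖ ≤ 1 ∧ S ≤ V * (S * S) + algebraMap ℝ A ε := by
  have hSsa : IsSelfAdjoint S := hS0.isSelfAdjoint
  have hsp : ∀ t ∈ spectrum ℝ S, 0 ≤ t := fun t ht => spectrum_nonneg_of_nonneg hS0 ht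
  have hc : ContinuousOn (fun t : ℝ => (t + ε)⁻¹) (spectrum ℝ S) :=
    ContinuousOn.inv₀ (by fun_prop) fun t ht => by have := hsp t ht; positivity
  have hid : ContinuousOn (fun t : ℝ => t) (spectrum ℝ S) := continuousOn_id
  have hsq : ContinuousOn (fun t : ℝ => t * t) (spectrum ℝ S) := by fun_prop
  refine ⟨cfc (fun t : ℝ => (t + ε)⁻¹) S, cfc_predicate (R := ℝ) _ S, ?_, ?_⟩
  · have hSV : S * cfc (fun t : ℝ => (t + ε)⁻¹) S = cfc (fun t : ℝ => t * (t + ε)⁻¹) S := by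
      rw [cfc_mul (fun t : ℝ => t) _ S hid hc, cfc_id' ℝ S]
    rw [hSV]
    refine norm_cfc_le zero_le_one fun t ht => ?_
    have := hsp t ht
    rw [Real.norm_of_nonneg (by positivity), ← div_eq_mul_inv, div_le_one (by positivity)]
    linarith
  · have e : cfc (fun t : ℝ => (t + ε)⁻¹) S * (S * S) + algebraMap ℝ A ε =
        cfc (fun t : ℝ => (t + ε)⁻¹ * (t * t) + ε) S := by
      rw [cfc_add_const ε (fun t : ℝ => (t + ε)⁻¹ * (t * t)) S (hc.mul hsq),
        cfc_mul _ (fun t : ℝ => t * t) S hc hsq,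
        cfc_mul (fun t : ℝ => t) (fun t : ℝ => t) S hid hid, cfc_id' ℝ S]
    rw [e]
    conv_lhs => rw [← cfc_id' ℝ S]
    rw [cfc_le_iff _ (fun t : ℝ => (t + ε)⁻¹ * (t * t) + ε) S hid
      ((hc.mul hsq).add continuousOn_const)]
    intro t ht
    have := hsp t ht
    rw [← sub_nonneg]
    have : (t + ε)⁻¹ * (t * t) + ε - t = ε ^ 2 / (t + ε) := by field_simp; ring
    rw [this]; positivity

/-- A regularized polar decomposition. -/
lemma exists_contraction_abs (T : H →L[ℂ] H) {ε : ℝ} (hε : 0 < ε) :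
    ∃ U : H →L[ℂ] H, ‖U‖ ≤ 1 ∧ ∀ x : H, ‖x‖ = 1 →
      0 ≤ (inner ℂ x (CFC.abs T x)).re ∧ (inner ℂ x (CFC.abs T x)).im = 0 ∧
      (inner ℂ x (CFC.abs T x)).re ≤ ‖inner ℂ (U x) (T x)‖ + ε := by
  set S := CFC.abs T with hS
  have hS0 : 0 ≤ S := CFC.abs_nonneg T
  have hSsa : IsSelfAdjoint S := hS0.isSelfAdjoint
  obtain ⟨V, hV, hSV, h2⟩ := exists_regularized_inverse S hS0 hε
  have hVsa : ContinuousLinearMap.adjoint V = V := hV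
  have hTT : ∀ x, ‖T x‖ = ‖S x‖ := by
    intro x
    have h1 : S * S = star T * T := CFC.abs_mul_abs T
    have h2 : inner ℂ (S x) (S x) = inner ℂ (T x) (T x) := by
      have h3 : inner ℂ (S x) (S x) = inner ℂ x ((S * S) x) := by
        have hSa : ContinuousLinearMap.adjoint S = S := hSsa
        rw [mul_apply_eq_comp, ← ContinuousLinearMap.adjoint_inner_left S (S x) x, hSa]
      rw [h3, h1, ContinuousLinearMap.star_eq_adjoint, mul_apply_eq_comp,
        ContinuousLinearMap.adjoint_inner_right]
    rw [inner_self_eq_norm_sq_to_K, inner_self_eq_norm_sq_to_K] at h2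
    have h3 : ‖S x‖ ^ 2 = ‖T x‖ ^ 2 := by exact_mod_cast h2
    exact ((sq_eq_sq₀ (norm_nonneg _) (norm_nonneg _)).1 h3).symm
  -- `T * V` is an approximate partial isometry: ‖TVx‖ = ‖|T|Vx‖ ≤ ‖x‖, while ⟨TVx, Tx⟩ = ⟨x,
  -- V|T|²x⟩, which is at least ⟨x, |T|x⟩ - ε for unit vectors.
  refine ⟨T * V, ?_, fun x hx => ?_⟩
  · refine ContinuousLinearMap.opNorm_le_bound _ zero_le_one fun x => ?_
    rw [mul_apply_eq_comp, hTT, ← mul_apply_eq_comp]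
    refine (ContinuousLinearMap.le_opNorm _ _).trans ?_
    gcongr
  · have hpos := (ContinuousLinearMap.nonneg_iff_isPositive S).1 hS0
    have hp := hpos.inner_nonneg_right x
    rw [Complex.le_def] at hp
    refine ⟨by simpa using hp.1, by simpa using hp.2.symm, ?_⟩
    have h1 : inner ℂ ((T * V) x) (T x) = inner ℂ x ((V * (S * S)) x) := by
      rw [CFC.abs_mul_abs T, mul_apply_eq_comp, mul_apply_eq_comp,
        mul_apply_eq_comp, ContinuousLinearMap.star_eq_adjoint,
        ← ContinuousLinearMap.adjoint_inner_left V, hVsa,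
        ContinuousLinearMap.adjoint_inner_right]
    have h3 := (ContinuousLinearMap.nonneg_iff_isPositive _).1 (sub_nonneg.2 h2)
    have h4 := (Complex.le_def.1 (h3.inner_nonneg_right x)).1
    have h5 : inner ℂ x ((algebraMap ℝ (H →L[ℂ] H) ε) x) = (ε : ℂ) := by
      rw [Algebra.algebraMap_eq_smul_one, smul_apply,
        one_apply_eq_self, ← Complex.coe_smul, inner_smul_right,
        inner_self_eq_norm_sq_to_K, hx]
      simp
    rw [sub_apply, add_apply, inner_sub_right,
      inner_add_right, h5, ← h1] at h4
    simp at h4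
    have := Complex.re_le_norm (inner ℂ (T (V x)) (T x))
    rw [mul_apply_eq_comp]
    linarith

/-- A bound on the diagonal of the form of `T` suffices: ⟨x, |T|x⟩ is at most |⟨Ux, Tx⟩| + ε for a
contraction `U`, polarization bounds this by the forms at `Ux` and at `x`, and composing `B k` with
`U` does not increase Hilbert–Schmidt norms. -/
lemma isTraceClass_of_quadratic {ι : Type*} (T : H →L[ℂ] H) (a : ι → ℝ≥0∞)
    (B : ι → H →L[ℂ] K)
    (h : ∀ x, ‖inner ℂ x (T x)‖ₑ ≤ ∑' k, a k * ‖B k x‖ₑ ^ 2)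
    (hfin : ∑' k, a k * hsq (B k) ≠ ∞) : IsTraceClass T := by
  intro w b
  set C : ℝ≥0∞ := ∑' k, a k * hsq (B k) with hC
  have h0 : ∀ i, (inner ℂ (b i) (CFC.abs T (b i))).im = 0 ∧
      0 ≤ (inner ℂ (b i) (CFC.abs T (b i))).re := fun i => by
    obtain ⟨U, -, hU⟩ := exists_contraction_abs T zero_lt_one
    exact ⟨(hU (b i) (b.orthonormal.1 i)).2.1, (hU (b i) (b.orthonormal.1 i)).1⟩
  have hsum : Summable fun i => (inner ℂ (b i) (CFC.abs T (b i))).re := by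
    refine summable_of_sum_le (c := (C + C).toReal) (fun i => (h0 i).2) fun s => ?_
    have hb : ∀ ε : ℝ, 0 < ε →
        ∑ i ∈ s, (inner ℂ (b i) (CFC.abs T (b i))).re ≤ (C + C).toReal + s.card * ε := by
      intro ε hε
      obtain ⟨U, hU1, hU⟩ := exists_contraction_abs T hε
      have h1 : ∑ i ∈ s, ‖inner ℂ (U (b i)) (T (b i))‖ₑ ≤ C + C := by
        calc ∑ i ∈ s, ‖inner ℂ (U (b i)) (T (b i))‖ₑ
            ≤ ∑' i, ‖inner ℂ (U (b i)) (T (b i))‖ₑ := ENNReal.sum_le_tsum s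
          _ ≤ ∑' i, (∑' k, a k * ‖B k (U (b i))‖ₑ ^ 2 + ∑' k, a k * ‖B k (b i)‖ₑ ^ 2) :=
              ENNReal.tsum_le_tsum fun i => norm_inner_le_add_of_quadratic T a B h _ _
          _ = ∑' k, a k * hsq (B k ∘L U) + ∑' k, a k * hsq (B k) := by
              rw [ENNReal.tsum_add, ENNReal.tsum_comm]
              congr 1
              · refine tsum_congr fun k => ?_
                rw [ENNReal.tsum_mul_left, hsq_eq b]; rfl
              · rw [ENNReal.tsum_comm]
                refine tsum_congr fun k => ?_
                rw [ENNReal.tsum_mul_left, hsq_eq b]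
          _ ≤ C + C := by
              refine add_le_add (ENNReal.tsum_le_tsum fun k => ?_) le_rfl
              gcongr
              refine (hsq_comp_le' (B _) U).trans ?_
              have : ‖U‖ₑ ≤ 1 := by
                rw [← ofReal_norm]; exact ENNReal.ofReal_le_one.2 hU1
              calc ‖U‖ₑ ^ 2 * _ ≤ 1 ^ 2 * _ := by gcongr
                _ = _ := by simp
      have h2 : ∑ i ∈ s, ‖inner ℂ (U (b i)) (T (b i))‖ ≤ (C + C).toReal := by
        have := ENNReal.toReal_mono (by simpa using hfin) h1
        rw [ENNReal.toReal_sum (by simp)] at this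
        simpa using this
      calc ∑ i ∈ s, (inner ℂ (b i) (CFC.abs T (b i))).re
          ≤ ∑ i ∈ s, (‖inner ℂ (U (b i)) (T (b i))‖ + ε) :=
            Finset.sum_le_sum fun i _ => (hU (b i) (b.orthonormal.1 i)).2.2
        _ ≤ _ := by rw [Finset.sum_add_distrib]; simpa using h2
    -- The finite set `s` is fixed, so the error `s.card * ε` can be made smaller than any supposed
    -- excess `d`.
    by_contra! hlt
    set d := ∑ i ∈ s, (inner ℂ (b i) (CFC.abs T (b i))).re - (C + C).toReal
    have hd : 0 < d := sub_pos.2 hlt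
    have h3 := hb (d / (2 * (s.card + 1))) (by positivity)
    have h4 : (s.card : ℝ) * (d / (2 * (s.card + 1))) < d := by
      rw [← mul_div_assoc, div_lt_iff₀ (by positivity)]
      nlinarith [(Nat.cast_nonneg s.card : (0 : ℝ) ≤ s.card)]
    simp only [d] at h3 h4
    linarith
  have he : (fun i => inner ℂ (b i) (CFC.abs T (b i))) =
      fun i => (((inner ℂ (b i) (CFC.abs T (b i))).re : ℝ) : ℂ) := by
    ext i
    exact Complex.ext rfl (by simpa using (h0 i).1)
  rw [he]
  exact (Complex.hasSum_ofReal.2 hsum.hasSum).summable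

/-- The trace norm of an operator of rank at most `r`. -/
lemma tsum_enorm_inner_le_of_range {ι : Type*} (b : HilbertBasis ι ℂ H) (D : H →L[ℂ] H)
    (F : Submodule ℂ H) [FiniteDimensional ℂ F] (hF : ∀ x, D x ∈ F) :
    ∑' i, ‖inner ℂ (b i) (D (b i))‖ₑ ≤ Module.finrank ℂ F * ‖D‖ₑ := by
  set v := stdOrthonormalBasis ℂ F
  have hD : ∀ x, D x = ∑ k, inner ℂ ((v k : F) : H) (D x) • ((v k : F) : H) := by
    intro x
    have := congrArg (Subtype.val) (v.sum_repr' ⟨D x, hF x⟩)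
    simpa using this.symm
  -- Each rank one piece is handled by Cauchy–Schwarz and Parseval for the vectors D*v_k and v_k,
  -- the latter of norm 1.
  have hk : ∀ k, ∑' i, ‖inner ℂ ((v k : F) : H) (D (b i)) * inner ℂ (b i) ((v k : F) : H)‖ₑ
      ≤ ‖D‖ₑ := by
    intro k
    set y : H := ContinuousLinearMap.adjoint D (v k : F)
    have hv : ‖((v k : F) : H)‖ₑ = 1 := by
      rw [← ofReal_norm, Submodule.norm_coe, v.orthonormal.1 k]; simp
    have hy : ‖y‖ₑ ≤ ‖D‖ₑ := by
      refine (ContinuousLinearMap.le_opENorm _ _).trans (le_of_eq ?_)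
      rw [hv, mul_one]
      simp [enorm, nnnorm]
    have e : ∀ i, inner ℂ ((v k : F) : H) (D (b i)) = conj (inner ℂ (b i) y) := fun i => by
      rw [inner_conj_symm, ContinuousLinearMap.adjoint_inner_left]
    simp_rw [enorm_mul, e]
    simp_rw [enorm_conj]
    have hcs : ∑' i, ‖inner ℂ (b i) y‖ₑ * ‖inner ℂ (b i) ((v k : F) : H)‖ₑ ≤
        (∑' i, ‖inner ℂ (b i) y‖ₑ ^ (2 : ℝ)) ^ (1 / 2 : ℝ) *
        (∑' i, ‖inner ℂ (b i) ((v k : F) : H)‖ₑ ^ (2 : ℝ)) ^ (1 / 2 : ℝ) := by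
      rw [ENNReal.tsum_eq_iSup_sum]
      refine iSup_le fun s => ?_
      refine (ENNReal.inner_le_Lp_mul_Lq s _ _ Real.HolderConjugate.two_two).trans ?_
      gcongr <;> exact ENNReal.sum_le_tsum s
    refine hcs.trans ?_
    have e2 : ∀ x : H, (∑' i, ‖inner ℂ (b i) x‖ₑ ^ (2 : ℝ)) ^ (1 / 2 : ℝ) = ‖x‖ₑ := by
      intro x
      have := tsum_enorm_inner_sq b x
      simp only [ENNReal.rpow_two]
      rw [this, ← ENNReal.rpow_two, ← ENNReal.rpow_mul]
      norm_num
    rw [e2, e2, hv, mul_one]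
    exact hy
  calc ∑' i, ‖inner ℂ (b i) (D (b i))‖ₑ
      ≤ ∑' i, ∑ k, ‖inner ℂ ((v k : F) : H) (D (b i)) * inner ℂ (b i) ((v k : F) : H)‖ₑ := by
        refine ENNReal.tsum_le_tsum fun i => ?_
        conv_lhs => rw [hD (b i), inner_sum]
        refine (enorm_sum_le _ _).trans (Finset.sum_le_sum fun k _ => ?_)
        rw [inner_smul_right]
    _ = ∑ k, ∑' i, ‖inner ℂ ((v k : F) : H) (D (b i)) * inner ℂ (b i) ((v k : F) : H)‖ₑ :=
        Summable.tsum_finsetSum fun _ _ => ENNReal.summable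
    _ ≤ ∑ _k : Fin (Module.finrank ℂ F), ‖D‖ₑ := Finset.sum_le_sum fun k _ => hk k
    _ = _ := by simp

end HilbertSchmidt
end RandomDirac
end

noncomputable section
set_option linter.unusedSectionVars false
namespace RandomDirac
open scoped ENNReal NNReal ComplexConjugate BoundedContinuousFunction

/-! ### Poisson kernels measured against the Cauchy weight. -/

section Poisson

/-- The Poisson kernel of the upper half plane (up to the factor `π`). -/
def poisson (s y t : ℝ) : ℝ := y / ((t - s) ^ 2 + y ^ 2)

/-- The Cauchy weight. -/
def cauchyWt (t : ℝ) : ℝ := (1 + t ^ 2)⁻¹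

lemma cauchyWt_pos (t : ℝ) : 0 < cauchyWt t := by unfold cauchyWt; positivity

lemma continuous_cauchyWt : Continuous cauchyWt := by
  unfold cauchyWt
  exact Continuous.inv₀ (by fun_prop) fun t => by positivity

lemma poisson_pos {y : ℝ} (hy : 0 < y) (s t : ℝ) : 0 < poisson s y t := by
  unfold poisson; positivity

lemma continuous_poisson {y : ℝ} (hy : 0 < y) (s : ℝ) : Continuous (poisson s y) := by
  unfold poisson
  exact Continuous.div (by fun_prop) (by fun_prop) fun t => by positivity

/-- The constant in the comparison of a Poisson kernel with the Cauchy weight. -/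
def poissonConst (y s : ℝ) : ℝ := 2 + (1 + 2 * s ^ 2) / y ^ 2

lemma one_add_sq_le {y : ℝ} (hy : 0 < y) (s t : ℝ) :
    (1 + t ^ 2) / ((t - s) ^ 2 + y ^ 2) ≤ poissonConst y s := by
  rw [div_le_iff₀ (by positivity), poissonConst]
  have h : (2 + (1 + 2 * s ^ 2) / y ^ 2) * ((t - s) ^ 2 + y ^ 2) =
      2 * (t - s) ^ 2 + 2 * y ^ 2 + (1 + 2 * s ^ 2) / y ^ 2 * (t - s) ^ 2 + (1 + 2 * s ^ 2) := by
    field_simp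
    ring
  rw [h]
  have : 0 ≤ (1 + 2 * s ^ 2) / y ^ 2 * (t - s) ^ 2 := by positivity
  nlinarith [sq_nonneg (t - 2 * s), sq_nonneg y]

/-- The Poisson kernel divided by the Cauchy weight. -/
def poissonBCF {y : ℝ} (hy : 0 < y) (s : ℝ) : ℝ →ᵇ ℝ :=
  BoundedContinuousFunction.ofNormedAddCommGroup (fun t => (1 + t ^ 2) * poisson s y t)
    (by have := continuous_poisson hy s; fun_prop) (poissonConst y s * y) (fun t => by
      have h := one_add_sq_le hy s t
      have h1 := poisson_pos hy s t
      rw [Real.norm_of_nonneg (by positivity)]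
      unfold poisson
      calc (1 + t ^ 2) * (y / ((t - s) ^ 2 + y ^ 2))
          = (1 + t ^ 2) / ((t - s) ^ 2 + y ^ 2) * y := by ring
        _ ≤ _ := by gcongr)

lemma poissonBCF_apply {y : ℝ} (hy : 0 < y) (s t : ℝ) :
    poissonBCF hy s t = (1 + t ^ 2) * poisson s y t := rfl

/-- After factoring out s - s', what remains is |y(u + v)| ≤ (u² + y²) + (v² + y²). The bound keeps
the decay t⁻², so that it survives the weight 1 + t² and gives continuity in `s` in the sup norm. -/
lemma abs_poisson_sub_le {y : ℝ} (hy : 0 < y) (s s' t : ℝ) :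
    |poisson s y t - poisson s' y t| ≤
      |s - s'| * (((t - s) ^ 2 + y ^ 2)⁻¹ + ((t - s') ^ 2 + y ^ 2)⁻¹) := by
  unfold poisson
  set u := t - s
  set v := t - s'
  have huv : s - s' = v - u := by simp [u, v]
  have e : y / (u ^ 2 + y ^ 2) - y / (v ^ 2 + y ^ 2) =
      (s - s') * (y * (v + u)) / ((u ^ 2 + y ^ 2) * (v ^ 2 + y ^ 2)) := by
    rw [huv]; field_simp; ring
  rw [e, abs_div, abs_mul, mul_div_assoc, abs_of_pos (a := (u ^ 2 + y ^ 2) * _) (by positivity)]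
  refine mul_le_mul_of_nonneg_left ?_ (abs_nonneg _)
  rw [div_le_iff₀ (by positivity)]
  have e2 : ((u ^ 2 + y ^ 2)⁻¹ + (v ^ 2 + y ^ 2)⁻¹) * ((u ^ 2 + y ^ 2) * (v ^ 2 + y ^ 2)) =
      (v ^ 2 + y ^ 2) + (u ^ 2 + y ^ 2) := by field_simp
  rw [e2, abs_le]
  constructor <;> nlinarith [sq_nonneg (y - v), sq_nonneg (y - u), sq_nonneg (y + v),
    sq_nonneg (y + u)]

lemma continuous_poissonBCF {y : ℝ} (hy : 0 < y) : Continuous (poissonBCF hy) := by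
  rw [continuous_iff_continuousAt]
  intro s₀
  rw [ContinuousAt, tendsto_iff_dist_tendsto_zero]
  have hlim : Tendsto (fun s => |s - s₀| * (poissonConst y s + poissonConst y s₀)) (𝓝 s₀)
      (𝓝 0) := by
    have hc : Continuous fun s => |s - s₀| * (poissonConst y s + poissonConst y s₀) := by
      unfold poissonConst; fun_prop
    simpa using hc.tendsto s₀
  refine squeeze_zero (fun _ => dist_nonneg) (fun s => ?_) hlim
  have hK : ∀ s, 0 ≤ poissonConst y s := fun s => by unfold poissonConst; positivity
  rw [BoundedContinuousFunction.dist_le (mul_nonneg (abs_nonneg _) (add_nonneg (hK _) (hK _)))]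
  intro t
  rw [poissonBCF_apply, poissonBCF_apply, Real.dist_eq, ← mul_sub, abs_mul,
    abs_of_pos (by positivity : 0 < 1 + t ^ 2)]
  calc (1 + t ^ 2) * |poisson s y t - poisson s₀ y t|
      ≤ (1 + t ^ 2) * (|s - s₀| * (((t - s) ^ 2 + y ^ 2)⁻¹ + ((t - s₀) ^ 2 + y ^ 2)⁻¹)) := by
        gcongr; exact abs_poisson_sub_le hy s s₀ t
    _ = |s - s₀| * ((1 + t ^ 2) / ((t - s) ^ 2 + y ^ 2) + (1 + t ^ 2) / ((t - s₀) ^ 2 + y ^ 2)) := by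
        ring
    _ ≤ _ := by gcongr <;> exact one_add_sq_le hy _ _

lemma integral_poisson {y : ℝ} (hy : 0 < y) (t : ℝ) : ∫ s, poisson s y t = Real.pi := by
  have h1 : ∀ s, poisson s y t = (fun u => (fun r : ℝ => y⁻¹ * (1 + r ^ 2)⁻¹) (u / y)) (t - s) := by
    intro s
    simp only [poisson]
    field_simp
    rw [add_comm]
  simp_rw [h1]
  rw [integral_sub_left_eq_self (fun u : ℝ => (fun r : ℝ => y⁻¹ * (1 + r ^ 2)⁻¹) (u / y)),
    Measure.integral_comp_div (fun r : ℝ => y⁻¹ * (1 + r ^ 2)⁻¹) y, integral_const_mul, integral_univ_inv_one_add_sq, abs_of_pos hy,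
    smul_eq_mul, ← mul_assoc, mul_inv_cancel₀ hy.ne', one_mul]

lemma integrable_poisson {y : ℝ} (hy : 0 < y) (t : ℝ) : Integrable fun s => poisson s y t := by
  by_contra h
  have := integral_poisson hy t
  rw [integral_undef h] at this
  exact Real.pi_pos.ne this

/-- Poisson regularizations converge uniformly with the Cauchy weight. -/
lemma exists_poisson_approx (f : ℝ → ℝ) (hf : Continuous f) (hfc : HasCompactSupport f) {ε : ℝ}
    (hε : 0 < ε) : ∃ δ > 0, ∀ y, 0 < y → y < δ → ∀ t,
      (1 + t ^ 2) * |Real.pi⁻¹ * (∫ s, f s * poisson s y t) - f t| ≤ ε := by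
  obtain ⟨K, hK1, hK⟩ : ∃ K : ℝ, 1 ≤ K ∧ ∀ s, K < |s| → f s = 0 := by
    obtain ⟨K, hK⟩ := hfc.isCompact.isBounded.subset_closedBall 0
    refine ⟨max K 1, le_max_right _ _, fun s hs => ?_⟩
    refine image_eq_zero_of_notMem_tsupport fun h => ?_
    have := hK h
    rw [mem_closedBall_zero_iff, Real.norm_eq_abs] at this
    exact absurd (hs.trans_le this) (not_lt.2 (le_max_left _ _))
  obtain ⟨M, hM0, hM⟩ : ∃ M : ℝ, 0 < M ∧ ∀ s, |f s| ≤ M := by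
    obtain ⟨C, hC⟩ := hfc.exists_bound_of_continuous hf
    exact ⟨max C 1, by positivity, fun s => (hC s).trans (le_max_left _ _)⟩
  have huc := hfc.uniformContinuous_of_continuous hf
  -- The final estimate has two contributions of size ε', multiplied by a weight of at most 1 + 4K².
  set ε' := ε / (2 * (1 + 4 * K ^ 2)) with hε'
  have hε'0 : 0 < ε' := by positivity
  obtain ⟨η, hη, hfη⟩ := Metric.uniformContinuous_iff.1 huc ε' hε'0
  have hpi := Real.pi_pos
  refine ⟨min (ε' / (2 * M * (1 + (η ^ 2)⁻¹))) (ε / (16 * K * M)), by positivity, ?_⟩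
  intro y hy hyδ t
  have hy1 := hyδ.trans_le (min_le_left _ _)
  have hy2 := hyδ.trans_le (min_le_right _ _)
  have hint := integrable_poisson hy t
  have hP := integral_poisson hy t
  have hintf : Integrable fun s => f s * poisson s y t :=
    hint.bdd_mul (c := M) hf.aestronglyMeasurable (ae_of_all _ hM)
  have hdiff : Real.pi⁻¹ * (∫ s, f s * poisson s y t) - f t =
      Real.pi⁻¹ * ∫ s, (f s - f t) * poisson s y t := by
    simp_rw [sub_mul]
    rw [integral_sub hintf (hint.const_mul _), integral_const_mul, hP]
    field_simp
  -- Far from the support of `f`, |t - s| ≥ |t|/2 bounds the kernel by 4y/t², which absorbs the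
  -- weight. Near the support the weight is bounded and the usual approximate identity argument,
  -- split at distance η, applies.
  by_cases ht : 2 * K < |t|
  · have hft : f t = 0 := hK t (by linarith)
    have ht1 : 4 * K ^ 2 ≤ t ^ 2 := by
      rw [← sq_abs t]; nlinarith
    have hb : |∫ s, f s * poisson s y t| ≤ 2 * K * (M * (4 * y / t ^ 2)) := by
      have h1 : ∫ s, f s * poisson s y t = ∫ s in Icc (-K) K, f s * poisson s y t := by
        rw [setIntegral_eq_integral_of_forall_compl_eq_zero]
        intro s hs
        rw [hK s, zero_mul]
        by_contra! h
        exact hs (abs_le.1 h)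
      rw [h1]
      have h2 := norm_setIntegral_le_of_norm_le_const (μ := volume) (s := Icc (-K) K)
        (f := fun s => f s * poisson s y t) (C := M * (4 * y / t ^ 2)) (by simp) (fun s hs => by
          rw [norm_mul]
          have hp := poisson_pos hy s t
          rw [Real.norm_of_nonneg hp.le]
          refine mul_le_mul (hM s) ?_ hp.le hM0.le
          unfold poisson
          have hs' : |s| ≤ K := abs_le.2 hs
          have : t ^ 2 ≤ 4 * ((t - s) ^ 2 + y ^ 2) := by
            have h3 : |t| ≤ 2 * |t - s| := by
              have := abs_sub_abs_le_abs_sub t s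
              linarith
            have := sq_le_sq' (by linarith [abs_nonneg t, abs_nonneg (t-s)]) h3
            rw [sq_abs, mul_pow, sq_abs] at this
            nlinarith [sq_nonneg y]
          rw [div_le_div_iff₀ (by positivity) (by nlinarith)]
          nlinarith)
      rw [Real.norm_eq_abs] at h2
      refine h2.trans (le_of_eq ?_)
      rw [Measure.real, Real.volume_Icc, ENNReal.toReal_ofReal (by linarith)]
      ring
    rw [hft, sub_zero, abs_mul, abs_of_pos (inv_pos.2 hpi)]
    have hpi1 : Real.pi⁻¹ ≤ 1 := inv_le_one_of_one_le₀ (by linarith [Real.pi_gt_three])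
    have ht2 : 1 ≤ t ^ 2 := by nlinarith
    calc (1 + t ^ 2) * (Real.pi⁻¹ * |∫ s, f s * poisson s y t|)
        ≤ (2 * t ^ 2) * (1 * (2 * K * (M * (4 * y / t ^ 2)))) := by
          gcongr; linarith
      _ = 16 * K * M * y := by
          have : t ≠ 0 := by rintro rfl; norm_num at ht2
          field_simp; ring
      _ ≤ ε := by
          rw [lt_div_iff₀ (by positivity)] at hy2
          linarith
  · rw [not_lt] at ht
    have ht1 : t ^ 2 ≤ 4 * K ^ 2 := by
      rw [← sq_abs t]; nlinarith [abs_nonneg t]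
    have hcw : Integrable fun s : ℝ => (1 + (t - s) ^ 2)⁻¹ :=
      integrable_inv_one_add_sq.comp_sub_left t
    have hcwi : ∫ s : ℝ, (1 + (t - s) ^ 2)⁻¹ = Real.pi := by
      rw [integral_sub_left_eq_self (fun s : ℝ => (1 + s ^ 2)⁻¹), integral_univ_inv_one_add_sq]
    have hpt : ∀ s, ‖(f s - f t) * poisson s y t‖ ≤ ε' * poisson s y t +
        2 * M * y * (1 + (η ^ 2)⁻¹) * (1 + (t - s) ^ 2)⁻¹ := by
      intro s
      have hp := poisson_pos hy s t
      rw [norm_mul, Real.norm_of_nonneg hp.le, Real.norm_eq_abs]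
      by_cases hs : dist s t < η
      · have h1 := (hfη hs).le
        rw [Real.dist_eq] at h1
        have : 0 ≤ 2 * M * y * (1 + (η ^ 2)⁻¹) * (1 + (t - s) ^ 2)⁻¹ := by positivity
        nlinarith
      · rw [not_lt, dist_comm, Real.dist_eq] at hs
        have h1 : |f s - f t| ≤ 2 * M := by
          have := abs_sub (f s) (f t); linarith [hM s, hM t]
        have h2 : η ^ 2 ≤ (t - s) ^ 2 := by rw [← sq_abs (t - s)]; gcongr
        have h3 : poisson s y t ≤ y * (1 + (η ^ 2)⁻¹) * (1 + (t - s) ^ 2)⁻¹ := by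
          unfold poisson
          rw [← div_eq_mul_inv, div_le_div_iff₀ (by positivity) (by positivity), mul_assoc]
          refine mul_le_mul_of_nonneg_left ?_ hy.le
          have h4 : 1 ≤ (η ^ 2)⁻¹ * (t - s) ^ 2 := by
            rw [inv_mul_eq_div, le_div_iff₀ (by positivity)]; linarith
          have : 0 ≤ (1 + (η ^ 2)⁻¹) * y ^ 2 := by positivity
          nlinarith
        calc |f s - f t| * poisson s y t
            ≤ 2 * M * (y * (1 + (η ^ 2)⁻¹) * (1 + (t - s) ^ 2)⁻¹) := by gcongr
          _ ≤ _ := by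
            have : 0 ≤ ε' * poisson s y t := by positivity
            linarith
    have hb : |∫ s, (f s - f t) * poisson s y t| ≤
        (ε' + 2 * M * y * (1 + (η ^ 2)⁻¹)) * Real.pi := by
      have := norm_integral_le_of_norm_le
        ((hint.const_mul ε').add (hcw.const_mul (2 * M * y * (1 + (η ^ 2)⁻¹)))) (ae_of_all _ hpt)
      rw [Real.norm_eq_abs] at this
      refine this.trans (le_of_eq ?_)
      simp only [Pi.add_apply]
      rw [integral_add (hint.const_mul ε') (hcw.const_mul _), integral_const_mul,
        integral_const_mul, hP, hcwi]
      ring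
    rw [hdiff, abs_mul, abs_of_pos (inv_pos.2 hpi)]
    have hy3 : 2 * M * y * (1 + (η ^ 2)⁻¹) ≤ ε' := by
      rw [lt_div_iff₀ (by positivity)] at hy1
      linarith
    calc (1 + t ^ 2) * (Real.pi⁻¹ * |∫ s, (f s - f t) * poisson s y t|)
        ≤ (1 + 4 * K ^ 2) * (Real.pi⁻¹ * ((ε' + ε') * Real.pi)) := by
          gcongr
          refine hb.trans ?_
          gcongr
      _ = ε := by rw [hε']; field_simp; ring

end Poisson
end RandomDirac
end

noncomputable section
set_option linter.unusedSectionVars false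
namespace RandomDirac
open scoped ENNReal NNReal ComplexConjugate BoundedContinuousFunction

/-! ### Convergence of measures tested on Poisson kernels. -/

section Convergence

variable {ι : Type*} {F : Filter ι}

/-- The approximate limit may depend on ε. In the application it is a mean over cells whose length
grows as ε shrinks. -/
lemma exists_tendsto_of_approx {E : Type*} [NormedAddCommGroup E] [CompleteSpace E] {x : ι → E}
    (h : ∀ ε > 0, ∃ a, ∀ᶠ i in F, ‖x i - a‖ ≤ ε) : ∃ ν, Tendsto x F (𝓝 ν) := by
  rcases F.eq_or_neBot with rfl | hF
  · exact ⟨0, tendsto_bot⟩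
  refine CompleteSpace.complete (Metric.cauchy_iff.2 ⟨inferInstance, fun ε hε => ?_⟩)
  obtain ⟨a, ha⟩ := h (ε / 3) (by positivity)
  refine ⟨{z | ‖z - a‖ ≤ ε / 3}, ha, fun z hz w hw => ?_⟩
  rw [mem_ofPred_eq] at hz hw
  calc dist z w ≤ dist z a + dist w a := dist_triangle_right _ _ _
    _ ≤ ε / 3 + ε / 3 := by rw [dist_eq_norm, dist_eq_norm]; gcongr
    _ < ε := by linarith

lemma exists_tendsto_of_tendsto_approx {E : Type*} [NormedAddCommGroup E] [CompleteSpace E]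
    {x : ι → E}
    (h : ∀ ε > 0, ∃ z : ι → E, (∃ a, Tendsto z F (𝓝 a)) ∧ ∀ᶠ i in F, ‖x i - z i‖ ≤ ε) :
    ∃ ν, Tendsto x F (𝓝 ν) := by
  refine exists_tendsto_of_approx fun ε hε => ?_
  obtain ⟨z, ⟨a, ha⟩, hz⟩ := h (ε / 2) (by positivity)
  refine ⟨a, ?_⟩
  filter_upwards [hz, (Metric.tendsto_nhds.1 ha) (ε / 2) (by positivity)] with i h1 h2
  rw [dist_eq_norm] at h2
  calc ‖x i - a‖ = ‖(x i - z i) + (z i - a)‖ := by congr 1; abel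
    _ ≤ ε / 2 + ε / 2 := (norm_add_le _ _).trans (by gcongr)
    _ = ε := by ring

/-- The measures `m` are bounded by `C` on unit intervals. -/
def UnitBound (C : ℝ≥0) (m : Measure ℝ) : Prop := ∀ k : ℤ, m (Ico (k : ℝ) (k + 1)) ≤ C

lemma UnitBound.lintegral_le {C : ℝ≥0} {m : Measure ℝ} (hm : UnitBound C m) {f : ℝ → ℝ≥0∞}
    {c : ℤ → ℝ≥0∞} (h : ∀ t, f t ≤ c ⌊t⌋) : ∫⁻ t, f t ∂m ≤ C * ∑' k, c k := by
  rw [← setLIntegral_univ, ← iUnion_Ico_intCast ℝ, lintegral_iUnion (fun _ => measurableSet_Ico)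
    (pairwise_disjoint_Ico_intCast ℝ), ← ENNReal.tsum_mul_left]
  refine ENNReal.tsum_le_tsum fun k => ?_
  calc ∫⁻ t in Ico (k : ℝ) (k + 1), f t ∂m ≤ ∫⁻ t in Ico (k : ℝ) (k + 1), c k ∂m := by
        refine setLIntegral_mono measurable_const fun t ht => ?_
        rw [← Int.floor_eq_iff.2 ht]; exact h t
    _ = c k * m (Ico (k : ℝ) (k + 1)) := by rw [setLIntegral_const]
    _ ≤ C * c k := by rw [mul_comm]; gcongr; exact hm k

lemma UnitBound.integrable {E : Type*} [NormedAddCommGroup E] {C : ℝ≥0} {m : Measure ℝ}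
    (hm : UnitBound C m) {f : ℝ → E} (hf : AEStronglyMeasurable f m) {c : ℤ → ℝ} (hc : Summable c)
    (h : ∀ t, ‖f t‖ ≤ c ⌊t⌋) : Integrable f m := by
  have hc0 : ∀ k, 0 ≤ c k := fun k => by
    have := h (k : ℝ); rw [Int.floor_intCast] at this; exact (norm_nonneg _).trans this
  refine ⟨hf, ?_⟩
  refine (hm.lintegral_le (c := fun k => ENNReal.ofReal (c k)) fun t => ?_).trans_lt ?_
  · rw [← ofReal_norm]; exact ENNReal.ofReal_le_ofReal (h t)
  · exact ENNReal.mul_lt_top (by simp) (hc.tsum_ofReal_lt_top)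

lemma UnitBound.integral_norm_le {E : Type*} [NormedAddCommGroup E] {C : ℝ≥0} {m : Measure ℝ}
    (hm : UnitBound C m) {f : ℝ → E} (hf : AEStronglyMeasurable f m) {c : ℤ → ℝ} (hc : Summable c)
    (h : ∀ t, ‖f t‖ ≤ c ⌊t⌋) : ∫ t, ‖f t‖ ∂m ≤ C * ∑' k, c k := by
  have hc0 : ∀ k, 0 ≤ c k := fun k => by
    have := h (k : ℝ); rw [Int.floor_intCast] at this; exact (norm_nonneg _).trans this
  rw [integral_norm_eq_lintegral_enorm hf]
  have h1 := hm.lintegral_le (f := fun t => ‖f t‖ₑ) (c := fun k => ENNReal.ofReal (c k))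
    fun t => by rw [← ofReal_norm]; exact ENNReal.ofReal_le_ofReal (h t)
  have h2 : (C : ℝ≥0∞) * ∑' k, ENNReal.ofReal (c k) = ENNReal.ofReal (C * ∑' k, c k) := by
    rw [ENNReal.ofReal_mul (by positivity), ENNReal.ofReal_tsum_of_nonneg hc0 hc]
    simp
  rw [h2] at h1
  refine ENNReal.toReal_le_of_le_ofReal ?_ h1
  exact mul_nonneg (by positivity) (tsum_nonneg hc0)

/-- A summable majorant of the Cauchy weight. -/
def wtSeq (k : ℤ) : ℝ := 3 * (1 + (k : ℝ) ^ 2)⁻¹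

lemma summable_wtSeq : Summable wtSeq := by
  have h : Summable fun k : ℤ => 1 / (k : ℝ) ^ 2 := Real.summable_one_div_int_pow.2 (by norm_num)
  refine Summable.mul_left _ ?_
  refine Summable.of_norm_bounded_eventually h ?_
  filter_upwards [(Set.finite_singleton (0 : ℤ)).compl_mem_cofinite] with k hk
  have : (k : ℝ) ≠ 0 := by simpa using hk
  rw [Real.norm_of_nonneg (by positivity), one_div]
  gcongr
  linarith

lemma cauchyWt_le_wtSeq (t : ℝ) : cauchyWt t ≤ wtSeq ⌊t⌋ := by
  have h1 := Int.floor_le t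
  have h2 := Int.lt_floor_add_one t
  unfold cauchyWt wtSeq
  rw [← div_eq_mul_inv, inv_eq_one_div, div_le_div_iff₀ (by positivity) (by positivity)]
  nlinarith [sq_nonneg (t - ⌊t⌋), sq_nonneg (2 * t - ⌊t⌋)]

lemma UnitBound.integrable_cauchyWt_mul {C : ℝ≥0} {m : Measure ℝ} (hm : UnitBound C m)
    (g : ℝ →ᵇ ℝ) : Integrable (fun t => g t * cauchyWt t) m := by
  refine hm.integrable (c := fun k => ‖g‖ * wtSeq k)
    (g.continuous.mul continuous_cauchyWt).aestronglyMeasurable (summable_wtSeq.mul_left _)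
    fun t => ?_
  change ‖g t * cauchyWt t‖ ≤ _
  rw [norm_mul, Real.norm_of_nonneg (cauchyWt_pos t).le]
  exact mul_le_mul (g.norm_coe_le_norm t) (cauchyWt_le_wtSeq t) (cauchyWt_pos t).le (norm_nonneg _)

lemma UnitBound.abs_integral_cauchyWt_le {C : ℝ≥0} {m : Measure ℝ} (hm : UnitBound C m)
    (g : ℝ →ᵇ ℝ) : |∫ t, g t * cauchyWt t ∂m| ≤ C * (‖g‖ * ∑' k, wtSeq k) := by
  rw [← tsum_mul_left]
  refine (norm_integral_le_integral_norm _).trans (hm.integral_norm_le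
    (g.continuous.mul continuous_cauchyWt).aestronglyMeasurable (summable_wtSeq.mul_left _)
    fun t => ?_)
  change ‖g t * cauchyWt t‖ ≤ _
  rw [norm_mul, Real.norm_of_nonneg (cauchyWt_pos t).le]
  exact mul_le_mul (g.norm_coe_le_norm t) (cauchyWt_le_wtSeq t) (cauchyWt_pos t).le (norm_nonneg _)

/-- The functions `g` such that the integrals of `g` against the weighted measures converge. -/
def convSubmodule (F : Filter ι) (m : ι → Measure ℝ) (C : ℝ≥0)
    (hC : ∀ᶠ i in F, UnitBound C (m i)) : Submodule ℝ (ℝ →ᵇ ℝ) where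
  carrier := {g | ∃ ν, Tendsto (fun i => ∫ t, g t * cauchyWt t ∂m i) F (𝓝 ν)}
  zero_mem' := ⟨0, by simpa using tendsto_const_nhds⟩
  add_mem' := by
    rintro g h ⟨ν, hν⟩ ⟨ν', hν'⟩
    refine ⟨ν + ν', (hν.add hν').congr' ?_⟩
    filter_upwards [hC] with i hi
    rw [← integral_add (hi.integrable_cauchyWt_mul g) (hi.integrable_cauchyWt_mul h)]
    simp [add_mul]
  smul_mem' := by
    rintro c g ⟨ν, hν⟩
    refine ⟨c * ν, (hν.const_mul c).congr fun i => ?_⟩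
    rw [← integral_const_mul]
    simp [mul_assoc]

/-- The unit bounds make integration against the weighted measures Lipschitz in the sup norm,
uniformly along the filter; so convergence passes to uniform limits of test functions. -/
lemma isClosed_convSubmodule (m : ι → Measure ℝ) (C : ℝ≥0)
    (hC : ∀ᶠ i in F, UnitBound C (m i)) :
    IsClosed (convSubmodule F m C hC : Set (ℝ →ᵇ ℝ)) := by
  refine isClosed_of_closure_subset fun g hg => ?_
  refine exists_tendsto_of_tendsto_approx fun ε hε => ?_
  set S := ∑' k, wtSeq k
  have hS : 0 ≤ S := tsum_nonneg fun k => by unfold wtSeq; positivity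
  obtain ⟨h, hh, hd⟩ := Metric.mem_closure_iff.1 hg (ε / (C * S + 1)) (by positivity)
  refine ⟨_, hh, ?_⟩
  filter_upwards [hC] with i hi
  rw [← integral_sub (hi.integrable_cauchyWt_mul g) (hi.integrable_cauchyWt_mul h)]
  have h1 := hi.abs_integral_cauchyWt_le (g - h)
  simp only [BoundedContinuousFunction.coe_sub, Pi.sub_apply, sub_mul] at h1
  rw [Real.norm_eq_abs]
  refine h1.trans ?_
  rw [dist_eq_norm] at hd
  rw [lt_div_iff₀ (by positivity)] at hd
  nlinarith [norm_nonneg (g - h)]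

lemma integral_mem_of_isClosed {E : Type*} [NormedAddCommGroup E] [NormedSpace ℝ E]
    [CompleteSpace E] (V : Submodule ℝ E) (hV : IsClosed (V : Set E)) {f : ℝ → E}
    (hf : Continuous f) (hfc : HasCompactSupport f) (hmem : ∀ s, f s ∈ V) : ∫ s, f s ∈ V := by
  have : CompleteSpace V := hV.completeSpace_coe
  have hcont : Continuous fun s => (⟨f s, hmem s⟩ : V) := hf.subtype_mk _
  have hcs : HasCompactSupport fun s => (⟨f s, hmem s⟩ : V) :=
    hfc.mono fun s hs h => hs (Subtype.ext h)
  have h := V.subtypeL.integral_comp_comm (hcont.integrable_of_hasCompactSupport (μ := volume) hcs)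
  change ∫ s, f s = _ at h
  rw [h]
  exact Subtype.prop _

/-- The weighted Poisson kernels with centre in the dense set `S` lie in the closed space of good
test functions; by continuity in the centre all of them do, and then also the Bochner integrals π⁻¹∫
f(s) P_s ds. These approximate `f` uniformly relative to the Cauchy weight. -/
lemma exists_tendsto_integral_of_hasCompactSupport (m : ι → Measure ℝ) (C : ℝ≥0)
    (hC : ∀ᶠ i in F, UnitBound C (m i)) (S : Set ℝ) (hS : Dense S) (y : ℕ → ℝ)
    (hy : ∀ n, 0 < y n) (hy0 : Tendsto y atTop (𝓝 0))
    (hP : ∀ s ∈ S, ∀ n, ∃ ν, Tendsto (fun i => ∫ t, poisson s (y n) t ∂m i) F (𝓝 ν))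
    (f : ℝ → ℝ) (hf : Continuous f) (hfc : HasCompactSupport f) :
    ∃ ν, Tendsto (fun i => ∫ t, f t ∂m i) F (𝓝 ν) := by
  set V := convSubmodule F m C hC with hV
  have hVc : IsClosed (V : Set (ℝ →ᵇ ℝ)) := isClosed_convSubmodule m C hC
  have hw : ∀ t a : ℝ, (1 + t ^ 2) * a * cauchyWt t = a := fun t a => by
    unfold cauchyWt; field_simp
  have hmem : ∀ n s, poissonBCF (hy n) s ∈ V := by
    intro n
    have h1 : S ⊆ (poissonBCF (hy n)) ⁻¹' (V : Set (ℝ →ᵇ ℝ)) := by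
      intro s hs
      obtain ⟨ν, hν⟩ := hP s hs n
      refine ⟨ν, hν.congr fun i => integral_congr_ae (ae_of_all _ fun t => ?_)⟩
      simp only
      rw [poissonBCF_apply, hw]
    have h2 := (hVc.preimage (continuous_poissonBCF (hy n))).closure_subset_iff.2 h1
    intro s
    exact h2 (hS s)
  obtain ⟨M, hM⟩ : ∃ M, ∀ t, ‖(1 + t ^ 2) * f t‖ ≤ M :=
    (hfc.mul_left (f := fun t : ℝ => 1 + t ^ 2)).exists_bound_of_continuous (by fun_prop)
  set g : ℝ →ᵇ ℝ := BoundedContinuousFunction.ofNormedAddCommGroup (fun t => (1 + t ^ 2) * f t)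
    (by fun_prop) M hM with hg
  have hgV : g ∈ V := by
    refine hVc.closure_subset (Metric.mem_closure_iff.2 fun ε hε => ?_)
    obtain ⟨δ, hδ, happ⟩ := exists_poisson_approx f hf hfc (half_pos hε)
    obtain ⟨n, hn⟩ := (hy0.eventually_lt_const hδ).exists
    have hcont : Continuous fun s => f s • poissonBCF (hy n) s :=
      hf.smul (continuous_poissonBCF (hy n))
    have hcs : HasCompactSupport fun s => f s • poissonBCF (hy n) s := hfc.smul_right
    have hint : Integrable fun s => f s • poissonBCF (hy n) s :=
      hcont.integrable_of_hasCompactSupport hcs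
    set h : ℝ →ᵇ ℝ := Real.pi⁻¹ • ∫ s, f s • poissonBCF (hy n) s with hh
    refine ⟨h, V.smul_mem _ (integral_mem_of_isClosed V hVc hcont hcs fun s =>
      V.smul_mem _ (hmem n s)), ?_⟩
    refine lt_of_le_of_lt ((BoundedContinuousFunction.dist_le (half_pos hε).le).2 fun t => ?_)
      (half_lt_self hε)
    have hval : h t = (1 + t ^ 2) * (Real.pi⁻¹ * ∫ s, f s * poisson s (y n) t) := by
      have h1 := (BoundedContinuousFunction.evalCLM ℝ t).integral_comp_comm hint
      have h2 : h t = Real.pi⁻¹ * (BoundedContinuousFunction.evalCLM ℝ t)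
          (∫ s, f s • poissonBCF (hy n) s) := by
        rw [hh]; rfl
      rw [h2, ← h1, mul_left_comm, ← integral_const_mul (1 + t ^ 2)]
      congr 1
      refine integral_congr_ae (ae_of_all _ fun s => ?_)
      change f s * ((1 + t ^ 2) * poisson s (y n) t) = _
      ring
    rw [hval, hg, dist_comm, Real.dist_eq]
    change |_ - (1 + t ^ 2) * f t| ≤ _
    rw [← mul_sub, abs_mul, abs_of_pos (by positivity : (0 : ℝ) < 1 + t ^ 2)]
    exact happ _ (hy n) hn t
  obtain ⟨ν, hν⟩ := hgV
  refine ⟨ν, hν.congr fun i => integral_congr_ae (ae_of_all _ fun t => ?_)⟩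
  change (1 + t ^ 2) * f t * cauchyWt t = f t
  rw [hw]

/-- The link between Poisson integrals of spectral measures and resolvents. -/
lemma im_resolvent_eq_poisson (s y t : ℝ) :
    (((t : ℂ) - ⟨s, y⟩)⁻¹).im = poisson s y t := by
  rw [Complex.inv_im, Complex.normSq_apply]
  simp only [Complex.sub_im, Complex.ofReal_im, Complex.sub_re, Complex.ofReal_re, poisson]
  congr 1 <;> ring

lemma norm_resolvent_le {z : ℂ} (hz : z.im ≠ 0) (t : ℝ) : ‖((t : ℂ) - z)⁻¹‖ ≤ |z.im|⁻¹ := by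
  rw [norm_inv]
  have := abs_pos.2 hz
  gcongr
  · simpa using Complex.abs_im_le_norm ((t : ℂ) - z)

lemma resolvent_ne_zero {z : ℂ} (hz : z.im ≠ 0) (t : ℝ) : (t : ℂ) - z ≠ 0 := by
  intro h
  apply hz
  have := congrArg Complex.im h
  simpa using this

lemma continuous_resolvent {z : ℂ} (hz : z.im ≠ 0) : Continuous fun t : ℝ => ((t : ℂ) - z)⁻¹ :=
  Continuous.inv₀ (by fun_prop) (resolvent_ne_zero hz)

lemma integrable_resolvent {z : ℂ} (hz : z.im ≠ 0) (μ : Measure ℝ) [IsFiniteMeasure μ] :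
    Integrable (fun t : ℝ => ((t : ℂ) - z)⁻¹) μ :=
  Integrable.of_bound (continuous_resolvent hz).aestronglyMeasurable _
    (ae_of_all _ (norm_resolvent_le hz))

lemma integral_poisson_eq_im {s y : ℝ} (hy : 0 < y) (μ : Measure ℝ) [IsFiniteMeasure μ] :
    ∫ t, poisson s y t ∂μ = (∫ t : ℝ, ((t : ℂ) - ⟨s, y⟩)⁻¹ ∂μ).im := by
  have h := integral_im (integrable_resolvent (z := ⟨s, y⟩) hy.ne' μ)
  simp only [RCLike.im_to_complex, im_resolvent_eq_poisson] at h
  exact h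

/-- A finite measure on `ℝ` is determined by its Stieltjes transform. -/
lemma ext_of_integral_resolvent {μ ν : Measure ℝ} [IsFiniteMeasure μ] [IsFiniteMeasure ν]
    (h : ∀ z : ℂ, z.im ≠ 0 → ∫ t : ℝ, ((t : ℂ) - z)⁻¹ ∂μ = ∫ t : ℝ, ((t : ℂ) - z)⁻¹ ∂ν) :
    μ = ν := by
  refine Measure.ext_of_integral_eq_on_compactlySupported fun f => ?_
  -- The two measures form a family indexed by `Bool` with the filter `⊤`. Convergence along `⊤`
  -- forces both values to equal the limit, so existence of a limit is equality of the integrals.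
  let m : Bool → Measure ℝ := fun b => if b then μ else ν
  have hC : ∀ᶠ i in (⊤ : Filter Bool), UnitBound ((μ univ).toNNReal + (ν univ).toNNReal) (m i) := by
    refine Eventually.of_forall fun b k => ?_
    rw [ENNReal.coe_add, ENNReal.coe_toNNReal (measure_ne_top _ _),
      ENNReal.coe_toNNReal (measure_ne_top _ _)]
    cases b
    · exact (measure_mono (subset_univ _)).trans le_add_self
    · exact (measure_mono (subset_univ _)).trans le_self_add
  have hP : ∀ s ∈ (univ : Set ℝ), ∀ n : ℕ, ∃ a,
      Tendsto (fun i => ∫ t, poisson s (1 / (n + 1 : ℝ)) t ∂m i) ⊤ (𝓝 a) := by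
    intro s _ n
    have hn : (0 : ℝ) < 1 / (n + 1) := by positivity
    refine ⟨∫ t, poisson s (1 / (n + 1 : ℝ)) t ∂μ, ?_⟩
    have : (fun i => ∫ t, poisson s (1 / (n + 1 : ℝ)) t ∂m i) =
        fun _ => ∫ t, poisson s (1 / (n + 1 : ℝ)) t ∂μ := by
      ext b
      cases b
      · simp only [m, Bool.false_eq_true, if_false]
        rw [integral_poisson_eq_im hn, integral_poisson_eq_im hn, h _ hn.ne']
      · simp [m]
    rw [this]
    exact tendsto_const_nhds
  obtain ⟨a, ha⟩ := exists_tendsto_integral_of_hasCompactSupport m _ hC univ dense_univ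
    (fun n : ℕ => 1 / (n + 1 : ℝ)) (fun n => by positivity) tendsto_one_div_add_atTop_nhds_zero_nat
    hP f f.continuous f.hasCompactSupport
  have h1 := tendsto_nhds_unique (ha.mono_left le_top) (tendsto_pure_nhds _ true)
  have h2 := tendsto_nhds_unique (ha.mono_left le_top) (tendsto_pure_nhds _ false)
  simpa [m] using h1.symm.trans h2

end Convergence
end RandomDirac
end

noncomputable section
set_option linter.unusedSectionVars false
namespace RandomDirac
open scoped ENNReal NNReal ComplexConjugate BoundedContinuousFunction

/-! ### From continuous functions to test functions with countably many discontinuities. -/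

section TestFunctions

variable {ι : Type*} {F : Filter ι}

lemma UnitBound.isLocallyFinite {C : ℝ≥0} {m : Measure ℝ} (hm : UnitBound C m) :
    IsLocallyFiniteMeasure m := by
  refine ⟨fun x => ⟨Ioo (⌊x⌋ - 1 : ℝ) (⌊x⌋ + 1), Ioo_mem_nhds ?_ ?_, ?_⟩⟩
  · linarith [Int.floor_le x]
  · exact Int.lt_floor_add_one x
  · have h : Ioo (⌊x⌋ - 1 : ℝ) (⌊x⌋ + 1) ⊆ Ico ((⌊x⌋ - 1 : ℤ) : ℝ) ((⌊x⌋ - 1 : ℤ) + 1) ∪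
        Ico (⌊x⌋ : ℝ) (⌊x⌋ + 1) := by
      intro t ht
      rcases lt_or_ge t ⌊x⌋ with h | h
      · left; push_cast; constructor <;> linarith [ht.1]
      · right; exact ⟨h, ht.2⟩
    refine (measure_mono h).trans_lt ((measure_union_le _ _).trans_lt ?_)
    exact ENNReal.add_lt_top.2 ⟨(hm _).trans_lt (by simp), (hm _).trans_lt (by simp)⟩

lemma exists_measure_Icc_bound (C : ℝ≥0) (R : ℝ) :
    ∃ B : ℝ≥0, ∀ m : Measure ℝ, UnitBound C m → m (Icc (-R) R) ≤ B := by
  have hs := (summable_wtSeq.mul_left (1 + R ^ 2)).tsum_ofReal_lt_top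
  refine ⟨(C * ∑' k, ENNReal.ofReal ((1 + R ^ 2) * wtSeq k)).toNNReal, fun m hm => ?_⟩
  rw [ENNReal.coe_toNNReal (ENNReal.mul_ne_top (by simp) hs.ne),
    ← lintegral_indicator_one measurableSet_Icc]
  refine hm.lintegral_le fun t => ?_
  by_cases ht : t ∈ Icc (-R) R
  · rw [indicator_of_mem ht, Pi.one_apply, ENNReal.one_le_ofReal]
    refine le_trans ?_ (mul_le_mul_of_nonneg_left (cauchyWt_le_wtSeq t) (by positivity))
    rw [cauchyWt, ← div_eq_mul_inv, le_div_iff₀ (by positivity)]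
    nlinarith [ht.1, ht.2]
  · rw [indicator_of_notMem ht]; exact zero_le

/-- The continuity points and the "light" points of a function cover everything. -/
lemma exists_tendsto_integral_of_bounded_support (m : ι → Measure ℝ) (C : ℝ≥0)
    (hC : ∀ᶠ i in F, UnitBound C (m i))
    (hcc : ∀ f : ℝ → ℝ, Continuous f → HasCompactSupport f →
      ∃ ν, Tendsto (fun i => ∫ t, f t ∂m i) F (𝓝 ν))
    (g : ℝ → ℂ) (hg : Measurable g) {M : ℝ} (hM : ∀ t, ‖g t‖ ≤ M) {N : ℝ}
    (hN : ∀ t, t ∉ Icc (-N) N → g t = 0) (hcount : {x | ¬ ContinuousAt g x}.Countable)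
    (hatom : ∀ E, ¬ ContinuousAt g E → ∀ ε > 0, ∃ δ > 0, ∀ᶠ i in F,
      m i (Ioo (E - δ) (E + δ)) ≤ ENNReal.ofReal ε) :
    ∃ ν, Tendsto (fun i => ∫ t, g t ∂m i) F (𝓝 ν) := by
  refine exists_tendsto_of_tendsto_approx fun ε hε => ?_
  have hM0 : 0 ≤ M := (norm_nonneg _).trans (hM 0)
  obtain ⟨B, hB⟩ := exists_measure_Icc_bound C (N + 1)
  -- Half of ε pays for the oscillation near continuity points, on a set of mass at most `B`; the
  -- other half, through `ε₂`, pays for neighbourhoods of discontinuities, where the error is up to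
  -- 2M.
  set ε₁ := ε / (2 * (B + 1)) with hε₁
  have hε₁0 : 0 < ε₁ := by positivity
  set ε₂ := ε / (4 * (M + 1)) with hε₂
  have hε₂0 : 0 < ε₂ := by positivity
  -- Countability of the discontinuities enters here: they receive positive weights all of whose
  -- finite sums are at most ε₂.
  obtain ⟨w, hw0, hw⟩ := hcount.exists_pos_forall_sum_le hε₂0
  -- Each point gets a neighbourhood with small oscillation of `g` or, at a discontinuity, with
  -- eventually small mass. The bound δ ≤ 1 keeps everything inside [-(N+1), N+1].
  have hU : ∀ x : ℝ, ∃ δ > 0, δ ≤ 1 ∧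
      (ContinuousAt g x → ∀ t ∈ Ioo (x - δ) (x + δ), ‖g t - g x‖ ≤ ε₁) ∧
      (¬ ContinuousAt g x → ∀ᶠ i in F, m i (Ioo (x - δ) (x + δ)) ≤ ENNReal.ofReal (w x)) := by
    intro x
    by_cases hx : ContinuousAt g x
    · obtain ⟨δ, hδ, h⟩ := Metric.continuousAt_iff.1 hx ε₁ hε₁0
      refine ⟨min δ 1, by positivity, min_le_right _ _, fun _ t ht => ?_, fun h' => absurd hx h'⟩
      have : dist t x < δ := by
        rw [Real.dist_eq, abs_lt]
        have := min_le_left δ 1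
        constructor <;> linarith [ht.1, ht.2]
      have := h this
      rw [dist_eq_norm] at this
      exact this.le
    · obtain ⟨δ, hδ, h⟩ := hatom x hx (w x) (hw0 x)
      refine ⟨min δ 1, by positivity, min_le_right _ _, fun h' => absurd h' hx, fun _ => ?_⟩
      filter_upwards [h] with i hi
      refine (measure_mono (Ioo_subset_Ioo ?_ ?_)).trans hi <;> linarith [min_le_left δ 1]
  choose δ hδ hδ1 hgood hbad using hU
  set U : ℝ → Set ℝ := fun x => Ioo (x - δ x) (x + δ x)
  obtain ⟨T, hTK, hT⟩ := (isCompact_Icc (a := -N) (b := N)).elim_nhds_subcover U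
    fun x _ => Ioo_mem_nhds (by linarith [hδ x]) (by linarith [hδ x])
  obtain ⟨ρ, hρ⟩ := PartitionOfUnity.exists_isSubordinate (isClosed_Icc (a := -N) (b := N))
    (fun x : T => U x) (fun x => isOpen_Ioo) (by
      intro t ht
      obtain ⟨x, hx, htx⟩ := mem_iUnion₂.1 (hT ht)
      exact mem_iUnion.2 ⟨⟨x, hx⟩, htx⟩)
  have hUsub : ∀ x : T, U x ⊆ Icc (-(N + 1)) (N + 1) := fun x t ht => by
    have h1 := hTK x x.2
    have h2 := hδ1 x
    constructor <;> linarith [ht.1, ht.2, h1.1, h1.2]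
  have hρcs : ∀ x : T, HasCompactSupport (ρ x) := fun x =>
    (isCompact_Icc (a := -(N + 1)) (b := N + 1)).of_isClosed_subset (isClosed_tsupport _)
      ((hρ x).trans (hUsub x))
  have hρsum : ∀ t ∈ Icc (-N) N, ∑ x, ρ x t = 1 := fun t ht => by
    rw [← finsum_eq_sum_of_fintype]; exact ρ.sum_eq_one ht
  have hρle : ∀ t, ∑ x, ρ x t ≤ 1 := fun t => by
    rw [← finsum_eq_sum_of_fintype]; exact ρ.sum_le_one t
  -- A combination of continuous compactly supported functions, so its integrals converge by `hcc`;
  -- it remains to bound `g - s`.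
  set s : ℝ → ℂ := fun t => ∑ x : T, (ρ x t : ℂ) * g x with hs
  refine ⟨fun i => ∫ t, s t ∂m i, ?_, ?_⟩
  · choose ν hν using fun x : T => hcc (ρ x) (ρ x).continuous (hρcs x)
    refine ⟨∑ x, (ν x : ℂ) * g x, ?_⟩
    have h1 : Tendsto (fun i => ∑ x : T, ((∫ t, ρ x t ∂m i : ℝ) : ℂ) * g x) F
        (𝓝 (∑ x, (ν x : ℂ) * g x)) :=
      tendsto_finsetSum _ fun x _ =>
        ((Complex.continuous_ofReal.tendsto _).comp (hν x)).mul_const _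
    refine h1.congr' ?_
    filter_upwards [hC] with i hi
    have := hi.isLocallyFinite
    rw [hs, integral_finsetSum]
    · refine Finset.sum_congr rfl fun x _ => ?_
      rw [integral_mul_const, integral_complex_ofReal]
    · intro x _
      exact (((ρ x).continuous.integrable_of_hasCompactSupport (hρcs x)).ofReal).mul_const _
  · have hev : ∀ᶠ i in F, ∀ x ∈ T, ¬ ContinuousAt g x → m i (U x) ≤ ENNReal.ofReal (w x) := by
      rw [Finset.eventually_all]
      intro x _
      by_cases hx : ContinuousAt g x
      · exact Eventually.of_forall fun i h => absurd hx h
      · filter_upwards [hbad x hx] with i hi _ using hi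
    classical
    set Tb := T.filter fun x => ¬ ContinuousAt g x
    -- Only the indices `x` with t ∈ U x contribute: a continuity point costs at most ε₁, a
    -- discontinuity at most 2M on its own neighbourhood.
    have hpt : ∀ t, ‖g t - s t‖ₑ ≤ (Icc (-(N + 1)) (N + 1)).indicator (fun _ => ENNReal.ofReal ε₁) t
        + ∑ x ∈ Tb, (U x).indicator (fun _ => ENNReal.ofReal (2 * M)) t := by
      intro t
      have h1 : g t - s t = ∑ x : T, (ρ x t : ℂ) * (g t - g x) := by
        simp_rw [mul_sub, Finset.sum_sub_distrib]
        rw [hs, ← Finset.sum_mul]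
        congr 1
        by_cases ht : t ∈ Icc (-N) N
        · have := hρsum t ht
          rw [← Complex.ofReal_sum, this]; simp
        · rw [hN t ht, mul_zero]
      have h2 : ∀ x : T, ‖(ρ x t : ℂ) * (g t - g x)‖ ≤ ρ x t *
          ((Icc (-(N + 1)) (N + 1)).indicator (fun _ => ε₁) t +
            ∑ x ∈ Tb, (U x).indicator (fun _ => 2 * M) t) := by
        intro x
        rw [norm_mul, Complex.norm_real, Real.norm_of_nonneg (ρ.nonneg x t)]
        by_cases hx0 : ρ x t = 0
        · simp [hx0]
        refine mul_le_mul_of_nonneg_left ?_ (ρ.nonneg x t)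
        have htU : t ∈ U x := hρ x (subset_tsupport _ hx0)
        have hn : ∀ y ∈ Tb, 0 ≤ (U y).indicator (fun _ => 2 * M) t := fun y _ =>
          indicator_nonneg (fun _ _ => by positivity) _
        by_cases hx : ContinuousAt g x
        · have h3 := hgood x hx t htU
          rw [indicator_of_mem (hUsub x htU)]
          linarith [Finset.sum_nonneg hn]
        · have hxT : (x : ℝ) ∈ Tb := Finset.mem_filter.2 ⟨x.2, hx⟩
          have h3 := Finset.single_le_sum hn hxT
          rw [indicator_of_mem htU] at h3
          have h4 : ‖g t - g x‖ ≤ 2 * M := (norm_sub_le _ _).trans (by linarith [hM t, hM x])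
          have h5 : 0 ≤ (Icc (-(N + 1)) (N + 1)).indicator (fun _ => ε₁) t :=
            indicator_nonneg (fun _ _ => hε₁0.le) _
          linarith
      have h3 : ‖g t - s t‖ ≤ (Icc (-(N + 1)) (N + 1)).indicator (fun _ => ε₁) t +
            ∑ x ∈ Tb, (U x).indicator (fun _ => 2 * M) t := by
        rw [h1]
        refine (norm_sum_le _ _).trans ((Finset.sum_le_sum fun x _ => h2 x).trans ?_)
        rw [← Finset.sum_mul]
        refine mul_le_of_le_one_left ?_ (hρle t)
        exact add_nonneg (indicator_nonneg (fun _ _ => hε₁0.le) _)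
          (Finset.sum_nonneg fun y _ => indicator_nonneg (fun _ _ => by positivity) _)
      rw [← ofReal_norm]
      refine (ENNReal.ofReal_le_ofReal h3).trans (ENNReal.ofReal_add_le.trans ?_)
      gcongr
      · by_cases ht : t ∈ Icc (-(N + 1)) (N + 1)
        · rw [indicator_of_mem ht, indicator_of_mem ht]
        · rw [indicator_of_notMem ht, indicator_of_notMem ht, ENNReal.ofReal_zero]
      · rw [ENNReal.ofReal_sum_of_nonneg fun y _ => indicator_nonneg (fun _ _ => by positivity) _]
        refine Finset.sum_le_sum fun y _ => ?_
        by_cases ht : t ∈ U y <;> simp [ht]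
    filter_upwards [hC, hev] with i hi hi2
    have := hi.isLocallyFinite
    have hgi : Integrable g (m i) := by
      have h1 : IntegrableOn g (Icc (-N) N) (m i) :=
        Measure.integrableOn_of_bounded (isCompact_Icc.measure_lt_top.ne) hg.aestronglyMeasurable
          (ae_of_all _ hM)
      refine (integrableOn_iff_integrable_of_support_subset fun t ht => ?_).1 h1
      by_contra h
      exact ht (hN t h)
    have hsi : Integrable s (m i) := integrable_finsetSum _ fun x _ =>
      (((ρ x).continuous.integrable_of_hasCompactSupport (hρcs x)).ofReal).mul_const _
    rw [← integral_sub hgi hsi]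
    refine (norm_integral_le_lintegral_norm _).trans (ENNReal.toReal_le_of_le_ofReal hε.le ?_)
    simp_rw [ofReal_norm]
    refine (lintegral_mono hpt).trans ?_
    rw [lintegral_add_left (measurable_const.indicator measurableSet_Icc),
      lintegral_finsetSum _ fun x _ => measurable_const.indicator measurableSet_Ioo,
      lintegral_indicator_const measurableSet_Icc]
    simp_rw [lintegral_indicator_const (measurableSet_Ioo : MeasurableSet (U _))]
    have e1 : ENNReal.ofReal ε₁ * m i (Icc (-(N + 1)) (N + 1)) ≤ ENNReal.ofReal (ε / 2) := by
      calc _ ≤ ENNReal.ofReal ε₁ * B := by gcongr; exact hB _ hi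
        _ = ENNReal.ofReal (ε₁ * B) := by rw [ENNReal.ofReal_mul hε₁0.le]; simp
        _ ≤ _ := by
          apply ENNReal.ofReal_le_ofReal
          rw [hε₁, div_mul_eq_mul_div, div_le_div_iff₀ (by positivity) (by norm_num)]
          nlinarith [B.2]
    have e2 : ∑ x ∈ Tb, ENNReal.ofReal (2 * M) * m i (U x) ≤ ENNReal.ofReal (ε / 2) := by
      calc _ ≤ ∑ x ∈ Tb, ENNReal.ofReal (2 * M) * ENNReal.ofReal (w x) := by
            refine Finset.sum_le_sum fun x hx => ?_
            gcongr
            exact hi2 x (Finset.mem_filter.1 hx).1 (Finset.mem_filter.1 hx).2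
        _ = ENNReal.ofReal (2 * M * ∑ x ∈ Tb, w x) := by
            rw [← Finset.mul_sum, ← ENNReal.ofReal_sum_of_nonneg fun x _ => (hw0 x).le,
              ← ENNReal.ofReal_mul (by positivity)]
        _ ≤ ENNReal.ofReal (2 * M * ε₂) := by
            apply ENNReal.ofReal_le_ofReal
            gcongr
            exact hw Tb fun x hx => (Finset.mem_filter.1 hx).2
        _ ≤ _ := by
          apply ENNReal.ofReal_le_ofReal
          rw [hε₂, mul_div_assoc', div_le_div_iff₀ (by positivity) (by norm_num)]
          nlinarith
    refine (add_le_add e1 e2).trans (le_of_eq ?_)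
    rw [← ENNReal.ofReal_add (by positivity) (by positivity)]
    congr 1; ring

lemma eventually_lt_iff {E a : ℝ} (h : E ≠ a) : ∀ᶠ t in 𝓝 E, (t < a ↔ E < a) := by
  rcases lt_or_gt_of_ne h with h | h
  · filter_upwards [Iio_mem_nhds h] with t ht using ⟨fun _ => h, fun _ => ht⟩
  · filter_upwards [Ioi_mem_nhds h] with t ht using
      ⟨fun h' => absurd h' (not_lt.2 (le_of_lt ht)), fun h' => absurd h' (not_lt.2 h.le)⟩

/-- Convergence of the integrals of a test function along a family of measures whose Poisson
integrals converge and which has no mass at the discontinuities in the limit. -/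
theorem IsTestFunction.exists_tendsto_integral {φ : ℝ → ℂ} (hφ : IsTestFunction φ)
    (m : ι → Measure ℝ) (C : ℝ≥0)
    (hC : ∀ᶠ i in F, UnitBound C (m i)) (S : Set ℝ) (hS : Dense S) (y : ℕ → ℝ)
    (hy : ∀ n, 0 < y n) (hy0 : Tendsto y atTop (𝓝 0))
    (hP : ∀ s ∈ S, ∀ n, ∃ ν, Tendsto (fun i => ∫ t, poisson s (y n) t ∂m i) F (𝓝 ν))
    (hatom : ∀ E, (¬ ContinuousAt φ E ∨ E ∈ range ((↑) : ℤ → ℝ)) → ∀ ε > 0, ∃ δ > 0,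
      ∀ᶠ i in F, m i (Ioo (E - δ) (E + δ)) ≤ ENNReal.ofReal ε) :
    ∃ ν, Tendsto (fun i => ∫ t, φ t ∂m i) F (𝓝 ν) := by
  obtain ⟨c, hc, hφc⟩ := hφ.decay
  have hc0 : ∀ k, 0 ≤ c k := fun k => by
    have := hφc (k : ℝ); rw [Int.floor_intCast] at this; exact (norm_nonneg _).trans this
  refine exists_tendsto_of_tendsto_approx fun ε hε => ?_
  obtain ⟨T, hT⟩ := summable_iff_vanishing_norm.1 hc (ε / (C + 1)) (by positivity)
  obtain ⟨N, hN⟩ : ∃ N : ℤ, ∀ k ∈ T, k ∈ Finset.Ico (-N) N := by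
    refine ⟨∑ k ∈ T, (|k| + 1), fun k hk => ?_⟩
    have h1 : |k| + 1 ≤ ∑ k ∈ T, (|k| + 1) :=
      Finset.single_le_sum (f := fun k : ℤ => |k| + 1) (fun j _ => by positivity) hk
    rw [Finset.mem_Ico]
    constructor <;> grind
  set I : Set ℝ := Ico (-(N : ℝ)) N with hI
  set g := I.indicator φ with hg
  have hfl : ∀ t : ℝ, t ∈ I ↔ ⌊t⌋ ∈ Finset.Ico (-N) N := by
    intro t
    rw [Finset.mem_Ico, Int.le_floor, Int.floor_lt, hI, mem_Ico]
    push_cast; rfl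
  -- Cutting φ off at ±N may create jumps there, which is why `hatom` also covers the integers.
  have hcont : ∀ E, ¬ ContinuousAt g E → ¬ ContinuousAt φ E ∨ E ∈ range ((↑) : ℤ → ℝ) := by
    intro E hE
    by_contra! h
    refine hE ?_
    have h1 : ∀ᶠ t in 𝓝 E, t ∈ I ↔ E ∈ I := by
      have hn1 : E ≠ -(N : ℝ) := fun h' => h.2 ⟨-N, by rw [h']; simp⟩
      have hn2 : E ≠ (N : ℝ) := fun h' => h.2 ⟨N, h'.symm⟩
      filter_upwards [eventually_lt_iff hn1, eventually_lt_iff hn2] with t h1 h2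
      rw [hI, mem_Ico, mem_Ico, ← not_lt, ← not_lt, h1, h2]
    by_cases hEI : E ∈ I
    · refine h.1.congr ?_
      filter_upwards [h1] with t ht
      rw [hg, indicator_of_mem (ht.2 hEI)]
    · refine (continuousAt_const (y := (0 : ℂ))).congr ?_
      filter_upwards [h1] with t ht
      rw [hg, indicator_of_notMem fun h => hEI (ht.1 h)]
  refine ⟨fun i => ∫ t, g t ∂m i, ?_, ?_⟩
  · have hle : ∀ k, c k ≤ ∑' k, c k := fun k => hc.le_tsum k fun j _ => hc0 j
    refine exists_tendsto_integral_of_bounded_support m C hC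
      (exists_tendsto_integral_of_hasCompactSupport m C hC S hS y hy hy0 hP) g
      (hφ.measurable.indicator measurableSet_Ico) (M := ∑' k, c k) (N := N) ?_ ?_ ?_
      (fun E hE => hatom E (hcont E hE))
    · intro t
      exact (norm_indicator_le_norm_self _ _).trans ((hφc t).trans (hle _))
    · intro t ht
      exact indicator_of_notMem (fun h => ht (Ico_subset_Icc_self h)) _
    · exact (hφ.countable_discontinuities.union (countable_range _)).mono fun E hE => hcont E hE
  · filter_upwards [hC] with i hi
    have hφi : Integrable φ (m i) := hi.integrable hφ.measurable.aestronglyMeasurable hc hφc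
    rw [← integral_sub hφi (hφi.indicator measurableSet_Ico)]
    set c' : ℤ → ℝ := ((Finset.Ico (-N) N : Finset ℤ) : Set ℤ)ᶜ.indicator c
    have hc' : Summable c' := hc.indicator _
    have hle : ∀ t, ‖φ t - g t‖ ≤ c' ⌊t⌋ := by
      intro t
      by_cases ht : t ∈ I
      · rw [hg, indicator_of_mem ht, sub_self, norm_zero]
        exact indicator_nonneg (fun _ _ => hc0 _) _
      · rw [hg, indicator_of_notMem ht, sub_zero]
        rw [hfl] at ht
        simp only [c']
        rw [indicator_of_mem (by simpa using ht)]
        exact hφc t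
    refine (norm_integral_le_integral_norm _).trans ((hi.integral_norm_le
      (hφi.sub (hφi.indicator measurableSet_Ico)).aestronglyMeasurable hc' hle).trans ?_)
    have h1 : ∑' k, c' k ≤ ε / (C + 1) := by
      refine hc'.tsum_le_of_sum_le fun s => ?_
      classical
      have h2 : ∑ k ∈ s, c' k = ∑ k ∈ s.filter (· ∉ Finset.Ico (-N) N), c k := by
        rw [Finset.sum_filter]
        refine Finset.sum_congr rfl fun k _ => ?_
        simp [c', indicator_apply]
      rw [h2]
      refine (le_abs_self _).trans (hT _ ?_).le
      rw [Finset.disjoint_left]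
      intro k hk hkT
      exact (Finset.mem_filter.1 hk).2 (hN k hkT)
    calc (C : ℝ) * ∑' k, c' k ≤ C * (ε / (C + 1)) := by gcongr
      _ ≤ ε := by rw [mul_div_assoc', div_le_iff₀ (by positivity)]; nlinarith [C.2]

end TestFunctions
end RandomDirac
end

noncomputable section
set_option linter.unusedSectionVars false
namespace RandomDirac
open scoped ENNReal NNReal ComplexConjugate

/-! ### Resolvents of unbounded self-adjoint operators. -/

section Resolvent

variable {H : Type*} [NormedAddCommGroup H] [InnerProductSpace ℂ H] [CompleteSpace H]
  {A : H →ₗ.[ℂ] H} {z w : ℂ}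

/-- `R = (A - z)⁻¹`. -/
def IsResolvent (A : H →ₗ.[ℂ] H) (z : ℂ) (R : H →L[ℂ] H) : Prop :=
  (∀ x, (R x, x + z • R x) ∈ A.graph) ∧ ∀ p ∈ A.graph, R (p.2 - z • p.1) = p.1

open scoped Classical in
/-- The resolvent `(A - z)⁻¹` (with value `0` where it is not defined). -/
def resolv (A : H →ₗ.[ℂ] H) (z : ℂ) : H →L[ℂ] H :=
  if h : ∃ R, IsResolvent A z R then h.choose else 0

lemma inner_graph_symm (hA : IsSelfAdjoint A) {p q : H × H} (hp : p ∈ A.graph)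
    (hq : q ∈ A.graph) : inner ℂ p.2 q.1 = inner ℂ p.1 q.2 := by
  have h := LinearPMap.adjoint_graph_eq_graph_adjoint hA.dense_domain
  rw [LinearPMap.isSelfAdjoint_def.1 hA] at h
  rw [h] at hq
  exact sub_eq_zero.1 ((Submodule.mem_adjoint_iff _ _).1 hq p.1 p.2 hp)

lemma mem_graph_of_inner (hA : IsSelfAdjoint A) {q : H × H}
    (h : ∀ p ∈ A.graph, inner ℂ p.2 q.1 = inner ℂ p.1 q.2) : q ∈ A.graph := by
  have h' := LinearPMap.adjoint_graph_eq_graph_adjoint hA.dense_domain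
  rw [LinearPMap.isSelfAdjoint_def.1 hA] at h'
  rw [h']
  exact (Submodule.mem_adjoint_iff _ _).2 fun a b hab => sub_eq_zero.2 (h (a, b) hab)

lemma im_inner_graph (hA : IsSelfAdjoint A) {p : H × H} (hp : p ∈ A.graph) (z : ℂ) :
    (inner ℂ p.1 (p.2 - z • p.1)).im = -z.im * ‖p.1‖ ^ 2 := by
  have h := inner_graph_symm hA hp hp
  have h1 : (inner ℂ p.1 p.2).im = 0 := by
    rw [← inner_conj_symm] at h
    exact Complex.conj_eq_iff_im.1 h
  rw [inner_sub_right, inner_smul_right, inner_self_eq_norm_sq_to_K, Complex.sub_im, h1]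
  have : ((‖p.1‖ : ℂ) ^ 2) = ((‖p.1‖ ^ 2 : ℝ) : ℂ) := by push_cast; rfl
  rw [RCLike.ofReal_eq_complex_ofReal, this, Complex.mul_im, Complex.ofReal_im, Complex.ofReal_re]
  ring

/-- Cauchy–Schwarz applied to Im⟨ψ, (A - z)ψ⟩ = -Im z ‖ψ‖². -/
lemma norm_graph_le (hA : IsSelfAdjoint A) {p : H × H} (hp : p ∈ A.graph) (z : ℂ) :
    |z.im| * ‖p.1‖ ≤ ‖p.2 - z • p.1‖ := by
  have h := im_inner_graph hA hp z
  have h1 : |z.im| * ‖p.1‖ ^ 2 ≤ ‖p.1‖ * ‖p.2 - z • p.1‖ := by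
    have h2 := (Complex.abs_im_le_norm _).trans (norm_inner_le_norm p.1 (p.2 - z • p.1))
    rwa [h, abs_mul, abs_neg, abs_of_nonneg (sq_nonneg ‖p.1‖)] at h2
  rcases (norm_nonneg p.1).eq_or_lt with h0 | h0
  · rw [← h0]; simp
  · nlinarith

/-- A - z is bounded below on the closed graph, hence has closed range. A vector orthogonal to the
range is an eigenvector of `A` for the non-real number `conj z`, so it vanishes. -/
lemma exists_graph_sub_eq (hA : IsSelfAdjoint A) (hz : z.im ≠ 0) (x : H) :
    ∃ p ∈ A.graph, p.2 - z • p.1 = x := by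
  have hcl : IsClosed (A.graph : Set (H × H)) := hA.isClosed
  have : CompleteSpace A.graph := hcl.completeSpace_coe
  let T : A.graph →L[ℂ] H :=
    (ContinuousLinearMap.snd ℂ H H - z • ContinuousLinearMap.fst ℂ H H).comp A.graph.subtypeL
  have hT : ∀ p : A.graph, T p = (p : H × H).2 - z • (p : H × H).1 := fun p => rfl
  have hz0 : 0 < |z.im| := abs_pos.2 hz
  have hK : ∀ p : A.graph, ‖p‖ ≤ (1 + (1 + ‖z‖) * |z.im|⁻¹) * ‖T p‖ := by
    intro p
    have h1 := norm_graph_le hA p.2 z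
    rw [← hT] at h1
    have h2 : ‖(p : H × H).1‖ ≤ |z.im|⁻¹ * ‖T p‖ := by
      rw [inv_mul_eq_div, le_div_iff₀ hz0]; linarith
    have h3 : ‖(p : H × H).2‖ ≤ ‖T p‖ + ‖z‖ * (|z.im|⁻¹ * ‖T p‖) := by
      have : (p : H × H).2 = T p + z • (p : H × H).1 := by rw [hT]; abel
      rw [this]
      refine (norm_add_le _ _).trans ?_
      rw [norm_smul]
      gcongr
    have h4 : 0 ≤ |z.im|⁻¹ * ‖T p‖ := by positivity
    have h5 : 0 ≤ ‖z‖ * (|z.im|⁻¹ * ‖T p‖) := by positivity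
    rw [Submodule.coe_norm, Prod.norm_def]
    refine max_le ?_ ?_ <;> linarith [norm_nonneg (T p)]
  have hanti : AntilipschitzWith (1 + (1 + ‖z‖) * |z.im|⁻¹).toNNReal T := by
    refine AddMonoidHomClass.antilipschitz_of_bound T fun p => ?_
    rw [Real.coe_toNNReal _ (by positivity)]
    exact hK p
  have hrange : IsClosed (T.range : Set H) := by
    have := hanti.isClosed_range T.uniformContinuous
    convert this using 1
    ext x; simp
  have horth : T.rangeᗮ = ⊥ := by
    rw [Submodule.eq_bot_iff]
    intro u hu
    have hmem : (u, conj z • u) ∈ A.graph := by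
      refine mem_graph_of_inner hA fun p hp => ?_
      have h1 := (Submodule.mem_orthogonal _ _).1 hu (T ⟨p, hp⟩) ⟨_, rfl⟩
      rw [hT, inner_sub_left, inner_smul_left, sub_eq_zero] at h1
      rw [h1, inner_smul_right]
    have h2 := norm_graph_le hA hmem (conj z)
    simp only [sub_self, norm_zero, Complex.conj_im, abs_neg] at h2
    have := nonpos_of_mul_nonpos_right h2 hz0
    exact norm_le_zero_iff.1 this
  have htop : T.range = ⊤ := by
    have h1 : IsClosed (T.range : Set H) := hrange
    have : CompleteSpace T.range := h1.completeSpace_coe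
    exact (Submodule.orthogonal_eq_bot_iff).1 horth
  obtain ⟨p, hp⟩ := (htop ▸ Submodule.mem_top : x ∈ T.range)
  exact ⟨p, p.2, hp⟩

lemma exists_isResolvent (hA : IsSelfAdjoint A) (hz : z.im ≠ 0) : ∃ R, IsResolvent A z R := by
  have hz0 : 0 < |z.im| := abs_pos.2 hz
  choose p hp hpx using exists_graph_sub_eq hA hz
  have huniq : ∀ q ∈ A.graph, ∀ x, q.2 - z • q.1 = x → q.1 = (p x).1 := by
    intro q hq x hqx
    have h := norm_graph_le hA (A.graph.sub_mem hq (hp x)) z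
    have h1 : (q - p x).2 - z • (q - p x).1 = 0 := by
      have := hpx x
      rw [Prod.snd_sub, Prod.fst_sub, smul_sub, sub_sub_sub_comm, hqx, this, sub_self]
    rw [h1, norm_zero] at h
    have := norm_le_zero_iff.1 (nonpos_of_mul_nonpos_right h hz0)
    rw [Prod.fst_sub] at this
    exact sub_eq_zero.1 this
  let R : H →ₗ[ℂ] H :=
    { toFun := fun x => (p x).1
      map_add' := fun x y => by
        refine (huniq (p x + p y) (A.graph.add_mem (hp x) (hp y)) _ ?_).symm
        rw [Prod.snd_add, Prod.fst_add, smul_add, add_sub_add_comm, hpx, hpx]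
      map_smul' := fun c x => by
        refine (huniq (c • p x) (A.graph.smul_mem c (hp x)) _ ?_).symm
        rw [Prod.smul_snd, Prod.smul_fst, smul_comm, ← smul_sub, hpx] }
  refine ⟨R.mkContinuous |z.im|⁻¹ fun x => ?_, fun x => ?_, fun q hq => ?_⟩
  · have := norm_graph_le hA (hp x) z
    rw [hpx] at this
    change ‖(p x).1‖ ≤ _
    rw [inv_mul_eq_div, le_div_iff₀ hz0]; linarith
  · change ((p x).1, x + z • (p x).1) ∈ A.graph
    have : x + z • (p x).1 = (p x).2 := (sub_eq_iff_eq_add.1 (hpx x)).symm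
    rw [this]
    exact hp x
  · exact (huniq q hq _ rfl).symm

lemma isResolvent_resolv (hA : IsSelfAdjoint A) (hz : z.im ≠ 0) :
    IsResolvent A z (resolv A z) := by
  rw [resolv, dif_pos (exists_isResolvent hA hz)]
  exact (exists_isResolvent hA hz).choose_spec

lemma norm_resolv_apply_le (hA : IsSelfAdjoint A) (hz : z.im ≠ 0) (x : H) :
    ‖resolv A z x‖ ≤ |z.im|⁻¹ * ‖x‖ := by
  have h := norm_graph_le hA ((isResolvent_resolv hA hz).1 x) z
  rw [add_sub_cancel_right] at h
  rw [inv_mul_eq_div, le_div_iff₀ (abs_pos.2 hz)]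
  linarith

/-- Combined with `im_resolvent_eq_poisson`, this turns Poisson integrals of spectral measures into
squared norms of resolvents. -/
lemma im_inner_resolv (hA : IsSelfAdjoint A) (hz : z.im ≠ 0) (x : H) :
    (inner ℂ x (resolv A z x)).im = z.im * ‖resolv A z x‖ ^ 2 := by
  have h := im_inner_graph hA ((isResolvent_resolv hA hz).1 x) z
  rw [add_sub_cancel_right] at h
  rw [← inner_conj_symm, Complex.conj_im, h]
  ring

lemma resolv_sub_resolv (hA : IsSelfAdjoint A) (hz : z.im ≠ 0) (hw : w.im ≠ 0) (x : H) :
    resolv A z x - resolv A w x = (z - w) • resolv A z (resolv A w x) := by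
  have h := (isResolvent_resolv hA hz).2 _ ((isResolvent_resolv hA hw).1 x)
  simp only at h
  rw [add_sub_assoc, ← sub_smul, map_add, map_smul] at h
  rw [← neg_sub z w, neg_smul, ← sub_eq_add_neg, sub_eq_iff_eq_add] at h
  rw [sub_eq_iff_eq_add, add_comm]
  exact h

lemma adjoint_resolv (hA : IsSelfAdjoint A) (hz : z.im ≠ 0) :
    ContinuousLinearMap.adjoint (resolv A z) = resolv A (conj z) := by
  have hz' : (conj z).im ≠ 0 := by simpa using hz
  symm
  rw [ContinuousLinearMap.eq_adjoint_iff]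
  intro x y
  have h := inner_graph_symm hA ((isResolvent_resolv hA hz').1 x) ((isResolvent_resolv hA hz).1 y)
  simp only [inner_add_left, inner_add_right, inner_smul_left, inner_smul_right,
    Complex.conj_conj] at h
  exact (add_right_cancel h).symm

lemma resolv_comm (hA : IsSelfAdjoint A) (hz : z.im ≠ 0) (hw : w.im ≠ 0) :
    resolv A z * resolv A w = resolv A w * resolv A z := by
  by_cases hzw : z = w
  · rw [hzw]
  ext x
  have h1 := resolv_sub_resolv hA hz hw x
  have h2 := resolv_sub_resolv hA hw hz x
  have h3 : (z - w) • resolv A z (resolv A w x) = (z - w) • resolv A w (resolv A z x) := by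
    rw [← h1, ← neg_sub w z, neg_smul, ← h2]; abel
  exact smul_right_injective H (sub_ne_zero.2 hzw) h3

end Resolvent
end RandomDirac
end

noncomputable section
set_option linter.unusedSectionVars false
namespace RandomDirac
open scoped ENNReal NNReal ComplexConjugate ComplexOrder

/-! ### Existence of spectral measures. -/

section SpectralMeasure

variable {H : Type*} [NormedAddCommGroup H] [InnerProductSpace ℂ H] [CompleteSpace H]

/-- A continuous real function on the spectrum as a complex function. -/
def toC {X : Type*} [TopologicalSpace X] (f : C(X, ℝ)) : C(X, ℂ) :=
  ⟨fun t => (f t : ℂ), by fun_prop⟩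

/-- With g = √f the form equals ‖g(N)x‖². -/
lemma cfcHom_toC_nonneg (N : H →L[ℂ] H) (hN : IsStarNormal N) (f : C(spectrum ℂ N, ℝ))
    (hf : 0 ≤ f) (x : H) : 0 ≤ inner ℂ x (cfcHom hN (toC f) x) := by
  let g : C(spectrum ℂ N, ℝ) := ⟨fun t => Real.sqrt (f t), by fun_prop⟩
  have h1 : toC f = star (toC g) * toC g := by
    ext t
    simp only [toC, ContinuousMap.coe_mk, ContinuousMap.mul_apply, ContinuousMap.star_apply,
      RCLike.star_def, Complex.conj_ofReal, g]
    rw [← Complex.ofReal_mul, Real.mul_self_sqrt (show 0 ≤ f t from hf t)]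
  rw [h1, map_mul, map_star, ContinuousLinearMap.star_eq_adjoint, mul_apply_eq_comp,
    ContinuousLinearMap.adjoint_inner_right]
  rw [inner_self_eq_norm_sq_to_K]
  have : ((0 : ℝ) : ℂ) ≤ ((‖cfcHom hN (toC g) x‖ ^ 2 : ℝ) : ℂ) := by
    rw [Complex.real_le_real]; positivity
  simp only [Complex.ofReal_zero, Complex.ofReal_pow] at this
  exact this

/-- f ↦ ⟨x, f(N)x⟩ is a positive functional on the compact spectrum, so the Riesz–Markov–Kakutani
theorem applies to real functions; complex ones follow by splitting. -/
lemma exists_measure_cfcHom (N : H →L[ℂ] H) (hN : IsStarNormal N) (x : H) :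
    ∃ μ : Measure (spectrum ℂ N), IsFiniteMeasure μ ∧
      ∀ f : C(spectrum ℂ N, ℂ), inner ℂ x (cfcHom hN f x) = ∫ ζ, f ζ ∂μ := by
  have : CompactSpace (spectrum ℂ N) := isCompact_iff_compactSpace.1 (spectrum.isCompact N)
  have hadd : ∀ f g : C(spectrum ℂ N, ℝ), toC (f + g) = toC f + toC g := fun f g => by
    ext t; simp [toC]
  have hsmul : ∀ (c : ℝ) (f : C(spectrum ℂ N, ℝ)), toC (c • f) = (c : ℂ) • toC f := fun c f => by
    ext t; simp [toC]
  let Λ : CompactlySupportedContinuousMap (spectrum ℂ N) ℝ →ₚ[ℝ] ℝ :=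
    { toFun := fun f => (inner ℂ x (cfcHom hN (toC f.toContinuousMap) x)).re
      map_add' := fun f g => by
        have : (f + g).toContinuousMap = f.toContinuousMap + g.toContinuousMap := rfl
        rw [this, hadd, map_add, add_apply, inner_add_right, Complex.add_re]
      map_smul' := fun c f => by
        have : (c • f).toContinuousMap = c • f.toContinuousMap := rfl
        rw [this, hsmul, map_smul, smul_apply, inner_smul_right]
        simp
      monotone' := fun f g hfg => by
        have h0 : (0 : C(spectrum ℂ N, ℝ)) ≤ g.toContinuousMap - f.toContinuousMap := by
          rw [sub_nonneg]; exact hfg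
        have h1 := cfcHom_toC_nonneg N hN _ h0 x
        have h2 : toC g.toContinuousMap = toC f.toContinuousMap +
            toC (g.toContinuousMap - f.toContinuousMap) := by
          rw [← hadd]; congr 1; abel
        change (inner ℂ x (cfcHom hN (toC f.toContinuousMap) x)).re ≤
          (inner ℂ x (cfcHom hN (toC g.toContinuousMap) x)).re
        rw [h2, map_add, add_apply, inner_add_right, Complex.add_re]
        have := (Complex.le_def.1 h1).1
        simpa using this }
  refine ⟨RealRMK.rieszMeasure Λ, inferInstance, ?_⟩
  have hreal : ∀ f : C(spectrum ℂ N, ℝ), inner ℂ x (cfcHom hN (toC f) x) =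
      ((∫ ζ, f ζ ∂(RealRMK.rieszMeasure Λ) : ℝ) : ℂ) := by
    intro f
    have h1 := RealRMK.integral_rieszMeasure Λ ⟨f, HasCompactSupport.of_compactSpace _⟩
    have h2 : ∫ ζ, f ζ ∂(RealRMK.rieszMeasure Λ) = (inner ℂ x (cfcHom hN (toC f) x)).re := h1
    have h3 : star (toC f) = toC f := by ext t; simp [toC]
    have h4 : (inner ℂ x (cfcHom hN (toC f) x)).im = 0 := by
      rw [← Complex.conj_eq_iff_im, inner_conj_symm, ← ContinuousLinearMap.adjoint_inner_right,
        ← ContinuousLinearMap.star_eq_adjoint, ← map_star, h3]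
    rw [h2]
    exact Complex.ext rfl h4
  intro f
  let f₁ : C(spectrum ℂ N, ℝ) := ⟨fun t => (f t).re, by fun_prop⟩
  let f₂ : C(spectrum ℂ N, ℝ) := ⟨fun t => (f t).im, by fun_prop⟩
  have hf : f = toC f₁ + Complex.I • toC f₂ := by
    ext t
    simp only [toC, f₁, f₂, ContinuousMap.add_apply, ContinuousMap.smul_apply,
      ContinuousMap.coe_mk, smul_eq_mul]
    rw [mul_comm]
    exact (Complex.re_add_im _).symm
  have hint : ∀ g : C(spectrum ℂ N, ℝ), Integrable g (RealRMK.rieszMeasure Λ) := fun g =>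
    g.continuous.integrable_of_hasCompactSupport (HasCompactSupport.of_compactSpace _)
  conv_lhs => rw [hf]
  rw [map_add, map_smul, add_apply, smul_apply, inner_add_right, inner_smul_right, hreal, hreal]
  have h5 : ∫ ζ, f ζ ∂(RealRMK.rieszMeasure Λ) =
      ∫ ζ, ((f₁ ζ : ℂ) + Complex.I * (f₂ ζ : ℂ)) ∂(RealRMK.rieszMeasure Λ) := by
    congr 1; ext t
    rw [mul_comm]
    exact (Complex.re_add_im _).symm
  rw [h5, integral_add (hint f₁).ofReal ((hint f₂).ofReal.const_mul _), integral_const_mul,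
    integral_complex_ofReal, integral_complex_ofReal]

variable {A : H →ₗ.[ℂ] H}

lemma I_im_ne : Complex.I.im ≠ 0 := by simp

lemma star_resolv_I (hA : IsSelfAdjoint A) :
    star (resolv A Complex.I) = resolv A (conj Complex.I) :=
  adjoint_resolv hA I_im_ne

lemma isStarNormal_resolv (hA : IsSelfAdjoint A) : IsStarNormal (resolv A Complex.I) := by
  refine ⟨?_⟩
  rw [star_resolv_I hA]
  exact resolv_comm hA (by simp) I_im_ne

/-- The resolvent identity N - N* = 2i N N* says that the spectrum lies on the circle Im ζ = |ζ|²,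
the image of the real line under t ↦ (t - i)⁻¹ together with the point 0, which corresponds to t =
∞. -/
lemma im_eq_of_mem_spectrum (hA : IsSelfAdjoint A) {N : H →L[ℂ] H}
    (hNdef : N = resolv A Complex.I) (ζ : spectrum ℂ N) :
    (ζ : ℂ).im = Complex.normSq ζ := by
  have hN : IsStarNormal N := hNdef ▸ isStarNormal_resolv hA
  let e : C(spectrum ℂ N, ℂ) := ⟨fun t => (t : ℂ), by fun_prop⟩
  have he : cfcHom hN e = N := cfcHom_id hN
  have h1 : N - star N = (2 * Complex.I) • (N * star N) := by
    rw [hNdef, star_resolv_I hA]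
    ext x
    have := resolv_sub_resolv hA I_im_ne (w := conj Complex.I) (by simp) x
    rw [sub_apply, smul_apply, mul_apply_eq_comp]
    rw [this]
    congr 1
    simp; ring
  have h2 : cfcHom hN (e - star e) = cfcHom hN ((2 * Complex.I) • (e * star e)) := by
    rw [map_sub, map_smul, map_mul, map_star, he, h1]
  have h3 := congrArg (fun f : C(spectrum ℂ N, ℂ) => (f ζ).im) (cfcHom_injective hN h2)
  simp only [ContinuousMap.sub_apply, ContinuousMap.star_apply, ContinuousMap.smul_apply,
    ContinuousMap.mul_apply, e, ContinuousMap.coe_mk, smul_eq_mul, RCLike.star_def,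
    Complex.mul_conj] at h3
  simp at h3
  linarith

/-- No mass escapes to infinity. The functions (1 + n|ζ|²)⁻¹ dominate the indicator of 0; applied to
`N` they give contractions whose products with `N` tend to 0 in norm, so they tend to 0 strongly,
because the range of `N` is the dense domain of `A`. -/
lemma measure_zero_eq_zero (hA : IsSelfAdjoint A) (x : H)
    {N : H →L[ℂ] H} (hNdef : N = resolv A Complex.I) (hN : IsStarNormal N)
    (μ : Measure (spectrum ℂ N)) [IsFiniteMeasure μ]
    (hμ : ∀ f : C(spectrum ℂ N, ℂ), inner ℂ x (cfcHom hN f x) = ∫ ζ, f ζ ∂μ) :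
    μ {ζ | (ζ : ℂ) = 0} = 0 := by
  let e : C(spectrum ℂ N, ℂ) := ⟨fun t => (t : ℂ), by fun_prop⟩
  have he : cfcHom hN e = N := cfcHom_id hN
  let h : ℕ → C(spectrum ℂ N, ℝ) := fun n => ⟨fun t => (1 + n * ‖(t : ℂ)‖ ^ 2)⁻¹,
    Continuous.inv₀ (by fun_prop) fun t => by positivity⟩
  have hms : MeasurableSet {ζ : spectrum ℂ N | (ζ : ℂ) = 0} :=
    (isClosed_singleton.preimage continuous_subtype_val).measurableSet
  have hint : ∀ n, Integrable (h n) μ := fun n => by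
    refine Integrable.of_bound (h n).continuous.aestronglyMeasurable 1 (ae_of_all _ fun t => ?_)
    simp only [h, ContinuousMap.coe_mk]
    rw [Real.norm_of_nonneg (by positivity)]
    exact inv_le_one_of_one_le₀ (by have : 0 ≤ n * ‖(t : ℂ)‖ ^ 2 := by positivity
                                    linarith)
  have hb : ∀ n : ℕ, μ.real {ζ | (ζ : ℂ) = 0} ≤ ‖inner ℂ x (cfcHom hN (toC (h n)) x)‖ := by
    intro n
    rw [hμ]
    have h1 : ∫ ζ, toC (h n) ζ ∂μ = ((∫ ζ, h n ζ ∂μ : ℝ) : ℂ) := integral_complex_ofReal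
    rw [h1, Complex.norm_real, ← integral_indicator_one hms]
    refine (integral_mono ((integrable_const 1).indicator hms) (hint n) fun t => ?_).trans
      (le_abs_self _)
    by_cases ht : (t : ℂ) = 0
    · rw [indicator_of_mem (by exact ht)]; simp [h, ht]
    · rw [indicator_of_notMem (by exact ht)]
      change 0 ≤ (1 + n * ‖(t : ℂ)‖ ^ 2)⁻¹
      positivity
  have hT1 : ∀ n, ‖cfcHom hN (toC (h n))‖ ≤ 1 := by
    intro n
    rw [norm_cfcHom (𝕜 := ℂ) N (toC (h n)) hN, ContinuousMap.norm_le _ zero_le_one]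
    intro t
    change ‖(((1 + n * ‖(t : ℂ)‖ ^ 2)⁻¹ : ℝ) : ℂ)‖ ≤ 1
    rw [Complex.norm_real, Real.norm_of_nonneg (by positivity)]
    exact inv_le_one_of_one_le₀ (by have : 0 ≤ n * ‖(t : ℂ)‖ ^ 2 := by positivity
                                    linarith)
  have hT2 : ∀ n : ℕ, ‖cfcHom hN (toC (h n)) * N‖ ≤ 1 / Real.sqrt (n + 1) + 1 / (n + 1) := by
    intro n
    have h1 : cfcHom hN (toC (h n)) * N = cfcHom hN (toC (h n) * e) := by rw [map_mul, he]
    rw [h1, norm_cfcHom (𝕜 := ℂ) N (toC (h n) * e) hN, ContinuousMap.norm_le _ (by positivity)]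
    intro t
    change ‖(((1 + n * ‖(t : ℂ)‖ ^ 2)⁻¹ : ℝ) : ℂ) * (t : ℂ)‖ ≤ _
    rw [norm_mul, Complex.norm_real, Real.norm_of_nonneg (by positivity)]
    set r := ‖(t : ℂ)‖
    have hr : 0 ≤ r := norm_nonneg _
    have hs : 0 < Real.sqrt (n + 1) := Real.sqrt_pos.2 (by positivity)
    have hss : Real.sqrt (n + 1) ^ 2 = n + 1 := Real.sq_sqrt (by positivity)
    have hr1 : r ≤ 1 := by
      have h2 := im_eq_of_mem_spectrum hA hNdef t
      have h3 := Complex.abs_im_le_norm (t : ℂ)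
      rw [Complex.normSq_eq_norm_sq] at h2
      rw [h2, abs_of_nonneg (by positivity)] at h3
      change r ^ 2 ≤ r at h3
      nlinarith
    refine le_trans ?_ (le_add_of_nonneg_right (by positivity))
    rw [inv_mul_eq_div, div_le_div_iff₀ (by positivity) hs]
    nlinarith [sq_nonneg (Real.sqrt (n + 1) * r - 1), sq_nonneg r,
      mul_nonneg hr (sub_nonneg.2 hr1)]
  have hdense : ∀ ε > 0, ∃ v, ‖x - N v‖ < ε := by
    intro ε hε
    obtain ⟨u, hu, hxu⟩ := Metric.mem_closure_iff.1 (hA.dense_domain x) ε hε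
    have hug : (u, A ⟨u, hu⟩) ∈ A.graph := LinearPMap.mem_graph A ⟨u, hu⟩
    have h2 := (isResolvent_resolv hA I_im_ne).2 _ hug
    refine ⟨A ⟨u, hu⟩ - Complex.I • u, ?_⟩
    rw [hNdef, h2, ← dist_eq_norm]
    exact hxu
  have hreal : μ.real {ζ | (ζ : ℂ) = 0} ≤ 0 := by
    refine le_of_forall_pos_le_add fun ε hε => ?_
    obtain ⟨v, hv⟩ := hdense (ε / (‖x‖ + 1)) (by positivity)
    have hlim : Tendsto (fun n : ℕ => ‖x‖ * (ε / (‖x‖ + 1) +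
        (1 / Real.sqrt (n + 1) + 1 / (n + 1)) * ‖v‖)) atTop
        (𝓝 (‖x‖ * (ε / (‖x‖ + 1) + (0 + 0) * ‖v‖))) := by
      refine (((Tendsto.add ?_ tendsto_one_div_add_atTop_nhds_zero_nat).mul_const _).const_add
        _).const_mul _
      refine (tendsto_const_nhds.div_atTop ?_)
      refine Real.tendsto_sqrt_atTop.comp ?_
      exact tendsto_atTop_add_const_right _ _ tendsto_natCast_atTop_atTop
    have hle := ge_of_tendsto' hlim fun n => (hb n).trans (by
      refine (norm_inner_le_norm _ _).trans ?_
      gcongr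
      have h1 : cfcHom hN (toC (h n)) x = cfcHom hN (toC (h n)) (x - N v) +
          (cfcHom hN (toC (h n)) * N) v := by
        rw [mul_apply_eq_comp, map_sub]; abel
      rw [h1]
      refine (norm_add_le _ _).trans (add_le_add ?_ ?_)
      · refine ((cfcHom hN (toC (h n))).le_of_opNorm_le (hT1 n) _).trans ?_
        rw [one_mul]; exact hv.le
      · exact (cfcHom hN (toC (h n)) * N).le_of_opNorm_le (hT2 n) _)
    refine hle.trans ?_
    rw [add_zero, zero_mul, add_zero, zero_add, mul_div_assoc', div_le_iff₀ (by positivity)]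
    nlinarith [norm_nonneg x]
  have h0 : μ.real {ζ | (ζ : ℂ) = 0} = 0 := le_antisymm hreal measureReal_nonneg
  exact (measureReal_eq_zero_iff (by finiteness)).1 h0

lemma exists_isSpectralMeasure (hA : IsSelfAdjoint A) (x : H) :
    ∃ μ, IsSpectralMeasure A x μ ∧ μ.real univ = ‖x‖ ^ 2 := by
  obtain ⟨N, hNdef⟩ : ∃ N, N = resolv A Complex.I := ⟨_, rfl⟩
  have hN : IsStarNormal N := hNdef ▸ isStarNormal_resolv hA
  obtain ⟨μ, hfin, hμ⟩ := exists_measure_cfcHom N hN x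
  have hμ0 := measure_zero_eq_zero hA x hNdef hN μ hμ
  -- The inverse of t ↦ (t - i)⁻¹ on the circle. At ζ = 0 it takes the default value 0, harmless
  -- since that point is null.
  let τ : spectrum ℂ N → ℝ := fun ζ => ((ζ : ℂ)⁻¹).re
  have hτ : Measurable τ := Complex.measurable_re.comp (measurable_subtype_coe.inv)
  have hτ0 : ∀ ζ : spectrum ℂ N, (ζ : ℂ) ≠ 0 → (τ ζ : ℂ) = (ζ : ℂ)⁻¹ + Complex.I := by
    intro ζ hζ
    have h1 := im_eq_of_mem_spectrum hA hNdef ζ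
    have h2 : Complex.normSq (ζ : ℂ) ≠ 0 := (Complex.normSq_pos.2 hζ).ne'
    refine Complex.ext (by simp [τ]) ?_
    rw [Complex.ofReal_im, Complex.add_im, Complex.inv_im, h1, Complex.I_im]
    field_simp
    ring
  let e : C(spectrum ℂ N, ℂ) := ⟨fun t => (t : ℂ), by fun_prop⟩
  have he : cfcHom hN e = N := cfcHom_id hN
  refine ⟨μ.map τ, ⟨Measure.isFiniteMeasure_map _ _, fun z hz => ?_⟩, ?_⟩
  · have hg := (isResolvent_resolv hA hz).1 x
    obtain ⟨y, hy1, hy2⟩ := (LinearPMap.mem_graph_iff A).1 hg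
    refine ⟨y, by rw [hy1, hy2]; simp, ?_⟩
    have hden : ∀ ζ : spectrum ℂ N, 1 + (Complex.I - z) * (ζ : ℂ) ≠ 0 := by
      intro ζ h0
      by_cases hζ : (ζ : ℂ) = 0
      · rw [hζ] at h0; simp at h0
      · have h1 := resolvent_ne_zero hz (τ ζ)
        rw [hτ0 ζ hζ] at h1
        apply h1
        have : ((ζ : ℂ)⁻¹ + Complex.I - z) * ζ = 1 + (Complex.I - z) * ζ := by
          field_simp
          ring
        rw [h0] at this
        exact (mul_eq_zero.1 this).resolve_right hζ
    let d : C(spectrum ℂ N, ℂ) := ⟨fun t => 1 + (Complex.I - z) * t, by fun_prop⟩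
    let d' : C(spectrum ℂ N, ℂ) := ⟨fun t => (1 + (Complex.I - z) * t)⁻¹,
      Continuous.inv₀ (by fun_prop) hden⟩
    have hdd : d * d' = 1 := by
      ext t
      exact mul_inv_cancel₀ (hden t)
    have hd : cfcHom hN d = 1 + (Complex.I - z) • N := by
      have : d = 1 + (Complex.I - z) • e := by ext t; simp [d, e]
      rw [this, map_add, map_one, map_smul, he]
    -- (A - z)⁻¹ = N(1 + (i - z)N)⁻¹, a continuous function of `N`; on the spectrum it is ζ/(1 + (i
    -- - z)ζ) = (τ ζ - z)⁻¹ away from 0.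
    have hR : cfcHom hN (e * d') = resolv A z := by
      have h1 : resolv A z * cfcHom hN d = N := by
        rw [hd]
        ext v
        have h2 := resolv_sub_resolv hA hz I_im_ne v
        rw [mul_apply_eq_comp, add_apply, one_apply_eq_self, smul_apply, map_add, map_smul,
          ← neg_sub z, neg_smul, hNdef, ← h2]
        abel
      calc cfcHom hN (e * d') = N * cfcHom hN d' := by rw [map_mul, he]
        _ = resolv A z * cfcHom hN (d * d') := by rw [map_mul, ← mul_assoc, h1]
        _ = _ := by rw [hdd, map_one, mul_one]
    rw [hy1]
    simp only
    rw [← hR, hμ, integral_map hτ.aemeasurable (continuous_resolvent hz).aestronglyMeasurable]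
    refine integral_congr_ae ?_
    have : ∀ᵐ ζ : spectrum ℂ N ∂μ, (ζ : ℂ) ≠ 0 := by
      rw [ae_iff]; simpa using hμ0
    filter_upwards [this] with ζ hζ
    change (ζ : ℂ) * (1 + (Complex.I - z) * ζ)⁻¹ = _
    rw [hτ0 ζ hζ]
    have h1 := hden ζ
    have h2 : (ζ : ℂ)⁻¹ + Complex.I - z = (1 + (Complex.I - z) * ζ) * (ζ : ℂ)⁻¹ := by
      field_simp
      ring
    rw [h2, mul_inv, inv_inv, mul_comm]
  · have h1 := hμ 1
    rw [map_one, one_apply_eq_self, inner_self_eq_norm_sq_to_K] at h1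
    simp only [ContinuousMap.one_apply, integral_const] at h1
    rw [Measure.real, Measure.map_apply hτ MeasurableSet.univ, preimage_univ]
    have h2 : ((‖x‖ ^ 2 : ℝ) : ℂ) = ((μ.real univ : ℝ) : ℂ) := by
      rw [← Complex.coe_smul] at h1
      simpa using h1
    exact (Complex.ofReal_injective h2).symm

end SpectralMeasure
end RandomDirac
end

noncomputable section
set_option linter.unusedSectionVars false
namespace RandomDirac
open scoped ENNReal NNReal ComplexConjugate

/-! ### Borel functional calculus by polarization. -/

section FunctionalCalculus

variable {H : Type*} [NormedAddCommGroup H] [InnerProductSpace ℂ H] [CompleteSpace H]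
variable {A : H →ₗ.[ℂ] H}

open scoped Classical in
/-- The spectral measure of `A` at `x` (with value `0` if `A` is not self-adjoint). -/
def specMeasure (A : H →ₗ.[ℂ] H) (x : H) : Measure ℝ :=
  if hA : IsSelfAdjoint A then (exists_isSpectralMeasure hA x).choose else 0

lemma isSpectralMeasure_specMeasure (hA : IsSelfAdjoint A) (x : H) :
    IsSpectralMeasure A x (specMeasure A x) := by
  rw [specMeasure, dif_pos hA]
  exact (exists_isSpectralMeasure hA x).choose_spec.1

instance (x : H) : IsFiniteMeasure (specMeasure A x) := by
  by_cases hA : IsSelfAdjoint A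
  · exact (isSpectralMeasure_specMeasure hA x).1
  · rw [specMeasure, dif_neg hA]; infer_instance

lemma specMeasure_real_univ (hA : IsSelfAdjoint A) (x : H) :
    (specMeasure A x).real univ = ‖x‖ ^ 2 := by
  rw [specMeasure, dif_pos hA]
  exact (exists_isSpectralMeasure hA x).choose_spec.2

lemma IsSpectralMeasure.inner_resolv (hA : IsSelfAdjoint A) {x : H} {μ : Measure ℝ}
    (hμ : IsSpectralMeasure A x μ) {z : ℂ} (hz : z.im ≠ 0) :
    inner ℂ x (resolv A z x) = ∫ t : ℝ, ((t : ℂ) - z)⁻¹ ∂μ := by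
  obtain ⟨y, hy, h⟩ := hμ.2 z hz
  have h1 := (isResolvent_resolv hA hz).2 _ (LinearPMap.mem_graph A y)
  simp only [hy] at h1
  rw [h1, h]

lemma inner_resolv_eq (hA : IsSelfAdjoint A) (x : H) {z : ℂ} (hz : z.im ≠ 0) :
    inner ℂ x (resolv A z x) = ∫ t : ℝ, ((t : ℂ) - z)⁻¹ ∂(specMeasure A x) :=
  (isSpectralMeasure_specMeasure hA x).inner_resolv hA hz

lemma IsSpectralMeasure.eq_specMeasure (hA : IsSelfAdjoint A) {x : H} {μ : Measure ℝ}
    (hμ : IsSpectralMeasure A x μ) : μ = specMeasure A x := by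
  have := hμ.1
  refine ext_of_integral_resolvent fun z hz => ?_
  rw [← hμ.inner_resolv hA hz, inner_resolv_eq hA x hz]

lemma integral_poisson_specMeasure (hA : IsSelfAdjoint A) (x : H) (s : ℝ) {y : ℝ} (hy : 0 < y) :
    ∫ t, poisson s y t ∂(specMeasure A x) = y * ‖resolv A ⟨s, y⟩ x‖ ^ 2 := by
  rw [integral_poisson_eq_im hy, ← inner_resolv_eq hA x (z := ⟨s, y⟩) hy.ne',
    im_inner_resolv hA (z := ⟨s, y⟩) hy.ne']

variable {φ : ℝ → ℂ} {C : ℝ}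

lemma integrable_specMeasure (hφ : Measurable φ) (hC : ∀ t, ‖φ t‖ ≤ C) (x : H) :
    Integrable φ (specMeasure A x) :=
  Integrable.of_bound hφ.aestronglyMeasurable C (ae_of_all _ hC)

/-- The transfer principle: an identity between diagonal matrix elements that holds for all bounded
operators, in particular for resolvents, holds for φ(A). The positive and negative parts of the
coefficients give two finite measures with equal Stieltjes transforms, hence the same measure. -/
lemma sum_real_integral_specMeasure_eq_zero (hA : IsSelfAdjoint A) (hφ : Measurable φ)
    (hC : ∀ t, ‖φ t‖ ≤ C) {κ : Type*} [Fintype κ] (a : κ → ℝ) (v : κ → H)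
    (h : ∀ T : H →L[ℂ] H, ∑ j, (a j : ℂ) * inner ℂ (v j) (T (v j)) = 0) :
    ∑ j, (a j : ℂ) * ∫ t, φ t ∂(specMeasure A (v j)) = 0 := by
  let m : (κ → ℝ) → Measure ℝ := fun b => ∑ j, (b j).toNNReal • specMeasure A (v j)
  have hm : ∀ (b : κ → ℝ) (f : ℝ → ℂ), (∀ j, Integrable f (specMeasure A (v j))) →
      ∫ t, f t ∂(m b) = ∑ j, ((b j).toNNReal : ℂ) * ∫ t, f t ∂(specMeasure A (v j)) := by
    intro b f hf
    rw [integral_finsetSum_measure fun j _ => (hf j).smul_measure_nnreal]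
    refine Finset.sum_congr rfl fun j _ => ?_
    rw [integral_smul_nnreal_measure, NNReal.smul_def, Complex.real_smul]
  have hdiff : ∀ (f : ℝ → ℂ), (∀ j, Integrable f (specMeasure A (v j))) →
      ∫ t, f t ∂(m a) - ∫ t, f t ∂(m (-a)) =
        ∑ j, (a j : ℂ) * ∫ t, f t ∂(specMeasure A (v j)) := by
    intro f hf
    rw [hm a f hf, hm (-a) f hf, ← Finset.sum_sub_distrib]
    refine Finset.sum_congr rfl fun j _ => ?_
    rw [← sub_mul]
    congr 1
    rw [← Complex.ofReal_sub, Real.coe_toNNReal', Real.coe_toNNReal', Pi.neg_apply]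
    congr 1
    have := max_zero_sub_max_neg_zero_eq_self (a j)
    exact this
  have heq : m a = m (-a) := by
    have hfin : ∀ b, IsFiniteMeasure (m b) := fun b => by
      refine ⟨?_⟩
      simp only [m, Measure.finsetSum_apply]
      exact ENNReal.sum_lt_top.2 fun j _ => measure_lt_top _ _
    have := hfin a
    have := hfin (-a)
    refine ext_of_integral_resolvent fun z hz => ?_
    rw [← sub_eq_zero, hdiff _ fun j => integrable_resolvent hz _, ← h (resolv A z)]
    refine Finset.sum_congr rfl fun j _ => ?_
    rw [inner_resolv_eq hA _ hz]
  rw [← hdiff φ fun j => integrable_specMeasure hφ hC _, heq, sub_self]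

/-- Applying the hypothesis to adjoints gives the identity with conjugated coefficients, so the real
and imaginary parts of the coefficients can be treated separately. -/
lemma sum_integral_specMeasure_eq_zero (hA : IsSelfAdjoint A) (hφ : Measurable φ)
    (hC : ∀ t, ‖φ t‖ ≤ C) {κ : Type*} [Fintype κ] (c : κ → ℂ) (v : κ → H)
    (h : ∀ T : H →L[ℂ] H, ∑ j, c j * inner ℂ (v j) (T (v j)) = 0) :
    ∑ j, c j * ∫ t, φ t ∂(specMeasure A (v j)) = 0 := by
  have h' : ∀ T : H →L[ℂ] H, ∑ j, conj (c j) * inner ℂ (v j) (T (v j)) = 0 := by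
    intro T
    have h1 := congrArg (starRingEnd ℂ) (h (ContinuousLinearMap.adjoint T))
    rw [map_zero, map_sum] at h1
    rw [← h1]
    refine Finset.sum_congr rfl fun j _ => ?_
    rw [map_mul, ContinuousLinearMap.adjoint_inner_right, inner_conj_symm]
  have hre := sum_real_integral_specMeasure_eq_zero hA hφ hC (fun j => (c j).re) v fun T => by
    have := congrArg₂ (fun a b => (a + b) / 2) (h T) (h' T)
    simp only [add_zero, zero_div] at this
    rw [← this, ← Finset.sum_add_distrib, Finset.sum_div]
    refine Finset.sum_congr rfl fun j _ => ?_
    rw [← add_mul, Complex.add_conj]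
    push_cast; ring
  have him := sum_real_integral_specMeasure_eq_zero hA hφ hC (fun j => (c j).im) v fun T => by
    have := congrArg₂ (fun a b => (a - b) / (2 * Complex.I)) (h T) (h' T)
    simp only [sub_zero, zero_div] at this
    rw [← this, ← Finset.sum_sub_distrib, Finset.sum_div]
    refine Finset.sum_congr rfl fun j _ => ?_
    rw [← sub_mul, Complex.sub_conj]
    have := Complex.I_ne_zero
    push_cast
    field_simp
  have h2 : ∀ j, c j * ∫ t, φ t ∂(specMeasure A (v j)) =
      ((c j).re : ℂ) * ∫ t, φ t ∂(specMeasure A (v j)) +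
        Complex.I * (((c j).im : ℂ) * ∫ t, φ t ∂(specMeasure A (v j))) := fun j => by
    conv_lhs => rw [← Complex.re_add_im (c j)]
    ring
  simp_rw [h2]
  rw [Finset.sum_add_distrib, ← Finset.mul_sum, hre, him]
  simp

/-- The sesquilinear form `⟨x, φ(A) y⟩`, defined by polarization. -/
def polarForm (A : H →ₗ.[ℂ] H) (φ : ℝ → ℂ) (x y : H) : ℂ :=
  ∑ k : Fin 4, (conj (Complex.I ^ (k : ℕ)) / 4) *
    ∫ t, φ t ∂(specMeasure A (x + Complex.I ^ (k : ℕ) • y))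

lemma inner_eq_polarization (T : H →L[ℂ] H) (x y : H) :
    ∑ k : Fin 4, (conj (Complex.I ^ (k : ℕ)) / 4) *
      inner ℂ (x + Complex.I ^ (k : ℕ) • y) (T (x + Complex.I ^ (k : ℕ) • y)) =
      inner ℂ x (T y) := by
  have h2 : Complex.I ^ 2 = -1 := Complex.I_sq
  have h3 : ((3 : Fin 4) : ℕ) = 3 := rfl
  have h4 : Complex.I ^ 3 = -Complex.I := by rw [pow_succ, h2]; ring
  simp only [Fin.sum_univ_four, Fin.val_zero, Fin.val_one, Fin.val_two, h3, pow_zero, pow_one, h2,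
    h4, map_neg, map_one, Complex.conj_I, map_add, map_smul, inner_add_left, inner_add_right,
    inner_smul_left, inner_smul_right]
  linear_combination (inner ℂ y (T x) / 2 - inner ℂ x (T y) / 2) * h2

lemma sum_polarForm_eq_zero (hA : IsSelfAdjoint A) (hφ : Measurable φ)
    (hC : ∀ t, ‖φ t‖ ≤ C) {κ : Type*} [Fintype κ] (c : κ → ℂ) (v w : κ → H)
    (h : ∀ T : H →L[ℂ] H, ∑ j, c j * inner ℂ (v j) (T (w j)) = 0) :
    ∑ j, c j * polarForm A φ (v j) (w j) = 0 := by
  have := sum_integral_specMeasure_eq_zero hA hφ hC (κ := κ × Fin 4)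
    (fun p => c p.1 * (conj (Complex.I ^ (p.2 : ℕ)) / 4))
    (fun p => v p.1 + Complex.I ^ (p.2 : ℕ) • w p.1) fun T => by
      rw [Fintype.sum_prod_type, ← h T]
      refine Finset.sum_congr rfl fun j _ => ?_
      rw [← inner_eq_polarization, Finset.mul_sum]
      simp only [mul_assoc]
  rw [← this, Fintype.sum_prod_type]
  refine Finset.sum_congr rfl fun j _ => ?_
  rw [polarForm, Finset.mul_sum]
  simp only [mul_assoc]

lemma polarForm_self (hA : IsSelfAdjoint A) (hφ : Measurable φ) (hC : ∀ t, ‖φ t‖ ≤ C) (x : H) :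
    polarForm A φ x x = ∫ t, φ t ∂(specMeasure A x) := by
  have := sum_integral_specMeasure_eq_zero hA hφ hC (κ := Unit ⊕ Fin 4)
    (Sum.elim (fun _ => -1) fun k => conj (Complex.I ^ (k : ℕ)) / 4)
    (Sum.elim (fun _ => x) fun k => x + Complex.I ^ (k : ℕ) • x) fun T => by
      rw [Fintype.sum_sum_type]
      simp only [Sum.elim_inl, Sum.elim_inr]
      rw [inner_eq_polarization]
      simp
  rw [Fintype.sum_sum_type] at this
  simp only [Sum.elim_inl, Sum.elim_inr, Finset.univ_unique, Finset.sum_const,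
    Finset.card_singleton, one_smul] at this
  rw [polarForm]
  linear_combination this

/-- There are four terms with factor 1/4, each against a measure of total mass ‖x + iᵏy‖² ≤ 4. -/
lemma norm_polarForm_le_of_le_one (hA : IsSelfAdjoint A) (hC : ∀ t, ‖φ t‖ ≤ C) {x y : H}
    (hx : ‖x‖ ≤ 1) (hy : ‖y‖ ≤ 1) : ‖polarForm A φ x y‖ ≤ 4 * C := by
  have hC0 : 0 ≤ C := (norm_nonneg _).trans (hC 0)
  have h1 : ∀ k : Fin 4, ‖(conj (Complex.I ^ (k : ℕ)) / 4) *
      ∫ t, φ t ∂(specMeasure A (x + Complex.I ^ (k : ℕ) • y))‖ ≤ C := by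
    intro k
    have h2 : ‖x + Complex.I ^ (k : ℕ) • y‖ ≤ 2 := by
      refine (norm_add_le _ _).trans ?_
      rw [norm_smul, norm_pow, Complex.norm_I, one_pow, one_mul]
      linarith
    have h3 := norm_integral_le_of_norm_le_const (μ := specMeasure A (x + Complex.I ^ (k : ℕ) • y))
      (ae_of_all _ hC)
    rw [specMeasure_real_univ hA] at h3
    rw [norm_mul, norm_div, Complex.norm_conj, norm_pow, Complex.norm_I, one_pow]
    have h4 : ‖(4 : ℂ)‖ = 4 := by simp
    rw [h4]
    have h5 : C * ‖x + Complex.I ^ (k : ℕ) • y‖ ^ 2 ≤ C * 2 ^ 2 := by gcongr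
    linarith
  refine (norm_sum_le _ _).trans ((Finset.sum_le_sum fun k _ => h1 k).trans ?_)
  simp

lemma exists_isFunctionOf (hA : IsSelfAdjoint A) (hφ : Measurable φ) (hC : ∀ t, ‖φ t‖ ≤ C) :
    ∃ T, IsFunctionOf A φ T := by
  -- Sesquilinearity is a family of linear identities valid for every form ⟨x, Ty⟩, so it is
  -- inherited by `polarForm`.
  have hadd₁ : ∀ x x' y, polarForm A φ (x + x') y = polarForm A φ x y + polarForm A φ x' y := by
    intro x x' y
    have := sum_polarForm_eq_zero hA hφ hC ![1, -1, -1] ![x + x', x, x'] ![y, y, y] fun T => by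
      simp [Fin.sum_univ_three]
    simp [Fin.sum_univ_three] at this
    linear_combination this
  have hsmul₁ : ∀ (a : ℂ) x y, polarForm A φ (a • x) y = conj a * polarForm A φ x y := by
    intro a x y
    have := sum_polarForm_eq_zero hA hφ hC ![1, -conj a] ![a • x, x] ![y, y] fun T => by
      simp [Fin.sum_univ_two, mul_comm]
    simp [Fin.sum_univ_two] at this
    linear_combination this
  have hadd₂ : ∀ x y y', polarForm A φ x (y + y') = polarForm A φ x y + polarForm A φ x y' := by
    intro x y y'
    have := sum_polarForm_eq_zero hA hφ hC ![1, -1, -1] ![x, x, x] ![y + y', y, y'] fun T => by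
      simp [Fin.sum_univ_three]
    simp [Fin.sum_univ_three] at this
    linear_combination this
  have hsmul₂ : ∀ (a : ℂ) x y, polarForm A φ x (a • y) = a * polarForm A φ x y := by
    intro a x y
    have := sum_polarForm_eq_zero hA hφ hC ![1, -a] ![x, x] ![a • y, y] fun T => by
      simp [Fin.sum_univ_two]
    simp [Fin.sum_univ_two] at this
    linear_combination this
  have hbound : ∀ x y, ‖polarForm A φ x y‖ ≤ 4 * C * ‖x‖ * ‖y‖ := by
    intro x y
    by_cases hx : x = 0
    · have : polarForm A φ x y = 0 := by
        have := hsmul₁ 0 x y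
        rw [zero_smul, map_zero, zero_mul] at this
        rw [hx, this]
      rw [this, hx]; simp
    by_cases hy : y = 0
    · have : polarForm A φ x y = 0 := by
        have := hsmul₂ 0 x y
        rw [zero_smul, zero_mul] at this
        rw [hy, this]
      rw [this, hy]; simp
    have hx' : ‖x‖ ≠ 0 := norm_ne_zero_iff.2 hx
    have hy' : ‖y‖ ≠ 0 := norm_ne_zero_iff.2 hy
    have h1 : ∀ v : H, ‖v‖ ≠ 0 → ‖((‖v‖⁻¹ : ℝ) : ℂ) • v‖ ≤ 1 := fun v hv => by
      rw [norm_smul, Complex.norm_real, norm_inv, norm_norm, inv_mul_cancel₀ hv]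
    have h2 := norm_polarForm_le_of_le_one (φ := φ) hA hC (h1 x hx') (h1 y hy')
    rw [hsmul₁, hsmul₂, norm_mul, norm_mul, Complex.norm_conj, Complex.norm_real,
      Complex.norm_real, norm_inv, norm_inv, norm_norm, norm_norm] at h2
    have hx0 : 0 < ‖x‖ := norm_pos_iff.2 hx
    have hy0 : 0 < ‖y‖ := norm_pos_iff.2 hy
    rw [inv_mul_le_iff₀ hx0, inv_mul_le_iff₀ hy0] at h2
    linarith
  let B₀ : H →ₗ⋆[ℂ] H →ₗ[ℂ] ℂ := LinearMap.mk₂'ₛₗ (starRingEnd ℂ) (RingHom.id ℂ) (polarForm A φ)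
    hadd₁ hsmul₁ hadd₂ hsmul₂
  let B : H →L⋆[ℂ] H →L[ℂ] ℂ := B₀.mkContinuous₂ (4 * C) hbound
  let S := InnerProductSpace.continuousLinearMapOfBilin B
  -- `S` represents the form through ⟨Sx, y⟩, in the antilinear slot, so φ(A) is its adjoint.
  refine ⟨ContinuousLinearMap.adjoint S, hA, fun x => ⟨specMeasure A x,
    isSpectralMeasure_specMeasure hA x, ?_⟩⟩
  rw [ContinuousLinearMap.adjoint_inner_right, InnerProductSpace.continuousLinearMapOfBilin_apply]
  exact polarForm_self hA hφ hC x

lemma isFunctionOf_borelFC (hA : IsSelfAdjoint A) (hφ : Measurable φ) (hC : ∀ t, ‖φ t‖ ≤ C) :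
    IsFunctionOf A φ (borelFC A φ) := by
  rw [borelFC, dif_pos (exists_isFunctionOf hA hφ hC)]
  exact (exists_isFunctionOf hA hφ hC).choose_spec

lemma inner_borelFC (hA : IsSelfAdjoint A) (hφ : Measurable φ) (hC : ∀ t, ‖φ t‖ ≤ C) (x : H) :
    inner ℂ x (borelFC A φ x) = ∫ t, φ t ∂(specMeasure A x) := by
  obtain ⟨μ, hμ, h⟩ := (isFunctionOf_borelFC hA hφ hC).2 x
  rw [h, hμ.eq_specMeasure hA]

/-! ### Spectral projections at points -/

/-- The spectral projection of `A` at the point `E`. -/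
def pointProj (A : H →ₗ.[ℂ] H) (E : ℝ) : H →L[ℂ] H :=
  borelFC A (indicator {E} fun _ => 1)

lemma inner_pointProj_self (hA : IsSelfAdjoint A) (E : ℝ) (x : H) :
    inner ℂ x (pointProj A E x) = ((specMeasure A x).real {E} : ℂ) := by
  have h1 : Measurable (indicator {E} fun _ => (1 : ℂ)) :=
    measurable_const.indicator (measurableSet_singleton E)
  rw [pointProj, inner_borelFC hA h1 (C := 1), integral_indicator (measurableSet_singleton E)]
  · simp [Measure.real]
  · intro t
    refine (norm_indicator_le_norm_self _ _).trans (by simp)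

/-- The function -iε/(t - E - iε) is 1 at t = E, is bounded by 1 and tends to 0 elsewhere. Dominated
convergence gives the diagonal case, polarization the rest. -/
lemma tendsto_inner_resolv_pointProj (hA : IsSelfAdjoint A) (E : ℝ) (x v : H) :
    Tendsto (fun n : ℕ => inner ℂ x
      ((-(Complex.I * (1 / ((n : ℝ) + 1) : ℝ))) • resolv A ⟨E, 1 / ((n : ℝ) + 1)⟩ v)) atTop
      (𝓝 (inner ℂ x (pointProj A E v))) := by
  have hdiag : ∀ x : H, Tendsto (fun n : ℕ => inner ℂ x
      ((-(Complex.I * (1 / ((n : ℝ) + 1) : ℝ))) • resolv A ⟨E, 1 / ((n : ℝ) + 1)⟩ x)) atTop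
      (𝓝 (inner ℂ x (pointProj A E x))) := by
    intro x
    have hn : ∀ n : ℕ, (0 : ℝ) < 1 / ((n : ℝ) + 1) := fun n => by positivity
    have hn' : ∀ n : ℕ, (⟨E, 1 / ((n : ℝ) + 1)⟩ : ℂ).im ≠ 0 := fun n => (hn n).ne'
    have h1 : Measurable (indicator {E} fun _ => (1 : ℂ)) :=
      measurable_const.indicator (measurableSet_singleton E)
    rw [pointProj, inner_borelFC hA h1 (C := 1) fun t =>
      (norm_indicator_le_norm_self _ _).trans (by simp)]
    simp_rw [inner_smul_right, inner_resolv_eq hA x (hn' _), ← integral_const_mul]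
    refine tendsto_integral_of_dominated_convergence (fun _ => 1)
      (fun n => ((continuous_resolvent (hn' n)).const_mul _).aestronglyMeasurable)
      (integrable_const _) (fun n => ae_of_all _ fun t => ?_) (ae_of_all _ fun t => ?_)
    · rw [norm_mul, norm_neg, norm_mul, Complex.norm_I, one_mul, Complex.norm_real,
        Real.norm_of_nonneg (hn n).le]
      refine (mul_le_mul_of_nonneg_left (norm_resolvent_le (hn' n) t) (hn n).le).trans ?_
      rw [abs_of_pos (hn n)]
      exact (mul_inv_cancel₀ (hn n).ne').le
    · by_cases ht : t = E
      · rw [indicator_of_mem (by exact ht)]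
        refine tendsto_const_nhds.congr fun n => ?_
        have h2 : (t : ℂ) - ⟨E, 1 / ((n : ℝ) + 1)⟩ =
            -(Complex.I * (1 / ((n : ℝ) + 1) : ℝ)) := by
          rw [Complex.mk_eq_add_mul_I, ht]; ring
        have h3 := resolvent_ne_zero (hn' n) t
        rw [h2] at h3 ⊢
        exact (mul_inv_cancel₀ h3).symm
      · rw [indicator_of_notMem (by exact ht)]
        have h0 : Tendsto (fun n : ℕ => 1 / ((n : ℝ) + 1)) atTop (𝓝 0) :=
          tendsto_one_div_add_atTop_nhds_zero_nat
        have h2 : Tendsto (fun n : ℕ => (-(Complex.I * ((1 / ((n : ℝ) + 1) : ℝ) : ℂ)))) atTop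
            (𝓝 (-(Complex.I * ((0 : ℝ) : ℂ)))) :=
          (((Complex.continuous_ofReal.tendsto 0).comp h0).const_mul _).neg
        have h3 : Tendsto (fun n : ℕ => ((t : ℂ) - ⟨E, 1 / ((n : ℝ) + 1)⟩)⁻¹) atTop
            (𝓝 (((t : ℂ) - ((E : ℝ) + (0 : ℝ) * Complex.I))⁻¹)) := by
          refine Tendsto.inv₀ (tendsto_const_nhds.sub ?_) ?_
          · have h4 : ∀ n : ℕ, (⟨E, 1 / ((n : ℝ) + 1)⟩ : ℂ) =
                E + ((1 / ((n : ℝ) + 1) : ℝ) : ℂ) * Complex.I := fun n =>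
              Complex.mk_eq_add_mul_I _ _
            simp_rw [h4]
            exact (((Complex.continuous_ofReal.tendsto 0).comp h0).mul_const _).const_add _
          · rw [Complex.ofReal_zero, zero_mul, add_zero, sub_ne_zero]
            exact_mod_cast ht
        have := h2.mul h3
        simpa using this
  simp_rw [← smul_apply]
  simp_rw [← inner_eq_polarization _ x v]
  refine tendsto_finsetSum _ fun k _ => ?_
  exact (hdiag _).const_mul _

lemma norm_pointProj_le (hA : IsSelfAdjoint A) (E : ℝ) : ‖pointProj A E‖ ≤ 1 := by
  refine ContinuousLinearMap.opNorm_le_bound _ zero_le_one fun x => ?_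
  rw [one_mul]
  set v := pointProj A E x with hv
  have h1 := (tendsto_inner_resolv_pointProj hA E v x).norm
  have h2 : ‖inner ℂ v (pointProj A E x)‖ ≤ ‖v‖ * ‖x‖ := by
    refine le_of_tendsto' h1 fun n => ?_
    refine (norm_inner_le_norm _ _).trans ?_
    gcongr
    have hn : (0 : ℝ) < 1 / ((n : ℝ) + 1) := by positivity
    rw [norm_smul, norm_neg, norm_mul, Complex.norm_I, one_mul, Complex.norm_real,
        Real.norm_of_nonneg hn.le]
    refine (mul_le_mul_of_nonneg_left (norm_resolv_apply_le hA
      (z := ⟨E, 1 / ((n : ℝ) + 1)⟩) hn.ne' x) hn.le).trans ?_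
    simp only
    rw [abs_of_pos hn, ← mul_assoc, mul_inv_cancel₀ hn.ne', one_mul]
  rw [← hv, inner_self_eq_norm_sq_to_K] at h2
  simp only [norm_pow, Complex.coe_algebraMap, Complex.norm_real, norm_norm] at h2
  nlinarith [norm_nonneg v, norm_nonneg x]

/-- Multiplying the resolvent identity for i and E + iε by -iε and letting ε → 0 shows that (A -
i)⁻¹ acts as (E - i)⁻¹ on the range of the projection; so this range consists of eigenvectors. -/
lemma pointProj_mem_graph (hA : IsSelfAdjoint A) (E : ℝ) (x : H) :
    (pointProj A E x, (E : ℂ) • pointProj A E x) ∈ A.graph := by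
  have hz : Complex.I.im ≠ 0 := by simp
  have hkey : ((E : ℂ) - Complex.I) • resolv A Complex.I (pointProj A E x) = pointProj A E x := by
    refine ext_inner_left ℂ fun v => ?_
    have h1 := tendsto_inner_resolv_pointProj hA E
      (ContinuousLinearMap.adjoint (resolv A Complex.I) v) x
    rw [ContinuousLinearMap.adjoint_inner_left] at h1
    have h2 := tendsto_inner_resolv_pointProj hA E v x
    have h0 : Tendsto (fun n : ℕ => 1 / ((n : ℝ) + 1)) atTop (𝓝 0) :=
      tendsto_one_div_add_atTop_nhds_zero_nat
    have h0' : Tendsto (fun n : ℕ => ((1 / ((n : ℝ) + 1) : ℝ) : ℂ)) atTop (𝓝 ((0 : ℝ) : ℂ)) :=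
      (Complex.continuous_ofReal.tendsto 0).comp h0
    have h3 : Tendsto (fun n : ℕ => -(Complex.I * ((1 / ((n : ℝ) + 1) : ℝ) : ℂ)) *
        inner ℂ v (resolv A Complex.I x)) atTop
        (𝓝 (-(Complex.I * ((0 : ℝ) : ℂ)) * inner ℂ v (resolv A Complex.I x))) :=
      ((h0'.const_mul _).neg).mul_const _
    have h4 : Tendsto (fun n : ℕ => Complex.I - ((E : ℂ) + ((1 / ((n : ℝ) + 1) : ℝ) : ℂ) *
        Complex.I)) atTop (𝓝 (Complex.I - ((E : ℂ) + ((0 : ℝ) : ℂ) * Complex.I))) :=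
      ((h0'.mul_const _).const_add _).const_sub _
    have h5 := tendsto_nhds_unique (h4.mul h1) ((h3.sub h2).congr fun n => ?_)
    · rw [inner_smul_right]
      simp only [Complex.ofReal_zero, zero_mul, add_zero, mul_zero, neg_zero, zero_sub] at h5
      linear_combination -h5
    · have hn : (0 : ℝ) < 1 / ((n : ℝ) + 1) := by positivity
      have h6 := resolv_sub_resolv hA hz (w := ⟨E, 1 / ((n : ℝ) + 1)⟩) hn.ne' x
      have h7 : (⟨E, 1 / ((n : ℝ) + 1)⟩ : ℂ) =
          E + ((1 / ((n : ℝ) + 1) : ℝ) : ℂ) * Complex.I :=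
        Complex.mk_eq_add_mul_I _ _
      rw [ContinuousLinearMap.adjoint_inner_left, map_smul, inner_smul_right, inner_smul_right,
        ← h7]
      have h8 := congrArg (inner ℂ v) h6
      rw [inner_sub_right, inner_smul_right] at h8
      linear_combination (-(Complex.I * ((1 / ((n : ℝ) + 1) : ℝ) : ℂ))) * h8
  have h := (isResolvent_resolv hA hz).1 (pointProj A E x)
  have h2 := A.graph.smul_mem ((E : ℂ) - Complex.I) h
  convert h2 using 1
  ext
  · exact hkey.symm
  · simp only [Prod.smul_snd, smul_add]
    rw [smul_comm _ Complex.I, hkey, ← add_smul]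
    congr 1; ring

end FunctionalCalculus
end RandomDirac
end

noncomputable section
set_option linter.unusedSectionVars false
namespace RandomDirac
open scoped ENNReal NNReal ComplexConjugate

/-! ### Primitives of integrable functions -/

section Primitive

variable {E F : Type*} [NormedAddCommGroup E] [NormedSpace ℝ E] [CompleteSpace E]
  [NormedAddCommGroup F] [NormedSpace ℝ F] [CompleteSpace F]

/-- `f` is absolutely continuous on `[c, d]` with derivative `g`. -/
structure IsPrimitive (f g : ℝ → E) (c d : ℝ) : Prop where
  le : c ≤ d
  integrable : IntervalIntegrable g volume c d
  eq : ∀ x ∈ Icc c d, f x = f c + ∫ t in c..x, g t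

namespace IsPrimitive

variable {f g : ℝ → E} {c d : ℝ}

lemma integrable_sub (hf : IsPrimitive f g c d) {x y : ℝ} (hx : x ∈ Icc c d) (hy : y ∈ Icc c d) :
    IntervalIntegrable g volume x y :=
  hf.integrable.mono_set (by
    rw [uIcc_of_le hf.le]
    exact ordConnected_Icc.uIcc_subset hx hy)

lemma sub_eq (hf : IsPrimitive f g c d) {x y : ℝ} (hx : x ∈ Icc c d) (hy : y ∈ Icc c d) :
    f y - f x = ∫ t in x..y, g t := by
  have hc : c ∈ Icc c d := left_mem_Icc.2 hf.le
  rw [hf.eq x hx, hf.eq y hy, add_sub_add_left_eq_sub,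
    intervalIntegral.integral_interval_sub_left (hf.integrable_sub hc hy) (hf.integrable_sub hc hx)]

lemma continuousOn (hf : IsPrimitive f g c d) : ContinuousOn f (Icc c d) := by
  have h1 := intervalIntegral.continuousOn_primitive_interval' hf.integrable left_mem_uIcc
  rw [uIcc_of_le hf.le] at h1
  exact (continuousOn_const.add h1).congr hf.eq

/-- The increments of `f` are dominated by those of the primitive of ‖g‖. -/
lemma absolutelyContinuous (hf : IsPrimitive f g c d) : AbsolutelyContinuousOnInterval f c d := by
  have h1 := hf.integrable.norm.absolutelyContinuousOnInterval_intervalIntegral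
    (left_mem_uIcc (a := c) (b := d))
  rw [absolutelyContinuousOnInterval_iff] at h1 ⊢
  intro ε hε
  obtain ⟨δ, hδ, h⟩ := h1 ε hε
  refine ⟨δ, hδ, fun E hE hlt => lt_of_le_of_lt (Finset.sum_le_sum fun i hi => ?_) (h E hE hlt)⟩
  have hmem := hE.1 i hi
  rw [uIcc_of_le hf.le] at hmem
  have hc : c ∈ Icc c d := left_mem_Icc.2 hf.le
  rw [dist_eq_norm, dist_eq_norm, hf.sub_eq hmem.2 hmem.1,
    intervalIntegral.integral_interval_sub_left (hf.integrable_sub hc hmem.1).norm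
      (hf.integrable_sub hc hmem.2).norm, Real.norm_eq_abs]
  exact intervalIntegral.norm_integral_le_abs_integral_norm

lemma ae_hasDerivAt (hf : IsPrimitive f g c d) : ∀ᵐ x, x ∈ uIcc c d → HasDerivAt f (g x) x := by
  have h0 : ∀ᵐ x : ℝ, x ≠ c ∧ x ≠ d := by
    have : ∀ a : ℝ, ∀ᵐ x : ℝ, x ≠ a := fun a => by
      rw [ae_iff]; simp
    exact (this c).and (this d)
  filter_upwards [hf.integrable.ae_hasDerivAt_integral, h0] with x hx h hm
  have h1 := (hx hm c left_mem_uIcc).const_add (f c)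
  rw [uIcc_of_le hf.le] at hm
  refine h1.congr_of_eventuallyEq ?_
  filter_upwards [Icc_mem_nhds (lt_of_le_of_ne hm.1 h.1.symm) (lt_of_le_of_ne hm.2 h.2)] with y hy
  exact hf.eq y hy

lemma congr_ae (hf : IsPrimitive f g c d) {g' : ℝ → E}
    (h : ∀ᵐ x ∂(volume.restrict (Icc c d)), g x = g' x) : IsPrimitive f g' c d := by
  have h' : ∀ᵐ x, x ∈ Icc c d → g x = g' x := (ae_restrict_iff' measurableSet_Icc).1 h
  refine ⟨hf.le, hf.integrable.congr_ae ?_, fun x hx => ?_⟩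
  · rw [uIoc_of_le hf.le]
    exact ae_restrict_of_ae_restrict_of_subset Ioc_subset_Icc_self h
  · rw [hf.eq x hx]
    congr 1
    refine intervalIntegral.integral_congr_ae ?_
    filter_upwards [h'] with t ht htm
    rw [uIoc_of_le hx.1] at htm
    exact ht ⟨htm.1.le, htm.2.trans hx.2⟩

lemma clm (hf : IsPrimitive f g c d) (L : E →L[ℝ] F) :
    IsPrimitive (fun x => L (f x)) (fun x => L (g x)) c d := by
  refine ⟨hf.le, ⟨L.integrable_comp hf.integrable.1, L.integrable_comp hf.integrable.2⟩,
    fun x hx => ?_⟩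
  rw [hf.eq x hx, map_add, L.intervalIntegral_comp_comm
    (hf.integrable_sub (left_mem_Icc.2 hf.le) hx)]

lemma add (hf : IsPrimitive f g c d) {h k : ℝ → E} (hh : IsPrimitive h k c d) :
    IsPrimitive (fun x => f x + h x) (fun x => g x + k x) c d := by
  refine ⟨hf.le, hf.integrable.add hh.integrable, fun x hx => ?_⟩
  rw [intervalIntegral.integral_add (hf.integrable_sub (left_mem_Icc.2 hf.le) hx)
    (hh.integrable_sub (left_mem_Icc.2 hf.le) hx), hf.eq x hx, hh.eq x hx]
  abel

/-- The product minus the primitive of the Leibniz expression is absolutely continuous with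
derivative 0 almost everywhere, hence constant. -/
lemma mul {f g h k : ℝ → ℂ} (hf : IsPrimitive f g c d) (hh : IsPrimitive h k c d) :
    IsPrimitive (fun x => f x * h x) (fun x => g x * h x + f x * k x) c d := by
  have hfc := hf.continuousOn
  have hhc := hh.continuousOn
  rw [← uIcc_of_le hf.le] at hfc hhc
  have hint : IntervalIntegrable (fun x => g x * h x + f x * k x) volume c d :=
    (hf.integrable.mul_continuousOn hhc).add (hh.integrable.continuousOn_mul hfc)
  have hP : IsPrimitive (fun x => ∫ t in c..x, (g t * h t + f t * k t))
      (fun x => g x * h x + f x * k x) c d := ⟨hf.le, hint, fun x _ => by simp⟩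
  have hac : AbsolutelyContinuousOnInterval
      (fun x => f x * h x - ∫ t in c..x, (g t * h t + f t * k t)) c d :=
    (hf.absolutelyContinuous.smul hh.absolutelyContinuous).sub hP.absolutelyContinuous
  obtain ⟨C, hC⟩ := hac.const_of_ae_hasDerivAt_zero (by
    filter_upwards [hf.ae_hasDerivAt, hh.ae_hasDerivAt, hP.ae_hasDerivAt] with x h1 h2 h3 hx
    have h4 := ((h1 hx).mul (h2 hx)).sub (h3 hx)
    rw [sub_self] at h4
    exact h4)
  refine ⟨hf.le, hint, fun x hx => ?_⟩
  rw [uIcc_of_le hf.le] at hC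
  have h1 := hC x hx
  have h2 := hC c (left_mem_Icc.2 hf.le)
  simp only [intervalIntegral.integral_same] at h2
  linear_combination h1 - h2

lemma inner {f g h k : ℝ → EuclideanSpace ℂ (Fin 2)} (hf : IsPrimitive f g c d)
    (hh : IsPrimitive h k c d) :
    IsPrimitive (fun x => inner ℂ (f x) (h x))
      (fun x => inner ℂ (g x) (h x) + inner ℂ (f x) (k x)) c d := by
  have hp : ∀ i {f g : ℝ → EuclideanSpace ℂ (Fin 2)}, IsPrimitive f g c d →
      IsPrimitive (fun x => f x i) (fun x => g x i) c d := fun i f g hf =>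
    hf.clm ((EuclideanSpace.proj i : EuclideanSpace ℂ (Fin 2) →L[ℂ] ℂ).restrictScalars ℝ)
  have hpc : ∀ i {f g : ℝ → EuclideanSpace ℂ (Fin 2)}, IsPrimitive f g c d →
      IsPrimitive (fun x => conj (f x i)) (fun x => conj (g x i)) c d := fun i f g hf =>
    (hp i hf).clm Complex.conjCLE.toContinuousLinearMap
  have h1 := ((hp 0 hh).mul (hpc 0 hf)).add ((hp 1 hh).mul (hpc 1 hf))
  simp only [PiLp.inner_apply, Fin.sum_univ_two, RCLike.inner_apply]
  convert h1 using 2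
  ring

end IsPrimitive
end Primitive

/-! ### Matrices -/

lemma act_apply (M : Matrix (Fin 2) (Fin 2) ℂ) (v : EuclideanSpace ℂ (Fin 2)) (i : Fin 2) :
    act M v i = M i 0 * v 0 + M i 1 * v 1 := by
  fin_cases i <;> simp [act, Matrix.toEuclideanLin, Matrix.toLpLin_apply]

lemma act_J_apply_zero (v : EuclideanSpace ℂ (Fin 2)) : act J v 0 = -v 1 := by
  simp [act_apply, J]

lemma act_J_apply_one (v : EuclideanSpace ℂ (Fin 2)) : act J v 1 = v 0 := by
  simp [act_apply, J]

lemma act_J_act_J (v : EuclideanSpace ℂ (Fin 2)) : act J (act J v) = -v := by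
  ext i
  fin_cases i <;> simp [act_J_apply_zero, act_J_apply_one]

lemma norm_act_J (v : EuclideanSpace ℂ (Fin 2)) : ‖act J v‖ = ‖v‖ := by
  rw [EuclideanSpace.norm_eq, EuclideanSpace.norm_eq]
  simp [Fin.sum_univ_two, act_J_apply_zero, act_J_apply_one, add_comm]

lemma inner_act_J (v w : EuclideanSpace ℂ (Fin 2)) :
    inner ℂ (act J v) w = -inner ℂ v (act J w) := by
  simp only [PiLp.inner_apply, Fin.sum_univ_two, RCLike.inner_apply, act_J_apply_zero,
    act_J_apply_one, map_neg]
  ring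

/-- The action of `J` as a continuous linear map. -/
def actJ : EuclideanSpace ℂ (Fin 2) →L[ℂ] EuclideanSpace ℂ (Fin 2) :=
  LinearMap.toContinuousLinearMap (Matrix.toEuclideanLin J)

lemma actJ_apply (v : EuclideanSpace ℂ (Fin 2)) : actJ v = act J v := rfl

/-- The action of the potential at a point. -/
def pot (W : ℝ → Matrix (Fin 2) (Fin 2) ℝ) (x : ℝ) :
    EuclideanSpace ℂ (Fin 2) →L[ℂ] EuclideanSpace ℂ (Fin 2) :=
  LinearMap.toContinuousLinearMap (Matrix.toEuclideanLin ((W x).map fun r : ℝ => (r : ℂ)))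

lemma pot_apply (W : ℝ → Matrix (Fin 2) (Fin 2) ℝ) (x : ℝ) (v : EuclideanSpace ℂ (Fin 2)) :
    pot W x v = act ((W x).map fun r : ℝ => (r : ℂ)) v := rfl

lemma pot_apply_coord (W : ℝ → Matrix (Fin 2) (Fin 2) ℝ) (x : ℝ)
    (v : EuclideanSpace ℂ (Fin 2)) (i : Fin 2) :
    pot W x v i = (W x i 0 : ℂ) * v 0 + (W x i 1 : ℂ) * v 1 := by
  rw [pot_apply, act_apply]; rfl

variable {W : ℝ → Matrix (Fin 2) (Fin 2) ℝ}

lemma inner_pot (h : ∀ x, (W x).IsSymm) (x : ℝ) (v w : EuclideanSpace ℂ (Fin 2)) :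
    inner ℂ (pot W x v) w = inner ℂ v (pot W x w) := by
  have h1 : W x 1 0 = W x 0 1 := (h x).apply 0 1
  simp only [PiLp.inner_apply, Fin.sum_univ_two, RCLike.inner_apply, pot_apply_coord, map_add,
    map_mul, Complex.conj_ofReal, h1]
  ring

lemma norm_le_coord_add (v : EuclideanSpace ℂ (Fin 2)) : ‖v‖ ≤ ‖v 0‖ + ‖v 1‖ := by
  rw [EuclideanSpace.norm_eq, Fin.sum_univ_two]
  refine Real.sqrt_le_iff.2 ⟨by positivity, ?_⟩
  nlinarith [norm_nonneg (v 0), norm_nonneg (v 1)]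

/-- `W` is a potential bounded (entrywise) by `B`. -/
structure IsBddPotential (W : ℝ → Matrix (Fin 2) (Fin 2) ℝ) (B : ℝ) : Prop where
  symm : ∀ x, (W x).IsSymm
  measurable : ∀ i j, Measurable fun x => W x i j
  bound : ∀ x i j, |W x i j| ≤ B

lemma norm_pot_le_of_entry {B x : ℝ} (hB : ∀ i j, |W x i j| ≤ B) (v : EuclideanSpace ℂ (Fin 2)) :
    ‖pot W x v‖ ≤ 4 * B * ‖v‖ := by
  have hB0 : 0 ≤ B := (abs_nonneg _).trans (hB 0 0)
  have h1 : ∀ i, ‖pot W x v i‖ ≤ 2 * B * ‖v‖ := by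
    intro i
    rw [pot_apply_coord]
    refine (norm_add_le _ _).trans ?_
    rw [norm_mul, norm_mul, Complex.norm_real, Complex.norm_real, Real.norm_eq_abs,
      Real.norm_eq_abs]
    have h0 := mul_le_mul (hB i 0) (PiLp.norm_apply_le v 0) (norm_nonneg _) hB0
    have h1 := mul_le_mul (hB i 1) (PiLp.norm_apply_le v 1) (norm_nonneg _) hB0
    linarith
  refine (norm_le_coord_add _).trans ?_
  linarith [h1 0, h1 1]

lemma IsBddPotential.norm_pot_le {B : ℝ} (hW : IsBddPotential W B) (x : ℝ)
    (v : EuclideanSpace ℂ (Fin 2)) : ‖pot W x v‖ ≤ 4 * B * ‖v‖ :=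
  norm_pot_le_of_entry (hW.bound x) v

lemma aestronglyMeasurable_pot (hW : ∀ i j, Measurable fun x => W x i j) {μ : Measure ℝ}
    {f : ℝ → EuclideanSpace ℂ (Fin 2)} (hf : AEStronglyMeasurable f μ) :
    AEStronglyMeasurable (fun x => pot W x (f x)) μ := by
  have hc : ∀ i, AEMeasurable (fun x => f x i) μ := fun i =>
    (EuclideanSpace.proj i : EuclideanSpace ℂ (Fin 2) →L[ℂ] ℂ).measurable.comp_aemeasurable
      hf.aemeasurable
  have h2 : AEMeasurable (fun x => fun i => pot W x (f x) i) μ := by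
    refine aemeasurable_pi_iff.2 fun i => ?_
    simp only [pot_apply_coord]
    have hm : ∀ j, Measurable fun x => (W x i j : ℂ) := fun j =>
      Complex.measurable_ofReal.comp (hW i j)
    exact ((hm 0).aemeasurable.mul (hc 0)).add ((hm 1).aemeasurable.mul (hc 1))
  exact ((MeasurableEquiv.toLp 2 (Fin 2 → ℂ)).measurable.comp_aemeasurable
    h2).aestronglyMeasurable

end RandomDirac
end

noncomputable section
set_option linter.unusedSectionVars false
namespace RandomDirac
open scoped ENNReal NNReal ComplexConjugate

/-- Abbreviation for `ℂ²`. -/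
abbrev C2 : Type := EuclideanSpace ℂ (Fin 2)

/-! ### Self-adjointness from the graph -/

section Graph

variable {H : Type*} [NormedAddCommGroup H] [InnerProductSpace ℂ H] [CompleteSpace H]

/-- Density of the domain is automatic: if `v` is orthogonal to the domain, then (0, v) satisfies
the symmetry relation against the whole graph, so it lies in the graph by maximality, and v = 0. -/
lemma isSelfAdjoint_toLinearPMap {G : Submodule ℂ (H × H)}
    (hsingle : ∀ p ∈ G, p.1 = 0 → p.2 = 0)
    (hsymm : ∀ p ∈ G, ∀ q ∈ G, inner ℂ p.2 q.1 = inner ℂ p.1 q.2)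
    (hmax : ∀ q : H × H, (∀ p ∈ G, inner ℂ p.2 q.1 = inner ℂ p.1 q.2) → q ∈ G) :
    IsSelfAdjoint G.toLinearPMap ∧ G.toLinearPMap.graph = G := by
  have hgr : G.toLinearPMap.graph = G := Submodule.toLinearPMap_graph_eq G hsingle
  refine ⟨?_, hgr⟩
  have hdense : Dense (G.toLinearPMap.domain : Set H) := by
    rw [Submodule.dense_iff_topologicalClosure_eq_top, Submodule.topologicalClosure_eq_top_iff,
      Submodule.eq_bot_iff]
    intro v hv
    rw [Submodule.mem_orthogonal] at hv
    refine hsingle (0, v) (hmax _ fun p hp => ?_) rfl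
    rw [← hgr] at hp
    simp only [inner_zero_right]
    exact (hv p.1 (LinearPMap.mem_domain_of_mem_graph hp)).symm
  rw [LinearPMap.isSelfAdjoint_def]
  refine LinearPMap.eq_of_eq_graph ?_
  rw [LinearPMap.adjoint_graph_eq_graph_adjoint hdense, hgr]
  ext q
  rw [Submodule.mem_adjoint_iff]
  constructor
  · intro h
    exact hmax q fun p hp => sub_eq_zero.1 (h p.1 p.2 hp)
  · intro hq a b hab
    exact sub_eq_zero.2 (hsymm _ hab _ hq)

end Graph

/-! ### Representatives of elements of the graph -/

/-- `μ` is the Lebesgue measure on the interval `s`, which is exhausted by compact intervals. -/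
structure IsIntervalMeasure (μ : Measure ℝ) (s : Set ℝ) : Prop where
  eq : μ = volume.restrict s
  ord : s.OrdConnected
  dense : s ⊆ closure (interior s)
  exhaust : ∃ c d : ℕ → ℝ, (∀ n, c n ∈ s ∧ d n ∈ s ∧ c n < d n) ∧
    (∀ n, Icc (c 0) (d 0) ⊆ Icc (c n) (d n)) ∧ s ⊆ ⋃ n, Icc (c n) (d n)

lemma isIntervalMeasure_univ : IsIntervalMeasure volume univ where
  eq := Measure.restrict_univ.symm
  ord := ordConnected_univ
  dense := by simp
  exhaust := by
    refine ⟨fun n => -((n : ℝ) + 1), fun n => (n : ℝ) + 1, fun n => ⟨mem_univ _, mem_univ _, ?_⟩,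
      fun n => Icc_subset_Icc ?_ ?_, fun x _ => ?_⟩
    · have : (0 : ℝ) ≤ n := n.cast_nonneg
      linarith
    · simp
    · simp
    · obtain ⟨n, hn⟩ := exists_nat_ge |x|
      exact mem_iUnion.2 ⟨n, abs_le.1 (hn.trans (by linarith))⟩

lemma isIntervalMeasure_Icc {a b : ℝ} (hab : a < b) :
    IsIntervalMeasure (volume.restrict (Ioo a b)) (Icc a b) where
  eq := Measure.restrict_congr_set Ioo_ae_eq_Icc
  ord := ordConnected_Icc
  dense := by rw [closure_interior_Icc hab.ne]
  exhaust := ⟨fun _ => a, fun _ => b,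
    fun _ => ⟨left_mem_Icc.2 hab.le, right_mem_Icc.2 hab.le, hab⟩, fun _ => subset_rfl,
    fun _ hx => mem_iUnion.2 ⟨0, hx⟩⟩

section Rep

variable {μ : Measure ℝ} [IsLocallyFiniteMeasure μ] {s bdry : Set ℝ}
  {W : ℝ → Matrix (Fin 2) (Fin 2) ℝ} {B : ℝ}

namespace IsIntervalMeasure

lemma measurableSet (hs : IsIntervalMeasure μ s) : MeasurableSet s := hs.ord.measurableSet

lemma restrict (hs : IsIntervalMeasure μ s) {t : Set ℝ} (ht : MeasurableSet t) (hts : t ⊆ s) :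
    μ.restrict t = volume.restrict t := by
  rw [hs.eq, Measure.restrict_restrict ht, inter_eq_left.2 hts]

lemma intervalIntegral_eq {E : Type*} [NormedAddCommGroup E] [NormedSpace ℝ E]
    (hs : IsIntervalMeasure μ s) {c d : ℝ} (hc : c ∈ s) (hd : d ∈ s) (g : ℝ → E) :
    ∫ x in c..d, g x ∂μ = ∫ x in c..d, g x := by
  rw [intervalIntegral.intervalIntegral_eq_integral_uIoc,
    intervalIntegral.intervalIntegral_eq_integral_uIoc,
    hs.restrict measurableSet_uIoc (uIoc_subset_uIcc.trans (hs.ord.uIcc_subset hc hd))]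

lemma intervalIntegrable_iff {E : Type*} [NormedAddCommGroup E]
    (hs : IsIntervalMeasure μ s) {c d : ℝ} (hc : c ∈ s) (hd : d ∈ s) {g : ℝ → E} :
    IntervalIntegrable g μ c d ↔ IntervalIntegrable g volume c d := by
  rw [_root_.intervalIntegrable_iff, _root_.intervalIntegrable_iff, IntegrableOn, IntegrableOn,
    hs.restrict measurableSet_uIoc (uIoc_subset_uIcc.trans (hs.ord.uIcc_subset hc hd))]

lemma ae_of_forall_Icc (hs : IsIntervalMeasure μ s) {P : ℝ → Prop}
    (h : ∀ c ∈ s, ∀ d ∈ s, c < d → ∀ᵐ x ∂(volume.restrict (Icc c d)), P x) : ∀ᵐ x ∂μ, P x := by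
  obtain ⟨c, d, hcd, -, hsub⟩ := hs.exhaust
  rw [hs.eq]
  refine ae_restrict_of_ae_restrict_of_subset hsub ?_
  rw [ae_restrict_iUnion_iff]
  exact fun n => h _ (hcd n).1 _ (hcd n).2.1 (hcd n).2.2

end IsIntervalMeasure

/-- `f` is the absolutely continuous representative of the first component of the element `p` of
the graph of a Dirac operator and `g` is the derivative of `f`. -/
structure IsRep (μ : Measure ℝ) (s bdry : Set ℝ) (W : ℝ → Matrix (Fin 2) (Fin 2) ℝ)
    (p : Spinor μ × Spinor μ) (f g : ℝ → C2) : Prop where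
  fst : p.1 =ᵐ[μ] f
  memLp : MemLp g 2 μ
  prim : ∀ c ∈ s, ∀ d ∈ s, c ≤ d → IsPrimitive f g c d
  bdry : ∀ x ∈ bdry, f x 0 = 0
  snd : p.2 =ᵐ[μ] fun x => actJ (g x) + pot W x (f x)

lemma exists_isRep (hs : IsIntervalMeasure μ s) {p : Spinor μ × Spinor μ}
    (hp : p ∈ diracGraph μ s bdry W) : ∃ f g, IsRep μ s bdry W p f g := by
  obtain ⟨f, g, h1, h2, h3, h4⟩ := hp
  refine ⟨f, g, h1, Lp.memLp g, fun c hc d hd hcd => ⟨hcd, ?_, fun x hx => ?_⟩, h3, h4⟩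
  · exact (hs.intervalIntegrable_iff hc hd).1 (intervalIntegrable_spinor g c d)
  · have hx' : x ∈ s := hs.ord.out hc hd hx
    rw [← hs.intervalIntegral_eq hc hx', ← h2 c hc x hx']
    abel

lemma IsRep.mem (hs : IsIntervalMeasure μ s) {p : Spinor μ × Spinor μ} {f g : ℝ → C2}
    (h : IsRep μ s bdry W p f g) : p ∈ diracGraph μ s bdry W := by
  have hg : h.memLp.toLp g =ᵐ[μ] g := h.memLp.coeFn_toLp
  refine ⟨f, h.memLp.toLp g, h.fst, fun c hc d hd => ?_, h.bdry, ?_⟩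
  · have h1 : ∫ x in c..d, (h.memLp.toLp g) x ∂μ = ∫ x in c..d, g x ∂μ :=
      intervalIntegral.integral_congr_ae (hg.mono fun x hx _ => hx)
    rw [h1, hs.intervalIntegral_eq hc hd]
    rcases le_total c d with hcd | hcd
    · exact (h.prim c hc d hd hcd).sub_eq (left_mem_Icc.2 hcd) (right_mem_Icc.2 hcd)
    · exact (h.prim d hd c hc hcd).sub_eq (right_mem_Icc.2 hcd) (left_mem_Icc.2 hcd)
  · filter_upwards [h.snd, hg] with x hx hgx
    rw [hx, hgx]
    rfl

lemma mem_of_memLp (hs : IsIntervalMeasure μ s) {f g : ℝ → C2} (hf : MemLp f 2 μ)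
    (hg : MemLp g 2 μ) (hprim : ∀ c ∈ s, ∀ d ∈ s, c ≤ d → IsPrimitive f g c d)
    (hb : ∀ x ∈ bdry, f x 0 = 0) (hW : MemLp (fun x => actJ (g x) + pot W x (f x)) 2 μ) :
    (hf.toLp f, hW.toLp _) ∈ diracGraph μ s bdry W :=
  IsRep.mem hs ⟨hf.coeFn_toLp, hg, hprim, hb, hW.coeFn_toLp⟩

lemma IsRep.continuousOn (hs : IsIntervalMeasure μ s) {p : Spinor μ × Spinor μ} {f g : ℝ → C2}
    (h : IsRep μ s bdry W p f g) : ContinuousOn f s := by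
  obtain ⟨c, d, hcd, -, hsub⟩ := hs.exhaust
  intro x hx
  have hnb : ∃ c ∈ s, ∃ d ∈ s, c ≤ d ∧ x ∈ Icc c d ∧ Icc c d ∈ 𝓝[s] x := by
    by_cases hl : ∃ c ∈ s, c < x
    · by_cases hr : ∃ d ∈ s, x < d
      · obtain ⟨c, hc, hcx⟩ := hl
        obtain ⟨d, hd, hdx⟩ := hr
        exact ⟨c, hc, d, hd, (hcx.trans hdx).le, ⟨hcx.le, hdx.le⟩,
          mem_nhdsWithin_of_mem_nhds (Icc_mem_nhds hcx hdx)⟩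
      · obtain ⟨c, hc, hcx⟩ := hl
        push Not at hr
        refine ⟨c, hc, x, hx, hcx.le, ⟨hcx.le, le_rfl⟩, ?_⟩
        filter_upwards [self_mem_nhdsWithin, mem_nhdsWithin_of_mem_nhds (Ioi_mem_nhds hcx)]
          with y hy hcy
        exact ⟨hcy.le, hr y hy⟩
    · push Not at hl
      by_cases hr : ∃ d ∈ s, x < d
      · obtain ⟨d, hd, hdx⟩ := hr
        refine ⟨x, hx, d, hd, hdx.le, ⟨le_rfl, hdx.le⟩, ?_⟩
        filter_upwards [self_mem_nhdsWithin, mem_nhdsWithin_of_mem_nhds (Iio_mem_nhds hdx)]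
          with y hy hcy
        exact ⟨hl y hy, hcy.le⟩
      · push Not at hr
        refine ⟨x, hx, x, hx, le_rfl, ⟨le_rfl, le_rfl⟩, ?_⟩
        filter_upwards [self_mem_nhdsWithin] with y hy
        exact ⟨hl y hy, hr y hy⟩
  obtain ⟨c, hc, d, hd, hcd, hxm, hnhds⟩ := hnb
  exact ((h.prim c hc d hd hcd).continuousOn x hxm).mono_of_mem_nhdsWithin hnhds

lemma IsRep.eqOn (hs : IsIntervalMeasure μ s) {p q : Spinor μ × Spinor μ} {f g f' g' : ℝ → C2}
    {W' : ℝ → Matrix (Fin 2) (Fin 2) ℝ} {bdry' : Set ℝ}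
    (h : IsRep μ s bdry W p f g) (h' : IsRep μ s bdry' W' q f' g') (hpq : p.1 = q.1) :
    EqOn f f' s := by
  have h1 : f =ᵐ[volume.restrict s] f' := by
    rw [← hs.eq]
    filter_upwards [h.fst, h'.fst] with x hx hx'
    rw [← hx, ← hx', hpq]
  exact Measure.eqOn_of_ae_eq h1 (h.continuousOn hs) (h'.continuousOn hs) hs.dense

lemma IsRep.deriv_eq {p : Spinor μ × Spinor μ} {f g : ℝ → C2} (h : IsRep μ s bdry W p f g) :
    ∀ᵐ x ∂μ, g x = -actJ (p.2 x - pot W x (f x)) := by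
  filter_upwards [h.snd] with x hx
  rw [hx, add_sub_cancel_right, actJ_apply, actJ_apply, act_J_act_J, neg_neg]

/-- The continuous representative of 0 vanishes everywhere on `s`, so its derivative vanishes almost
everywhere. This makes the graph the graph of an operator. -/
lemma snd_eq_zero_of_fst_eq_zero (hs : IsIntervalMeasure μ s) {p : Spinor μ × Spinor μ}
    (hp : p ∈ diracGraph μ s bdry W) (h0 : p.1 = 0) : p.2 = 0 := by
  obtain ⟨f, g, h⟩ := exists_isRep hs hp
  have h00 : IsRep μ s bdry W (0 : Spinor μ × Spinor μ) 0 0 := by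
    refine ⟨Lp.coeFn_zero _ _ _, MemLp.zero, fun c _ d _ hcd => ⟨hcd, ?_, fun x _ => ?_⟩, by simp,
      ?_⟩
    · exact IntervalIntegrable.zero
    · simp
    · filter_upwards [Lp.coeFn_zero C2 2 μ] with x hx
      rw [Prod.snd_zero, hx]; simp
  have hf : EqOn f 0 s := h.eqOn hs h00 h0
  have hg : ∀ᵐ x ∂μ, g x = 0 := by
    refine hs.ae_of_forall_Icc fun c hc d hd hcd => ?_
    have hp := h.prim c hc d hd hcd.le
    have h1 := hp.ae_hasDerivAt
    rw [Measure.restrict_congr_set Ioo_ae_eq_Icc.symm]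
    refine (ae_restrict_iff' measurableSet_Ioo).2 ?_
    filter_upwards [h1] with x hx hxm
    have h2 := hx (by rw [uIcc_of_le hcd.le]; exact Ioo_subset_Icc_self hxm)
    have h3 : HasDerivAt f 0 x := by
      refine (hasDerivAt_const x (0 : C2)).congr_of_eventuallyEq ?_
      filter_upwards [Ioo_mem_nhds hxm.1 hxm.2] with y hy
      exact hf (hs.ord.out hc hd (Ioo_subset_Icc_self hy))
    exact h2.unique h3
  refine Lp.ext ?_
  have hsm : ∀ᵐ x ∂μ, x ∈ s := by
    rw [hs.eq]; exact ae_restrict_mem hs.measurableSet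
  filter_upwards [h.snd, hg, hsm, Lp.coeFn_zero C2 2 μ] with x hx hgx hxs h0
  rw [hx, hgx, hf hxs, h0]
  simp

/-! ### Green's identity -/

/-- `W` is symmetric and drops out; `J` is antisymmetric, so what is left is the derivative of ⟨Jf,
h⟩. -/
lemma IsRep.green (hs : IsIntervalMeasure μ s) (hsymm : ∀ x, (W x).IsSymm)
    {p q : Spinor μ × Spinor μ} {bdry' : Set ℝ}
    {f g h k : ℝ → C2} (hf : IsRep μ s bdry W p f g) (hh : IsRep μ s bdry' W q h k) {c d : ℝ}
    (hc : c ∈ s) (hd : d ∈ s) (hcd : c ≤ d) :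
    IsPrimitive (fun x => inner ℂ (actJ (f x)) (h x))
      (fun x => inner ℂ (p.2 x) (q.1 x) - inner ℂ (p.1 x) (q.2 x)) c d := by
  have h1 := (((hf.prim c hc d hd hcd).clm (actJ.restrictScalars ℝ))).inner (hh.prim c hc d hd hcd)
  refine h1.congr_ae ?_
  have hsub : Icc c d ⊆ s := hs.ord.out hc hd
  rw [← hs.restrict measurableSet_Icc hsub]
  refine ae_restrict_of_ae ?_
  filter_upwards [hf.fst, hf.snd, hh.fst, hh.snd] with x e1 e2 e3 e4
  rw [e1, e2, e3, e4]
  simp only [ContinuousLinearMap.coe_restrictScalars', inner_add_left, inner_add_right,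
    inner_pot hsymm]
  rw [actJ_apply (f x), inner_act_J, actJ_apply (k x)]
  ring

lemma integrable_green (p q : Spinor μ × Spinor μ) :
    Integrable (fun x => inner ℂ (p.2 x) (q.1 x) - inner ℂ (p.1 x) (q.2 x)) μ :=
  (L2.integrable_inner p.2 q.1).sub (L2.integrable_inner p.1 q.2)

lemma integral_green (p q : Spinor μ × Spinor μ) :
    ∫ x, (inner ℂ (p.2 x) (q.1 x) - inner ℂ (p.1 x) (q.2 x)) ∂μ =
      inner ℂ p.2 q.1 - inner ℂ p.1 q.2 := by
  rw [integral_sub (L2.integrable_inner p.2 q.1) (L2.integrable_inner p.1 q.2), L2.inner_def,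
    L2.inner_def]

lemma green_Icc {a b : ℝ} (hab : a < b) (hsymm : ∀ x, (W x).IsSymm) {bdry' : Set ℝ}
    {p q : Spinor (volume.restrict (Ioo a b)) × Spinor (volume.restrict (Ioo a b))}
    {f g h k : ℝ → C2} (hf : IsRep (volume.restrict (Ioo a b)) (Icc a b) bdry W p f g)
    (hh : IsRep (volume.restrict (Ioo a b)) (Icc a b) bdry' W q h k) :
    inner ℂ p.2 q.1 - inner ℂ p.1 q.2 =
      inner ℂ (actJ (f b)) (h b) - inner ℂ (actJ (f a)) (h a) := by
  have h1 := hf.green (isIntervalMeasure_Icc hab) hsymm hh (left_mem_Icc.2 hab.le)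
    (right_mem_Icc.2 hab.le) hab.le
  rw [h1.sub_eq (left_mem_Icc.2 hab.le) (right_mem_Icc.2 hab.le), ← integral_green,
    intervalIntegral.integral_of_le hab.le]
  exact integral_Ioc_eq_integral_Ioo.symm

lemma inner_actJ_eq_zero {v w : C2} (hv : v 0 = 0) (hw : w 0 = 0) : inner ℂ (actJ v) w = 0 := by
  simp [PiLp.inner_apply, Fin.sum_univ_two, actJ_apply, act_J_apply_zero, act_J_apply_one, hv, hw]

lemma symm_Icc {a b : ℝ} (hab : a < b) (hsymm : ∀ x, (W x).IsSymm)
    {p q : Spinor (volume.restrict (Ioo a b)) × Spinor (volume.restrict (Ioo a b))}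
    (hp : p ∈ diracGraph (volume.restrict (Ioo a b)) (Icc a b) {a, b} W)
    (hq : q ∈ diracGraph (volume.restrict (Ioo a b)) (Icc a b) {a, b} W) :
    inner ℂ p.2 q.1 = inner ℂ p.1 q.2 := by
  obtain ⟨f, g, hf⟩ := exists_isRep (isIntervalMeasure_Icc hab) hp
  obtain ⟨h, k, hh⟩ := exists_isRep (isIntervalMeasure_Icc hab) hq
  rw [← sub_eq_zero, green_Icc hab hsymm hf hh,
    inner_actJ_eq_zero (hf.bdry b (by simp)) (hh.bdry b (by simp)),
    inner_actJ_eq_zero (hf.bdry a (by simp)) (hh.bdry a (by simp)), sub_zero]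

/-- The boundary form w = ⟨Jf, h⟩ has an integrable derivative, hence limits at ±∞. As w itself is
integrable, these limits are 0 and Green's identity has no boundary term. -/
lemma symm_univ (hsymm : ∀ x, (W x).IsSymm) {p q : Spinor volume × Spinor volume}
    (hp : p ∈ diracGraph volume univ ∅ W) (hq : q ∈ diracGraph volume univ ∅ W) :
    inner ℂ p.2 q.1 = inner ℂ p.1 q.2 := by
  obtain ⟨f, g, hf⟩ := exists_isRep isIntervalMeasure_univ hp
  obtain ⟨h, k, hh⟩ := exists_isRep isIntervalMeasure_univ hq
  let w : ℝ → ℂ := fun x => inner ℂ (actJ (f x)) (h x)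
  let v : ℝ → ℂ := fun x => inner ℂ (p.2 x) (q.1 x) - inner ℂ (p.1 x) (q.2 x)
  have hv : Integrable v := integrable_green p q
  have hprim : ∀ c d, c ≤ d → IsPrimitive w v c d := fun c d hcd =>
    hf.green isIntervalMeasure_univ hsymm hh (mem_univ c) (mem_univ d) hcd
  have hw : Integrable w := by
    refine (L2.integrable_inner (𝕜 := ℂ) (actJ.compLp p.1) q.1).congr ?_
    filter_upwards [actJ.coeFn_compLp p.1, hf.fst, hh.fst] with x h1 h2 h3
    rw [h1, h2, h3]
  have hsub : ∀ x y, w y - w x = ∫ t in x..y, v t := by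
    intro x y
    rcases le_total x y with hxy | hxy
    · exact (hprim x y hxy).sub_eq (left_mem_Icc.2 hxy) (right_mem_Icc.2 hxy)
    · exact (hprim y x hxy).sub_eq (right_mem_Icc.2 hxy) (left_mem_Icc.2 hxy)
  have hlim1 : Tendsto w atTop (𝓝 0) := by
    have h1 : Tendsto w atTop (𝓝 (w 0 + ∫ t in Ioi 0, v t)) := by
      refine ((intervalIntegral_tendsto_integral_Ioi 0 hv.integrableOn tendsto_id).const_add
        (w 0)).congr fun y => ?_
      rw [id, ← hsub]; abel
    have h2 := IntegrableAtFilter.eq_zero_of_tendsto (μ := volume) (l := atTop)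
      ⟨univ, univ_mem, hw.integrableOn⟩ (fun s hs => by
        obtain ⟨a, ha⟩ := mem_atTop_sets.1 hs
        exact top_unique ((Real.volume_Ici (a := a)).ge.trans (measure_mono (show Ici a ⊆ s from ha)))) h1
    rwa [h2] at h1
  have hlim2 : Tendsto w atBot (𝓝 0) := by
    have h1 : Tendsto w atBot (𝓝 (w 0 - ∫ t in Iic 0, v t)) := by
      refine ((intervalIntegral_tendsto_integral_Iic 0 hv.integrableOn tendsto_id).const_sub
        (w 0)).congr fun y => ?_
      rw [id, ← hsub]; abel
    have h2 := IntegrableAtFilter.eq_zero_of_tendsto (μ := volume) (l := atBot)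
      ⟨univ, univ_mem, hw.integrableOn⟩ (fun s hs => by
        obtain ⟨a, ha⟩ := mem_atBot_sets.1 hs
        exact top_unique ((Real.volume_Iic (a := a)).ge.trans (measure_mono (show Iic a ⊆ s from ha)))) h1
    rwa [h2] at h1
  have h3 := intervalIntegral_tendsto_integral hv tendsto_neg_atTop_atBot tendsto_id
  have h4 := (hlim1.comp tendsto_id).sub (hlim2.comp tendsto_neg_atTop_atBot)
  have h5 := tendsto_nhds_unique h3 (h4.congr fun x => by
    simp only [Function.comp, hsub])
  rw [← sub_eq_zero, ← integral_green]
  simpa using h5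

end Rep
end RandomDirac
end

/-! ### Self-adjointness of the Dirac operators on the line and on boxes. -/

noncomputable section
set_option linter.unusedSectionVars false
namespace RandomDirac
open scoped ENNReal NNReal ComplexConjugate

lemma integrable_inner_of_memLp {μ : Measure ℝ} {u v : ℝ → C2} (hu : MemLp u 2 μ)
    (hv : MemLp v 2 μ) : Integrable (fun x => inner ℂ (u x) (v x)) μ := by
  refine (L2.integrable_inner (𝕜 := ℂ) (hu.toLp _) (hv.toLp _)).congr ?_
  filter_upwards [hu.coeFn_toLp, hv.coeFn_toLp] with x h1 h2
  rw [h1, h2]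

lemma memLp_Icc_of_continuousOn {c d : ℝ} {f : ℝ → C2} (hf : ContinuousOn f (Icc c d)) :
    MemLp f 2 (volume.restrict (Icc c d)) := by
  obtain ⟨C, hC⟩ := isCompact_Icc.exists_bound_of_continuousOn hf
  exact MemLp.of_bound (hf.aestronglyMeasurable measurableSet_Icc) C
    ((ae_restrict_mem measurableSet_Icc).mono hC)

/-- The lemma of du Bois-Reymond. -/
lemma ae_const_of_integral_inner_eq_zero {c d : ℝ} (hcd : c < d) {h : ℝ → C2}
    (hh : MemLp h 2 (volume.restrict (Icc c d)))
    (hort : ∀ g : ℝ → C2, MemLp g 2 (volume.restrict (Icc c d)) → ∫ x in Icc c d, g x = 0 →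
      ∫ x in Icc c d, inner ℂ (g x) (h x) = 0) :
    ∃ C : C2, ∀ᵐ x ∂(volume.restrict (Icc c d)), h x = C := by
  have hint : Integrable h (volume.restrict (Icc c d)) := hh.integrable (by norm_num)
  set C : C2 := (d - c)⁻¹ • ∫ x in Icc c d, h x with hC
  have hmem : MemLp (fun x => h x - C) 2 (volume.restrict (Icc c d)) := hh.sub (memLp_const C)
  have hint' : Integrable (fun x => h x - C) (volume.restrict (Icc c d)) :=
    hmem.integrable (by norm_num)
  have hvol : (volume.restrict (Icc c d)).real univ = d - c := by
    simp [Measure.real, hcd.le]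
  have hzero : ∫ x in Icc c d, (h x - C) = 0 := by
    rw [integral_sub hint (integrable_const C), integral_const, hvol, hC, smul_smul,
      mul_inv_cancel₀ (sub_pos.2 hcd).ne', one_smul, sub_self]
  -- The test function is `h` minus its mean `C`, so that ∫‖h - C‖² = ⟨h - C, h⟩ - ⟨h - C, C⟩ = 0.
  have h1 := hort _ hmem hzero
  have hI' := integrable_inner_of_memLp hmem hh
  have h2 : ∫ x in Icc c d, inner ℂ (h x - C) C = 0 := by
    have : ∀ x, inner ℂ (h x - C) C = conj (inner ℂ C (h x - C)) := fun x =>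
      (inner_conj_symm _ _).symm
    simp_rw [this]
    rw [integral_conj, integral_inner hint' C, hzero]
    simp
  have hI2 := integrable_inner_of_memLp hmem (memLp_const C)
  have h3 : ∫ x in Icc c d, ‖h x - C‖ ^ 2 = 0 := by
    have h4 : ∫ x in Icc c d, ((‖h x - C‖ ^ 2 : ℝ) : ℂ) = 0 := by
      rw [← sub_self (0 : ℂ)]
      nth_rewrite 1 [← h1]
      rw [← h2, ← integral_sub hI' hI2]
      refine integral_congr_ae (ae_of_all _ fun x => ?_)
      simp only
      rw [← inner_sub_right, inner_self_eq_norm_sq_to_K]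
      simp
    rw [integral_complex_ofReal] at h4
    exact_mod_cast h4
  refine ⟨C, ?_⟩
  have h5 := (integral_eq_zero_iff_of_nonneg (fun x => by positivity)
    (hmem.integrable_norm_pow two_ne_zero)).1 h3
  filter_upwards [h5] with x hx
  have hx' : ‖h x - C‖ ^ 2 = 0 := hx
  exact sub_eq_zero.1 (norm_eq_zero.1 (pow_eq_zero_iff two_ne_zero |>.1 hx'))

section SelfAdjoint

variable {μ : Measure ℝ} [IsLocallyFiniteMeasure μ] {s bdry : Set ℝ}
  {W : ℝ → Matrix (Fin 2) (Fin 2) ℝ} {B : ℝ}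

lemma memLp_pot (hW : IsBddPotential W B) {f : ℝ → C2} (hf : MemLp f 2 μ) :
    MemLp (fun x => pot W x (f x)) 2 μ :=
  MemLp.of_le_mul (c := 4 * B) hf (aestronglyMeasurable_pot hW.measurable hf.1)
    (ae_of_all _ fun x => hW.norm_pot_le x (f x))

lemma memLp_actJ {f : ℝ → C2} (hf : MemLp f 2 μ) : MemLp (fun x => actJ (f x)) 2 μ :=
  actJ.comp_memLp' hf

/-- An adjoint pair (ψ, η) solves Jψ' + Wψ = η weakly. With `K` a primitive of η - Wψ, testing
against compactly supported functions and du Bois-Reymond show that K - Jψ is constant; thus ψ is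
absolutely continuous. No boundary condition is obtained, since `hb` makes every test function
vanish on `bdry`. -/
lemma mem_diracGraph_of_inner (hs : IsIntervalMeasure μ s) (hW : IsBddPotential W B)
    (hb : ∀ x ∈ bdry, ∀ c ∈ s, ∀ d ∈ s, x ∉ Ioo c d) {q : Spinor μ × Spinor μ}
    (hq : ∀ p ∈ diracGraph μ s bdry W, inner ℂ p.2 q.1 = inner ℂ p.1 q.2) :
    q ∈ diracGraph μ s ∅ W := by
  obtain ⟨cs, ds, hcds, hmono, hexh⟩ := hs.exhaust
  let ψ : ℝ → C2 := fun x => q.1 x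
  let η : ℝ → C2 := fun x => q.2 x
  have hψm : MemLp ψ 2 μ := Lp.memLp q.1
  have hηm : MemLp η 2 μ := Lp.memLp q.2
  let k : ℝ → C2 := fun x => η x - pot W x (ψ x)
  have hkm : MemLp k 2 μ := hηm.sub (memLp_pot hW hψm)
  have hrestr : ∀ {f : ℝ → C2} {c d : ℝ}, c ∈ s → d ∈ s → MemLp f 2 μ →
      MemLp f 2 (volume.restrict (Icc c d)) := fun hc hd hf => by
    rw [← hs.restrict measurableSet_Icc (hs.ord.out hc hd)]
    exact hf.restrict _
  have hkint : ∀ c ∈ s, ∀ d ∈ s, IntervalIntegrable k volume c d := by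
    intro c hc d hd
    have h1 : IntervalIntegrable (hkm.toLp k) volume c d :=
      (hs.intervalIntegrable_iff hc hd).1 (intervalIntegrable_spinor _ c d)
    refine (intervalIntegrable_iff.1 h1).congr ?_ |> intervalIntegrable_iff.2
    have h2 := ae_restrict_of_ae (s := uIoc c d) hkm.coeFn_toLp
    rwa [hs.restrict measurableSet_uIoc
      (uIoc_subset_uIcc.trans (hs.ord.uIcc_subset hc hd))] at h2
  let x₀ := cs 0
  have hx₀ : x₀ ∈ s := (hcds 0).1
  let K : ℝ → C2 := fun x => ∫ t in x₀..x, k t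
  have hK : ∀ c ∈ s, ∀ d ∈ s, c ≤ d → IsPrimitive K k c d := by
    intro c hc d hd hcd
    refine ⟨hcd, hkint c hc d hd, fun x hx => ?_⟩
    have hx' : x ∈ s := hs.ord.out hc hd hx
    exact (intervalIntegral.integral_add_adjacent_intervals (hkint x₀ hx₀ c hc)
      (hkint c hc x hx')).symm
  have hconst : ∀ c ∈ s, ∀ d ∈ s, c < d → ∃ C : C2,
      ∀ᵐ x ∂(volume.restrict (Icc c d)), K x - actJ (ψ x) = C := by
    intro c hc d hd hcd
    have hsub : Icc c d ⊆ s := hs.ord.out hc hd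
    have hKm : MemLp K 2 (volume.restrict (Icc c d)) :=
      memLp_Icc_of_continuousOn (hK c hc d hd hcd.le).continuousOn
    refine ae_const_of_integral_inner_eq_zero hcd (hKm.sub (hrestr hc hd (memLp_actJ hψm)))
      fun g hg hg0 => ?_
    let γ : ℝ → C2 := (Icc c d).indicator g
    have hγm : MemLp γ 2 volume := (memLp_indicator_iff_restrict measurableSet_Icc).2 hg
    have hγi : Integrable γ :=
      (integrable_indicator_iff measurableSet_Icc).2 (hg.integrable (by norm_num))
    -- As γ has mean zero, its primitive vanishes outside (c, d), in particular on `bdry`, so it is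
    -- an admissible test function.
    let f : ℝ → C2 := fun x => ∫ t in c..x, γ t
    have hf0 : ∀ x, x ∉ Ioo c d → f x = 0 := by
      intro x hx
      by_cases hxc : x ≤ c
      · refine intervalIntegral.integral_zero_ae ?_
        have : ∀ᵐ t : ℝ, t ≠ c := by rw [ae_iff]; simp
        filter_upwards [this] with t ht htm
        rw [uIoc_of_ge hxc] at htm
        refine indicator_of_notMem (fun h => ht (le_antisymm htm.2 h.1)) _
      · push Not at hxc
        have hdx : d ≤ x := by
          by_contra h
          exact hx ⟨hxc, not_le.1 h⟩
        change ∫ t in c..x, γ t = 0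
        rw [intervalIntegral.integral_of_le hxc.le, ← integral_Icc_eq_integral_Ioc,
          setIntegral_indicator measurableSet_Icc,
          inter_eq_right.2 (Icc_subset_Icc_right hdx)]
        exact hg0
    have hfc : Continuous f :=
      intervalIntegral.continuous_primitive (fun a b => hγi.intervalIntegrable) c
    have hfm : MemLp f 2 μ := by
      have h1 : MemLp f 2 volume := by
        refine hfc.memLp_of_hasCompactSupport ?_
        refine HasCompactSupport.intro isCompact_Icc (K := Icc c d) fun x hx => hf0 x fun h => ?_
        exact hx (Ioo_subset_Icc_self h)
      rw [hs.eq]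
      exact h1.restrict _
    have hprim : ∀ a b, a ≤ b → IsPrimitive f γ a b := fun a b hab =>
      ⟨hab, hγi.intervalIntegrable, fun x _ =>
        (intervalIntegral.integral_add_adjacent_intervals hγi.intervalIntegrable
          hγi.intervalIntegrable).symm⟩
    have hγμ : MemLp γ 2 μ := by rw [hs.eq]; exact hγm.restrict _
    have hPm : MemLp (fun x => actJ (γ x) + pot W x (f x)) 2 μ :=
      (memLp_actJ hγμ).add (memLp_pot hW hfm)
    have hp := hq _ (mem_of_memLp hs hfm hγμ (fun a _ b _ hab => hprim a b hab)
      (fun x hx => by rw [hf0 x (hb x hx c hc d hd)]; rfl) hPm)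
    rw [L2.inner_def, L2.inner_def] at hp
    have hI1 : ∫ x, inner ℂ (actJ (γ x) + pot W x (f x)) (ψ x) ∂μ =
        ∫ x, inner ℂ (f x) (η x) ∂μ := by
      have e1 : ∫ x, inner ℂ ((hPm.toLp _) x) (q.1 x) ∂μ =
          ∫ x, inner ℂ (actJ (γ x) + pot W x (f x)) (ψ x) ∂μ :=
        integral_congr_ae (by filter_upwards [hPm.coeFn_toLp] with x hx; rw [hx])
      have e2 : ∫ x, inner ℂ ((hfm.toLp _) x) (q.2 x) ∂μ = ∫ x, inner ℂ (f x) (η x) ∂μ :=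
        integral_congr_ae (by filter_upwards [hfm.coeFn_toLp] with x hx; rw [hx])
      rw [← e1, ← e2]
      exact hp
    have hI2 : ∫ x, (inner ℂ (actJ (γ x)) (ψ x) - inner ℂ (f x) (k x)) ∂μ = 0 := by
      rw [← sub_self (∫ x, inner ℂ (f x) (η x) ∂μ)]
      nth_rewrite 1 [← hI1]
      rw [← integral_sub (integrable_inner_of_memLp hPm hψm) (integrable_inner_of_memLp hfm hηm)]
      refine integral_congr_ae (ae_of_all _ fun x => ?_)
      simp only [k, inner_add_left, inner_sub_right, inner_pot hW.symm]
      ring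
    have hI3 : ∫ x in Icc c d, (inner ℂ (actJ (γ x)) (ψ x) - inner ℂ (f x) (k x)) = 0 := by
      rw [← hs.restrict measurableSet_Icc hsub, setIntegral_eq_integral_of_forall_compl_eq_zero]
      · exact hI2
      · intro x hx
        have h1 : γ x = 0 := indicator_of_notMem hx _
        have h2 : f x = 0 := hf0 x fun h => hx (Ioo_subset_Icc_self h)
        simp [h1, h2]
    have hprod := (hprim c d hcd.le).inner (hK c hc d hd hcd.le)
    have hI4 := hprod.sub_eq (left_mem_Icc.2 hcd.le) (right_mem_Icc.2 hcd.le)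
    rw [hf0 c (fun h => lt_irrefl _ h.1), hf0 d (fun h => lt_irrefl _ h.2), inner_zero_left,
      inner_zero_left, sub_zero, intervalIntegral.integral_of_le hcd.le,
      ← integral_Icc_eq_integral_Ioc] at hI4
    have hi1 : Integrable (fun x => inner ℂ (actJ (γ x)) (ψ x) - inner ℂ (f x) (k x))
        (volume.restrict (Icc c d)) := by
      rw [← hs.restrict measurableSet_Icc hsub]
      exact ((integrable_inner_of_memLp (memLp_actJ hγμ) hψm).sub (integrable_inner_of_memLp hfm hkm)).restrict
    have hi2 : Integrable (fun x => inner ℂ (γ x) (K x) + inner ℂ (f x) (k x))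
        (volume.restrict (Icc c d)) := by
      have := hprod.integrable
      rw [intervalIntegrable_iff_integrableOn_Icc_of_le hcd.le] at this
      exact this
    have hI5 := integral_add hi1 hi2
    rw [hI3, ← hI4, add_zero] at hI5
    rw [← hI5]
    refine setIntegral_congr_fun measurableSet_Icc fun x hx => ?_
    have h1 : γ x = g x := indicator_of_mem hx _
    simp only [h1, inner_sub_right]
    rw [actJ_apply, actJ_apply, inner_act_J]
    ring
  -- All intervals of the exhaustion contain the first one, which forces the constants to agree.
  obtain ⟨C, hC⟩ := hconst (cs 0) (hcds 0).1 (ds 0) (hcds 0).2.1 (hcds 0).2.2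
  have hall : ∀ᵐ x ∂μ, K x - actJ (ψ x) = C := by
    have h1 : ∀ n, ∀ᵐ x ∂(volume.restrict (Icc (cs n) (ds n))), K x - actJ (ψ x) = C := by
      intro n
      obtain ⟨C', hC'⟩ := hconst (cs n) (hcds n).1 (ds n) (hcds n).2.1 (hcds n).2.2
      have h2 := ae_restrict_of_ae_restrict_of_subset (hmono n) hC'
      have h3 : (volume.restrict (Icc (cs 0) (ds 0))) ≠ 0 := by
        rw [Ne, Measure.restrict_eq_zero, Real.volume_Icc, ENNReal.ofReal_eq_zero]
        linarith [(hcds 0).2.2]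
      have : (ae (volume.restrict (Icc (cs 0) (ds 0)))).NeBot := ae_neBot.2 h3
      obtain ⟨x, hx1, hx2⟩ := (hC.and h2).exists
      have hCC : C = C' := by rw [← hx1, hx2]
      rw [hCC]
      exact hC'
    rw [hs.eq]
    exact ae_restrict_of_ae_restrict_of_subset hexh ((ae_restrict_iUnion_iff _ _).2 h1)
  refine IsRep.mem hs (f := fun x => -actJ (K x - C)) (g := fun x => -actJ (k x))
    ⟨?_, (memLp_actJ hkm).neg, fun c hc d hd hcd => ?_, by simp, ?_⟩
  · filter_upwards [hall] with x hx
    rw [← hx, sub_sub_cancel, actJ_apply, actJ_apply, act_J_act_J, neg_neg]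
  · have h1 := (hK c hc d hd hcd).clm ((-actJ).restrictScalars ℝ)
    refine ⟨hcd, h1.integrable, fun x hx => ?_⟩
    have h2 := h1.eq x hx
    simp only [ContinuousLinearMap.coe_restrictScalars', neg_apply] at h2
    rw [map_sub, map_sub, neg_sub, neg_sub, sub_eq_add_neg, h2]
    abel
  · filter_upwards [hall] with x hx
    have h1 : -actJ (K x - C) = ψ x := by
      rw [← hx, sub_sub_cancel, actJ_apply, actJ_apply, act_J_act_J, neg_neg]
    rw [h1, map_neg, actJ_apply, actJ_apply, act_J_act_J, neg_neg]
    simp [k, η]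

lemma diracLine_isSelfAdjoint (hW : IsBddPotential W B) :
    IsSelfAdjoint (diracLine W) ∧ (diracLine W).graph = diracGraph volume univ ∅ W :=
  isSelfAdjoint_toLinearPMap (fun _ hp h0 => snd_eq_zero_of_fst_eq_zero isIntervalMeasure_univ hp h0)
    (fun _ hp _ hq => symm_univ hW.symm hp hq)
    (fun _ hq => mem_diracGraph_of_inner isIntervalMeasure_univ hW (by simp) hq)

/-- The lower component is unrestricted at the end points. Testing with affine multiples of the
lower basis vector that vanish at one end point isolates the upper component of the adjoint vector
at the other. -/
lemma mem_diracGraph_Icc_of_inner {a b : ℝ} (hab : a < b) (hW : IsBddPotential W B)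
    {q : Spinor (volume.restrict (Ioo a b)) × Spinor (volume.restrict (Ioo a b))}
    (hq : ∀ p ∈ diracGraph (volume.restrict (Ioo a b)) (Icc a b) {a, b} W,
      inner ℂ p.2 q.1 = inner ℂ p.1 q.2) :
    q ∈ diracGraph (volume.restrict (Ioo a b)) (Icc a b) {a, b} W := by
  have hs := isIntervalMeasure_Icc hab
  have h1 := mem_diracGraph_of_inner hs hW (by
    rintro x (rfl | rfl) c hc d hd h
    · exact absurd h.1 (not_lt.2 hc.1)
    · exact absurd h.2 (not_lt.2 hd.2)) hq
  obtain ⟨h, k, hh⟩ := exists_isRep hs h1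
  let e : C2 := EuclideanSpace.single 1 1
  have he0 : e 0 = 0 := by simp [e]
  have haff : ∀ α β : ℝ, (∀ x ∈ ({a, b} : Set ℝ), ((α * x + β : ℝ) : ℂ) • e ∈ {v : C2 | v 0 = 0}) ∧
      inner ℂ (actJ (((α * b + β : ℝ) : ℂ) • e)) (h b) =
      inner ℂ (actJ (((α * a + β : ℝ) : ℂ) • e)) (h a) := by
    intro α β
    refine ⟨fun x _ => by simp [he0], ?_⟩
    let f : ℝ → C2 := fun x => ((α * x + β : ℝ) : ℂ) • e
    let g : ℝ → C2 := fun _ => (α : ℂ) • e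
    have hfc : Continuous f := by fun_prop
    have hfm : MemLp f 2 (volume.restrict (Ioo a b)) :=
      (memLp_Icc_of_continuousOn hfc.continuousOn).mono_measure
        (Measure.restrict_mono Ioo_subset_Icc_self le_rfl)
    have hgm : MemLp g 2 (volume.restrict (Ioo a b)) := memLp_const _
    have hPm : MemLp (fun x => actJ (g x) + pot W x (f x)) 2 (volume.restrict (Ioo a b)) :=
      (memLp_actJ hgm).add (memLp_pot hW hfm)
    have hrep : IsRep (volume.restrict (Ioo a b)) (Icc a b) {a, b} W (hfm.toLp f, hPm.toLp _) f g := by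
      refine ⟨hfm.coeFn_toLp, hgm, fun c _ d _ hcd => ⟨hcd, by simp [g], fun x _ => ?_⟩,
        fun x _ => by simp [f, he0], hPm.coeFn_toLp⟩
      simp only [f, g, intervalIntegral.integral_const]
      rw [← Complex.coe_smul, smul_smul, ← add_smul]
      congr 1
      push_cast; ring
    have h2 := green_Icc hab hW.symm hrep hh
    rw [hq _ (hrep.mem hs), sub_self] at h2
    exact (sub_eq_zero.1 h2.symm)
  have hin : ∀ v : C2, inner ℂ (actJ e) v = -v 0 := by
    intro v
    simp [PiLp.inner_apply, Fin.sum_univ_two, actJ_apply, act_J_apply_zero, act_J_apply_one, e]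
  have hb0 : h b 0 = 0 := by
    have h3 := (haff 1 (-a)).2
    simp only [map_smul, inner_smul_left, hin, Complex.conj_ofReal] at h3
    have h4 : ((b - a : ℝ) : ℂ) ≠ 0 := Complex.ofReal_ne_zero.2 (sub_pos.2 hab).ne'
    have h5 : ((b - a : ℝ) : ℂ) * h b 0 = 0 := by
      push_cast at h3 ⊢
      linear_combination -h3
    exact (mul_eq_zero.1 h5).resolve_left h4
  have ha0 : h a 0 = 0 := by
    have h3 := (haff 1 (-b)).2
    simp only [map_smul, inner_smul_left, hin, Complex.conj_ofReal] at h3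
    have h4 : ((b - a : ℝ) : ℂ) ≠ 0 := Complex.ofReal_ne_zero.2 (sub_pos.2 hab).ne'
    have h5 : ((b - a : ℝ) : ℂ) * h a 0 = 0 := by
      push_cast at h3 ⊢
      linear_combination -h3
    exact (mul_eq_zero.1 h5).resolve_left h4
  refine IsRep.mem hs ⟨hh.fst, hh.memLp, hh.prim, ?_, hh.snd⟩
  rintro x (rfl | rfl)
  · exact ha0
  · exact hb0

lemma diracBox_isSelfAdjoint (hW : IsBddPotential W B) {L : ℝ} (hL : 0 < L) :
    IsSelfAdjoint (diracBox L W) ∧ (diracBox L W).graph =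
      diracGraph (boxMeasure L) (Icc (-(L / 2)) (L / 2)) {-(L / 2), L / 2} W := by
  have hab : -(L / 2) < L / 2 := by linarith
  exact isSelfAdjoint_toLinearPMap
    (fun _ hp h0 => snd_eq_zero_of_fst_eq_zero (isIntervalMeasure_Icc hab) hp h0)
    (fun _ hp _ hq => symm_Icc hab hW.symm hp hq)
    (fun _ hq => mem_diracGraph_Icc_of_inner hab hW hq)

end SelfAdjoint
end RandomDirac
end

noncomputable section
set_option linter.unusedSectionVars false
namespace RandomDirac
open scoped ENNReal NNReal ComplexConjugate

/-! ### Pointwise bounds on the resolvent, uniform in the energy. -/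

section Bounds

variable {μ : Measure ℝ} {s bdry : Set ℝ}
  {W : ℝ → Matrix (Fin 2) (Fin 2) ℝ} {B : ℝ}

lemma integrable_norm_sq (v : Spinor μ) : Integrable (fun x => ‖v x‖ ^ 2) μ :=
  (Lp.memLp v).integrable_norm_pow two_ne_zero

lemma norm_sq_eq_integral (v : Spinor μ) : ‖v‖ ^ 2 = ∫ x, ‖v x‖ ^ 2 ∂μ := by
  have h1 : ((‖v‖ ^ 2 : ℝ) : ℂ) = ((∫ x, ‖v x‖ ^ 2 ∂μ : ℝ) : ℂ) := by
    rw [← integral_complex_ofReal]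
    have h2 := L2.inner_def (𝕜 := ℂ) v v
    rw [inner_self_eq_norm_sq_to_K] at h2
    push_cast
    rw [show ((‖v‖ : ℂ)) ^ 2 = _ from h2]
    refine integral_congr_ae (ae_of_all _ fun x => ?_)
    simp only
    rw [inner_self_eq_norm_sq_to_K]
    rfl
  exact Complex.ofReal_injective h1

lemma enorm_sq_eq_lintegral (v : Spinor μ) : ‖v‖ₑ ^ 2 = ∫⁻ x, ‖v x‖ₑ ^ 2 ∂μ := by
  have h1 : ∀ a : C2, ‖a‖ₑ ^ 2 = ENNReal.ofReal (‖a‖ ^ 2) := fun a => by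
    rw [ENNReal.ofReal_pow (norm_nonneg _), ofReal_norm]
  simp_rw [h1]
  rw [← ofReal_integral_eq_lintegral_ofReal (integrable_norm_sq v)
    (ae_of_all _ fun x => by positivity), ← norm_sq_eq_integral,
    ENNReal.ofReal_pow (norm_nonneg _), ofReal_norm]

lemma re_inner_actJ_self (v : C2) : (inner ℂ v (actJ v)).re = 0 := by
  have h1 := inner_act_J v v
  have h2 : (inner ℂ (act J v) v).re = (inner ℂ v (act J v)).re := by
    rw [← inner_conj_symm, Complex.conj_re]
  rw [h1, Complex.neg_re] at h2
  rw [actJ_apply]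
  linarith

variable [IsLocallyFiniteMeasure μ]

/-- A Sobolev bound: ‖f‖² is compared with its mean over [c, d], the increment being controlled by
its derivative 2Re⟨f, f'⟩. The energy enters f' only through E·Jf, and Re⟨f, Jf⟩ = 0, so the
constant does not depend on `E`. -/
lemma IsRep.norm_sq_le (hs : IsIntervalMeasure μ s) (hW : IsBddPotential W B)
    {p : Spinor μ × Spinor μ} {f g : ℝ → C2} (h : IsRep μ s bdry W p f g) {c d : ℝ}
    (hc : c ∈ s) (hd : d ∈ s) (hcd : c < d) (E : ℝ) {x : ℝ} (hx : x ∈ Icc c d) :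
    ‖f x‖ ^ 2 ≤ ((d - c)⁻¹ + 1 + 8 * B) * ‖p.1‖ ^ 2 + ‖p.2 - (E : ℂ) • p.1‖ ^ 2 := by
  have hB0 : 0 ≤ B := (abs_nonneg _).trans (hW.bound 0 0 0)
  have hsub : Icc c d ⊆ s := hs.ord.out hc hd
  have hrestr := hs.restrict measurableSet_Icc hsub
  have hf := h.prim c hc d hd hcd.le
  let n' : ℝ → ℝ := fun x => (inner ℂ (g x) (f x) + inner ℂ (f x) (g x) : ℂ).re
  have hn : IsPrimitive (fun x => ‖f x‖ ^ 2) n' c d := by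
    have h1 := (hf.inner hf).clm Complex.reCLM
    have h2 : (fun x => ‖f x‖ ^ 2) = fun x => Complex.reCLM (inner ℂ (f x) (f x)) := by
      ext x
      rw [inner_self_eq_norm_sq_to_K]
      simp [← Complex.ofReal_pow]
    rw [h2]
    exact h1
  let q : Spinor μ := p.2 - (E : ℂ) • p.1
  let m : ℝ → ℝ := fun x => (1 + 8 * B) * ‖p.1 x‖ ^ 2 + ‖q x‖ ^ 2
  have hm : Integrable m μ := ((integrable_norm_sq p.1).const_mul _).add (integrable_norm_sq q)
  have hmI : ∫ x, m x ∂μ = (1 + 8 * B) * ‖p.1‖ ^ 2 + ‖q‖ ^ 2 := by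
    rw [integral_add ((integrable_norm_sq p.1).const_mul _) (integrable_norm_sq q),
      integral_const_mul, ← norm_sq_eq_integral, ← norm_sq_eq_integral]
  have hbound : ∀ᵐ x ∂μ, |n' x| ≤ m x := by
    filter_upwards [h.fst, h.deriv_eq, Lp.coeFn_sub p.2 ((E : ℂ) • p.1),
      Lp.coeFn_smul (E : ℂ) p.1] with x h1 h2 h3 h4
    have hq : q x = p.2 x - (E : ℂ) • f x := by
      rw [show q x = _ from h3, Pi.sub_apply, h4, Pi.smul_apply, h1]
    have h5 : n' x = 2 * (inner ℂ (f x) (g x)).re := by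
      simp only [n', Complex.add_re]
      rw [← inner_conj_symm (g x), Complex.conj_re]; ring
    have h6 : (inner ℂ (f x) (g x)).re =
        (inner ℂ (f x) (-actJ (q x))).re + (inner ℂ (f x) (actJ (pot W x (f x)))).re := by
      have h7 : g x = -actJ (q x) + actJ (pot W x (f x)) - (E : ℂ) • actJ (f x) := by
        rw [h2, hq, map_sub, map_sub, map_smul]; abel
      rw [h7, inner_sub_right, inner_add_right, inner_smul_right, Complex.sub_re, Complex.add_re,
        Complex.re_ofReal_mul, re_inner_actJ_self, mul_zero, sub_zero]
    have h8 : |(inner ℂ (f x) (-actJ (q x))).re| ≤ ‖f x‖ * ‖q x‖ := by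
      refine (Complex.abs_re_le_norm _).trans ((norm_inner_le_norm _ _).trans ?_)
      rw [norm_neg, actJ_apply, norm_act_J]
    have h9 : |(inner ℂ (f x) (actJ (pot W x (f x)))).re| ≤ ‖f x‖ * (4 * B * ‖f x‖) := by
      refine (Complex.abs_re_le_norm _).trans ((norm_inner_le_norm _ _).trans ?_)
      rw [actJ_apply, norm_act_J]
      gcongr
      exact hW.norm_pot_le x _
    simp only [m]
    rw [h5, h6, h1, abs_mul, abs_two]
    have h10 := abs_add_le (inner ℂ (f x) (-actJ (q x))).re
      (inner ℂ (f x) (actJ (pot W x (f x)))).re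
    nlinarith [sq_nonneg (‖f x‖ - ‖q x‖)]
  have hdiff : ∀ y ∈ Icc c d, ‖f x‖ ^ 2 - ‖f y‖ ^ 2 ≤ ∫ x, m x ∂μ := by
    intro y hy
    rw [hn.sub_eq hy hx]
    have hn'i : IntegrableOn (fun x => |n' x|) (Icc c d) := by
      have := hn.integrable.norm
      rw [intervalIntegrable_iff_integrableOn_Icc_of_le hcd.le] at this
      exact this
    calc ∫ t in y..x, n' t ≤ ‖∫ t in y..x, n' t‖ := le_abs_self _
      _ ≤ ∫ t in uIoc y x, ‖n' t‖ := intervalIntegral.norm_integral_le_integral_norm_uIoc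
      _ ≤ ∫ t in Icc c d, |n' t| :=
        setIntegral_mono_set hn'i (ae_of_all _ fun t => abs_nonneg _)
          (uIoc_subset_uIcc.trans (ordConnected_Icc.uIcc_subset hy hx)).eventuallyLE
      _ ≤ ∫ t in Icc c d, m t := by
        refine integral_mono_ae hn'i ?_ ?_
        · rw [← hrestr]; exact hm.restrict
        · rw [← hrestr]; exact ae_restrict_of_ae hbound
      _ ≤ ∫ t, m t ∂μ := by
        rw [← hrestr]
        exact setIntegral_le_integral hm (ae_of_all _ fun t => by positivity)
  have hnI : IntegrableOn (fun y => ‖f y‖ ^ 2) (Icc c d) := by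
    exact (hf.continuousOn.norm.pow 2).integrableOn_Icc
  have hnle : ∫ y in Icc c d, ‖f y‖ ^ 2 ≤ ‖p.1‖ ^ 2 := by
    rw [norm_sq_eq_integral, ← hrestr]
    have h1 : ∫ y in Icc c d, ‖f y‖ ^ 2 ∂μ = ∫ y in Icc c d, ‖p.1 y‖ ^ 2 ∂μ :=
      integral_congr_ae (ae_restrict_of_ae (by filter_upwards [h.fst] with y hy; rw [hy]))
    rw [h1]
    exact setIntegral_le_integral (integrable_norm_sq _) (ae_of_all _ fun t => by positivity)
  have hconst : ∀ a : ℝ, ∫ _ in Icc c d, a = (d - c) * a := fun a => by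
    rw [setIntegral_const]; simp [hcd.le]
  have hfin : (d - c) * ‖f x‖ ^ 2 - ‖p.1‖ ^ 2 ≤ (d - c) * ∫ x, m x ∂μ := by
    calc (d - c) * ‖f x‖ ^ 2 - ‖p.1‖ ^ 2
        ≤ ∫ y in Icc c d, (‖f x‖ ^ 2 - ‖f y‖ ^ 2) := by
          rw [integral_sub (integrable_const _) hnI, hconst]
          linarith
      _ ≤ ∫ _ in Icc c d, ∫ x, m x ∂μ := by
          refine setIntegral_mono_on ((integrable_const _).sub hnI)
            (integrable_const _) measurableSet_Icc hdiff
      _ = _ := hconst _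
  rw [hmI] at hfin
  have hpos : 0 < d - c := sub_pos.2 hcd
  have h1 : ‖f x‖ ^ 2 ≤ (d - c)⁻¹ * ‖p.1‖ ^ 2 + ((1 + 8 * B) * ‖p.1‖ ^ 2 + ‖q‖ ^ 2) := by
    rw [← mul_le_mul_iff_right₀ hpos, mul_add, ← mul_assoc, mul_inv_cancel₀ hpos.ne', one_mul]
    linarith
  refine h1.trans (le_of_eq ?_)
  ring

lemma IsRep.zero : IsRep μ s bdry W (0 : Spinor μ × Spinor μ) 0 0 := by
  refine ⟨Lp.coeFn_zero _ _ _, MemLp.zero, fun c _ d _ hcd => ⟨hcd, ?_, fun x _ => ?_⟩, by simp,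
    ?_⟩
  · exact IntervalIntegrable.zero
  · simp
  · filter_upwards [Lp.coeFn_zero C2 2 μ] with x hx
    rw [Prod.snd_zero, hx]; simp

lemma IsRep.add_smul {p q : Spinor μ × Spinor μ} {f g h k : ℝ → C2} (hf : IsRep μ s bdry W p f g)
    (hh : IsRep μ s bdry W q h k) (a : ℂ) :
    IsRep μ s bdry W (p + a • q) (fun x => f x + a • h x) (fun x => g x + a • k x) := by
  refine ⟨?_, hf.memLp.add (hh.memLp.const_smul a), fun c hc d hd hcd => ?_, fun x hx => ?_, ?_⟩
  · filter_upwards [hf.fst, hh.fst, Lp.coeFn_add p.1 (a • q.1), Lp.coeFn_smul a q.1]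
      with x h1 h2 h3 h4
    rw [Prod.fst_add, Prod.smul_fst, h3, Pi.add_apply, h4, Pi.smul_apply, h1, h2]
  · exact (hf.prim c hc d hd hcd).add ((hh.prim c hc d hd hcd).clm
      ((a • ContinuousLinearMap.id ℂ C2).restrictScalars ℝ))
  · simp [hf.bdry x hx, hh.bdry x hx]
  · filter_upwards [hf.snd, hh.snd, Lp.coeFn_add p.2 (a • q.2), Lp.coeFn_smul a q.2]
      with x h1 h2 h3 h4
    rw [Prod.snd_add, Prod.smul_snd, h3, Pi.add_apply, h4, Pi.smul_apply, h1, h2]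
    simp only [map_add, map_smul, smul_add]
    abel

lemma IsRep.sum {ι : Type*} {p : ι → Spinor μ × Spinor μ} {f g : ι → ℝ → C2}
    (hf : ∀ i, IsRep μ s bdry W (p i) (f i) (g i)) (a : ι → ℂ) (S : Finset ι) :
    ∃ g', IsRep μ s bdry W (∑ i ∈ S, a i • p i) (fun x => ∑ i ∈ S, a i • f i x) g' := by
  classical
  induction S using Finset.induction_on with
  | empty => exact ⟨0, by simp only [Finset.sum_empty]; exact IsRep.zero⟩
  | insert j S hj ih =>
    obtain ⟨g', h⟩ := ih
    refine ⟨fun x => g' x + a j • g j x, ?_⟩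
    simp_rw [Finset.sum_insert hj, add_comm (a j • _)]
    exact h.add_smul (hf j) (a j)

/-- The measure with density `∑ ‖(T eᵢ)(x)‖²`, where `(eᵢ)` is an orthonormal basis. -/
def density {H : Type*} [NormedAddCommGroup H] [InnerProductSpace ℂ H] [CompleteSpace H]
    (T : H →L[ℂ] Spinor μ) : Measure ℝ :=
  Measure.sum fun i => μ.withDensity fun x => ‖T (stdBasis H i) x‖ₑ ^ 2

lemma density_apply {H : Type*} [NormedAddCommGroup H] [InnerProductSpace ℂ H] [CompleteSpace H]
    (T : H →L[ℂ] Spinor μ) {t : Set ℝ} (ht : MeasurableSet t) :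
    density T t = ∑' i, ∫⁻ x in t, ‖T (stdBasis H i) x‖ₑ ^ 2 ∂μ := by
  rw [density, Measure.sum_apply _ ht]
  exact tsum_congr fun i => withDensity_apply _ ht

/-- A bound for the density of the resolvent of a Dirac operator. -/
lemma density_resolv_le (hs : IsIntervalMeasure μ s) (hW : IsBddPotential W B)
    {A : Spinor μ →ₗ.[ℂ] Spinor μ} (hA : IsSelfAdjoint A) (hgr : A.graph = diracGraph μ s bdry W)
    (E : ℝ) {y : ℝ} (hy : y ≠ 0) {c d : ℝ} (hc : c ∈ s) (hd : d ∈ s) (hcd : c < d) :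
    density (resolv A ⟨E, y⟩) (Icc c d) ≤
      ENNReal.ofReal (2 * ((1 + (1 + 8 * B) * (d - c)) * (y ^ 2)⁻¹ + 4 * (d - c))) := by
  have hB0 : 0 ≤ B := (abs_nonneg _).trans (hW.bound 0 0 0)
  have hsub : Icc c d ⊆ s := hs.ord.out hc hd
  set z : ℂ := ⟨E, y⟩ with hz
  have hzim : z.im ≠ 0 := hy
  set M : ℝ := ((d - c)⁻¹ + 1 + 8 * B) * (y ^ 2)⁻¹ + 4 with hM
  have hpos : 0 < d - c := sub_pos.2 hcd
  -- `M` comes from `IsRep.norm_sq_le` applied to ψ = (A - z)⁻¹u, with ‖ψ‖ ≤ ‖u‖/|y| and ‖(A - E)ψ‖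
  -- ≤ 2‖u‖.
  have hM0 : 0 ≤ M := by positivity
  have hgraph : ∀ u : Spinor μ, (resolv A z u, u + z • resolv A z u) ∈ diracGraph μ s bdry W :=
    fun u => hgr ▸ (isResolvent_resolv hA hzim).1 u
  have hpt : ∀ (u : Spinor μ) (f g : ℝ → C2),
      IsRep μ s bdry W (resolv A z u, u + z • resolv A z u) f g → ∀ x ∈ Icc c d,
      ‖f x‖ ^ 2 ≤ M * ‖u‖ ^ 2 := by
    intro u f g h x hx
    refine (h.norm_sq_le hs hW hc hd hcd E hx).trans ?_
    have h1 := norm_resolv_apply_le hA hzim u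
    have h2 : (u + z • resolv A z u - (E : ℂ) • resolv A z u) =
        u + ((y : ℂ) * Complex.I) • resolv A z u := by
      rw [add_sub_assoc, ← sub_smul]
      congr 2
      rw [hz, Complex.mk_eq_add_mul_I]; ring
    have h3 : ‖u + z • resolv A z u - (E : ℂ) • resolv A z u‖ ≤ 2 * ‖u‖ := by
      rw [h2]
      refine (norm_add_le _ _).trans ?_
      rw [norm_smul, norm_mul, Complex.norm_I, mul_one, Complex.norm_real, Real.norm_eq_abs]
      have h4 : |y| * ‖resolv A z u‖ ≤ ‖u‖ := by
        rw [← le_inv_mul_iff₀ (abs_pos.2 hy)]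
        exact h1
      linarith
    have h5 : ‖resolv A z u‖ ^ 2 ≤ (y ^ 2)⁻¹ * ‖u‖ ^ 2 := by
      have h6 := pow_le_pow_left₀ (norm_nonneg _) h1 2
      rw [mul_pow, inv_pow, sq_abs] at h6
      exact h6
    have h7 := pow_le_pow_left₀ (norm_nonneg _) h3 2
    calc _ ≤ ((d - c)⁻¹ + 1 + 8 * B) * ((y ^ 2)⁻¹ * ‖u‖ ^ 2) + (2 * ‖u‖) ^ 2 := by
          gcongr
      _ = M * ‖u‖ ^ 2 := by rw [hM]; ring
  rw [density_apply _ measurableSet_Icc]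
  have hrep : ∀ u : Spinor μ, ∃ f g,
      IsRep μ s bdry W (resolv A z u, u + z • resolv A z u) f g := fun u =>
    exists_isRep hs (hgraph u)
  let b := stdBasis (Spinor μ)
  choose f g hf using fun i => hrep (b i)
  -- Evaluation of a component at `x` is a bounded functional of `u`. Testing it on u = ∑
  -- conj(fᵢ(x)ₖ) eᵢ gives N² ≤ M N for the sum `N` of squares, hence N ≤ M.
  have hkey : ∀ (S : Finset _) (k : Fin 2), ∀ x ∈ Icc c d, ∑ i ∈ S, ‖f i x k‖ ^ 2 ≤ M := by
    intro S k x hx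
    let a : _ → ℂ := fun i => conj (f i x k)
    obtain ⟨g', hg'⟩ := IsRep.sum hf a S
    let u : Spinor μ := ∑ i ∈ S, a i • b i
    have hu : (∑ i ∈ S, a i • (resolv A z (b i), b i + z • resolv A z (b i))) =
        (resolv A z u, u + z • resolv A z u) := by
      ext1
      · rw [Prod.fst_sum]
        simp only [Prod.smul_fst, u, map_sum, map_smul]
      · rw [Prod.snd_sum]
        simp only [Prod.smul_snd, u, map_sum, map_smul, smul_add, Finset.sum_add_distrib,
          Finset.smul_sum]
        congr 1
        exact Finset.sum_congr rfl fun i _ => smul_comm _ _ _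
    rw [hu] at hg'
    have h1 := hpt u _ _ hg' x hx
    have h2 : ‖u‖ ^ 2 = ∑ i ∈ S, ‖f i x k‖ ^ 2 := by
      have h3 := b.orthonormal.inner_sum a a S
      have h4 : inner ℂ u u = ((∑ i ∈ S, ‖f i x k‖ ^ 2 : ℝ) : ℂ) := by
        rw [show inner ℂ u u = _ from h3]
        push_cast
        refine Finset.sum_congr rfl fun i _ => ?_
        simp only [a, Complex.conj_conj]
        rw [mul_comm, Complex.conj_mul']
      rw [inner_self_eq_norm_sq_to_K] at h4
      exact Complex.ofReal_injective (by rw [Complex.ofReal_pow]; exact h4)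
    have h5 : ‖(∑ i ∈ S, a i • f i x) k‖ ^ 2 ≤ ‖∑ i ∈ S, a i • f i x‖ ^ 2 := by
      gcongr
      exact PiLp.norm_apply_le _ _
    have h6 : (∑ i ∈ S, a i • f i x) k = ((∑ i ∈ S, ‖f i x k‖ ^ 2 : ℝ) : ℂ) := by
      rw [WithLp.ofLp_sum, Finset.sum_apply]
      push_cast
      refine Finset.sum_congr rfl fun i _ => ?_
      simp only [a, PiLp.smul_apply, smul_eq_mul]
      rw [Complex.conj_mul']
    rw [h6, Complex.norm_real, Real.norm_eq_abs, sq_abs] at h5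
    have h7 := h5.trans h1
    rw [h2] at h7
    set N := ∑ i ∈ S, ‖f i x k‖ ^ 2
    have hN0 : 0 ≤ N := Finset.sum_nonneg fun i _ => by positivity
    by_contra hlt
    push Not at hlt
    nlinarith
  rw [ENNReal.tsum_eq_iSup_sum]
  refine iSup_le fun S => ?_
  have h1 : ∀ i, ∫⁻ x in Icc c d, ‖resolv A z (b i) x‖ₑ ^ 2 ∂μ =
      ∫⁻ x in Icc c d, ENNReal.ofReal (‖f i x‖ ^ 2) ∂μ := fun i => by
    refine lintegral_congr_ae (ae_restrict_of_ae ?_)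
    filter_upwards [(hf i).fst] with x hx
    rw [show resolv A z (b i) x = f i x from hx, ENNReal.ofReal_pow (norm_nonneg _), ofReal_norm]
  calc ∑ i ∈ S, ∫⁻ x in Icc c d, ‖resolv A z (b i) x‖ₑ ^ 2 ∂μ
      = ∑ i ∈ S, ∫⁻ x in Icc c d, ENNReal.ofReal (‖f i x‖ ^ 2) ∂μ :=
        Finset.sum_congr rfl fun i _ => h1 i
    _ = ∫⁻ x in Icc c d, ∑ i ∈ S, ENNReal.ofReal (‖f i x‖ ^ 2) ∂μ := by
        rw [lintegral_finsetSum']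
        intro i _
        have h2 : AEMeasurable (f i) μ :=
          (Lp.aestronglyMeasurable (resolv A z (b i))).aemeasurable.congr (hf i).fst
        exact (h2.norm.pow_const 2).ennreal_ofReal.restrict
    _ ≤ ∫⁻ _ in Icc c d, ENNReal.ofReal (2 * M) ∂μ := by
        refine setLIntegral_mono measurable_const fun x hx => ?_
        rw [← ENNReal.ofReal_sum_of_nonneg fun i _ => by positivity]
        refine ENNReal.ofReal_le_ofReal ?_
        have h3 : ∀ i, ‖f i x‖ ^ 2 = ‖f i x 0‖ ^ 2 + ‖f i x 1‖ ^ 2 := fun i => by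
          rw [EuclideanSpace.norm_sq_eq, Fin.sum_univ_two]
        simp_rw [h3, Finset.sum_add_distrib]
        linarith [hkey S 0 x hx, hkey S 1 x hx]
    _ = ENNReal.ofReal (2 * M) * ENNReal.ofReal (d - c) := by
        rw [setLIntegral_const, ← Measure.restrict_apply_self,
          hs.restrict measurableSet_Icc hsub, Measure.restrict_apply_self, Real.volume_Icc]
    _ = _ := by
        rw [← ENNReal.ofReal_mul (by positivity), hM]
        congr 1
        field_simp
        ring

end Bounds
end RandomDirac
end

noncomputable section
set_option linter.unusedSectionVars false
namespace RandomDirac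
open scoped ENNReal NNReal ComplexConjugate

section Comparison

variable {μ : Measure ℝ} [IsLocallyFiniteMeasure μ] {s bdry : Set ℝ}
  {W : ℝ → Matrix (Fin 2) (Fin 2) ℝ} {B : ℝ}

/-! ### Restriction to a translated box -/

lemma measurePreserving_box (hs : IsIntervalMeasure μ s) {ℓ t : ℝ}
    (hsub : Icc (t - ℓ / 2) (t + ℓ / 2) ⊆ s) :
    MeasurePreserving (fun x => x + t) (boxMeasure ℓ)
      (μ.restrict (Ioo (t - ℓ / 2) (t + ℓ / 2))) := by
  rw [hs.restrict measurableSet_Ioo (Ioo_subset_Icc_self.trans hsub)]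
  have h := (measurePreserving_add_right volume t).restrict_preimage
    (measurableSet_Ioo (a := t - ℓ / 2) (b := t + ℓ / 2))
  have h2 : (fun x => x + t) ⁻¹' (Ioo (t - ℓ / 2) (t + ℓ / 2)) = Ioo (-(ℓ / 2)) (ℓ / 2) := by
    ext x
    simp only [mem_preimage, mem_Ioo]
    constructor <;> rintro ⟨h1, h2⟩ <;> constructor <;> linarith
  rw [h2] at h
  exact h

lemma measurePreserving_box_symm (hs : IsIntervalMeasure μ s) {ℓ t : ℝ}
    (hsub : Icc (t - ℓ / 2) (t + ℓ / 2) ⊆ s) :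
    MeasurePreserving (fun x => x - t) (μ.restrict (Ioo (t - ℓ / 2) (t + ℓ / 2)))
      (boxMeasure ℓ) := by
  rw [hs.restrict measurableSet_Ioo (Ioo_subset_Icc_self.trans hsub)]
  have h := (measurePreserving_sub_right volume t).restrict_preimage
    (measurableSet_Ioo (a := -(ℓ / 2)) (b := ℓ / 2))
  have h2 : (fun x => x - t) ⁻¹' (Ioo (-(ℓ / 2)) (ℓ / 2)) = Ioo (t - ℓ / 2) (t + ℓ / 2) := by
    ext x
    simp only [mem_preimage, mem_Ioo]
    constructor <;> rintro ⟨h1, h2⟩ <;> constructor <;> linarith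
  rw [h2] at h
  exact h

/-- ρ restricts to the cell around `t` and moves it to the origin. Its adjoint is extension by zero,
hence ρρ* = 1. -/
lemma exists_restriction (hs : IsIntervalMeasure μ s) {ℓ t : ℝ}
    (hsub : Icc (t - ℓ / 2) (t + ℓ / 2) ⊆ s) :
    ∃ ρ : Spinor μ →L[ℂ] Spinor (boxMeasure ℓ),
      (∀ f, ρ f =ᵐ[boxMeasure ℓ] fun x => f (x + t)) ∧ (∀ f, ‖ρ f‖ ≤ ‖f‖) ∧
      ∀ h, ρ (ContinuousLinearMap.adjoint ρ h) = h := by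
  have mp := measurePreserving_box hs hsub
  have mp' := measurePreserving_box_symm hs hsub
  let ρ : Spinor μ →L[ℂ] Spinor (boxMeasure ℓ) :=
    (Lp.compMeasurePreservingₗᵢ ℂ (fun x => x + t) mp).toContinuousLinearMap ∘L
      LpToLpRestrictCLM ℝ C2 ℂ μ 2 (Ioo (t - ℓ / 2) (t + ℓ / 2))
  have hρ : ∀ f, ρ f =ᵐ[boxMeasure ℓ] fun x => f (x + t) := by
    intro f
    have h1 : ρ f =ᵐ[boxMeasure ℓ]
        (LpToLpRestrictCLM ℝ C2 ℂ μ 2 (Ioo (t - ℓ / 2) (t + ℓ / 2)) f) ∘ (fun x => x + t) :=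
      Lp.coeFn_compMeasurePreserving _ mp
    exact h1.trans (mp.quasiMeasurePreserving.ae_eq_comp (LpToLpRestrictCLM_coeFn ℂ _ f))
  have hnorm : ∀ f, ‖ρ f‖ ≤ ‖f‖ := by
    intro f
    have h1 : ‖ρ f‖ = ‖LpToLpRestrictCLM ℝ C2 ℂ μ 2 (Ioo (t - ℓ / 2) (t + ℓ / 2)) f‖ :=
      (Lp.compMeasurePreservingₗᵢ ℂ (fun x => x + t) mp).norm_map _
    rw [h1]
    exact norm_Lp_toLp_restrict_le _ f
  refine ⟨ρ, hρ, hnorm, fun h => ?_⟩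
  have hadj : ‖ContinuousLinearMap.adjoint ρ h‖ ≤ ‖h‖ := by
    refine (ContinuousLinearMap.le_opNorm _ _).trans ?_
    rw [LinearIsometryEquiv.norm_map]
    have : ‖ρ‖ ≤ 1 := ρ.opNorm_le_bound zero_le_one fun f => by rw [one_mul]; exact hnorm f
    exact mul_le_of_le_one_left (norm_nonneg _) this
  have hmem : MemLp (h ∘ fun x => x - t) 2 (μ.restrict (Ioo (t - ℓ / 2) (t + ℓ / 2))) :=
    (Lp.memLp h).comp_measurePreserving mp'
  have hmem' := (memLp_indicator_iff_restrict measurableSet_Ioo).2 hmem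
  set S : Spinor μ := hmem'.toLp _ with hS
  have hρS : ρ S = h := by
    refine Lp.ext ?_
    have h1 : ∀ᵐ x ∂(boxMeasure ℓ), S (x + t) = h x := by
      have h2 := mp.quasiMeasurePreserving.ae (ae_restrict_of_ae hmem'.coeFn_toLp)
      filter_upwards [h2, ae_restrict_mem measurableSet_Ioo] with x hx hxm
      rw [hx, indicator_of_mem]
      · simp
      · constructor <;> linarith [hxm.1, hxm.2]
    exact (hρ S).trans h1
  have hSn : ‖S‖ = ‖h‖ := by
    rw [hS, Lp.norm_toLp, eLpNorm_indicator_eq_eLpNorm_restrict measurableSet_Ioo,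
      eLpNorm_comp_measurePreserving (Lp.aestronglyMeasurable h) mp', Lp.norm_def]
  -- With `S` the extension by zero, ‖S - ρ*h‖² = ‖S‖² - 2‖h‖² + ‖ρ*h‖², and neither ‖S‖ nor ‖ρ*h‖
  -- exceeds ‖h‖.
  have hkey : S = ContinuousLinearMap.adjoint ρ h := by
    rw [← sub_eq_zero, ← norm_eq_zero, ← sq_eq_zero_iff]
    have h1 := norm_sub_sq (𝕜 := ℂ) S (ContinuousLinearMap.adjoint ρ h)
    rw [ContinuousLinearMap.adjoint_inner_right, hρS, inner_self_eq_norm_sq, hSn] at h1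
    have h2 := pow_le_pow_left₀ (norm_nonneg _) hadj 2
    refine le_antisymm ?_ (by positivity)
    rw [h1]
    linarith
  rw [← hkey, hρS]

lemma hsq_restriction (hs : IsIntervalMeasure μ s) {ℓ t : ℝ}
    (hsub : Icc (t - ℓ / 2) (t + ℓ / 2) ⊆ s) {ρ : Spinor μ →L[ℂ] Spinor (boxMeasure ℓ)}
    (hρ : ∀ f, ρ f =ᵐ[boxMeasure ℓ] fun x => f (x + t))
    {H : Type*} [NormedAddCommGroup H] [InnerProductSpace ℂ H] [CompleteSpace H]
    (T : H →L[ℂ] Spinor μ) :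
    hsq (ρ ∘L T) = density T (Icc (t - ℓ / 2) (t + ℓ / 2)) := by
  have mp := measurePreserving_box hs hsub
  rw [density_apply _ measurableSet_Icc, hsq]
  refine tsum_congr fun i => ?_
  rw [ContinuousLinearMap.comp_apply, enorm_sq_eq_lintegral]
  have h1 : ∫⁻ x, ‖ρ (T (stdBasis H i)) x‖ₑ ^ 2 ∂(boxMeasure ℓ) =
      ∫⁻ x, ‖T (stdBasis H i) (x + t)‖ₑ ^ 2 ∂(boxMeasure ℓ) :=
    lintegral_congr_ae (by filter_upwards [hρ (T (stdBasis H i))] with x hx; rw [hx])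
  rw [h1, mp.lintegral_comp_emb (measurableEmbedding_addRight t)
    (fun x => ‖T (stdBasis H i) x‖ₑ ^ 2), hs.restrict measurableSet_Icc hsub,
    hs.restrict measurableSet_Ioo (Ioo_subset_Icc_self.trans hsub),
    Measure.restrict_congr_set Ioo_ae_eq_Icc]

lemma IsPrimitive.comp_add_right {f g : ℝ → C2} {c d t : ℝ}
    (h : IsPrimitive f g (c + t) (d + t)) :
    IsPrimitive (fun x => f (x + t)) (fun x => g (x + t)) c d := by
  refine ⟨by linarith [h.le], ?_, fun x hx => ?_⟩
  · have := h.integrable.comp_add_right t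
    simpa using this
  · rw [intervalIntegral.integral_comp_add_right (fun x => g x)]
    exact h.eq _ ⟨by linarith [hx.1], by linarith [hx.2]⟩

lemma IsRep.restriction (hs : IsIntervalMeasure μ s) {ℓ t : ℝ}
    (hsub : Icc (t - ℓ / 2) (t + ℓ / 2) ⊆ s) {ρ : Spinor μ →L[ℂ] Spinor (boxMeasure ℓ)}
    (hρ : ∀ f, ρ f =ᵐ[boxMeasure ℓ] fun x => f (x + t)) {p : Spinor μ × Spinor μ} {f g : ℝ → C2}
    (h : IsRep μ s bdry W p f g) :
    IsRep (boxMeasure ℓ) (Icc (-(ℓ / 2)) (ℓ / 2)) ∅ (fun x => W (x + t)) (ρ p.1, ρ p.2)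
      (fun x => f (x + t)) (fun x => g (x + t)) := by
  have mp := measurePreserving_box hs hsub
  have hae : ∀ {P : ℝ → Prop}, (∀ᵐ x ∂μ, P x) → ∀ᵐ x ∂(boxMeasure ℓ), P (x + t) := fun hP =>
    mp.quasiMeasurePreserving.ae (ae_restrict_of_ae hP)
  have hmem : ∀ x ∈ Icc (-(ℓ / 2)) (ℓ / 2), x + t ∈ s := fun x hx =>
    hsub ⟨by linarith [hx.1], by linarith [hx.2]⟩
  refine ⟨?_, ?_, fun c hc d hd hcd => ?_, by simp, ?_⟩
  · filter_upwards [hρ p.1, hae h.fst] with x h1 h2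
    rw [h1, h2]
  · exact (h.memLp.restrict _).comp_measurePreserving mp
  · exact (h.prim _ (hmem c hc) _ (hmem d hd) (by linarith)).comp_add_right
  · filter_upwards [hρ p.2, hae h.snd] with x h1 h2
    rw [h1, h2]
    rfl

lemma diracGraph_mono {bdry' : Set ℝ} (h : bdry' ⊆ bdry) :
    diracGraph μ s bdry W ≤ diracGraph μ s bdry' W := by
  rintro p ⟨f, g, h1, h2, h3, h4⟩
  exact ⟨f, g, h1, h2, fun x hx => h3 x (h hx), h4⟩

/-! ### Solutions of the homogeneous equation -/

/-- The square integrable solutions of `J ψ' + W ψ = z ψ`. -/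
def solutions (μ : Measure ℝ) [IsLocallyFiniteMeasure μ] (s : Set ℝ)
    (W : ℝ → Matrix (Fin 2) (Fin 2) ℝ) (z : ℂ) : Submodule ℂ (Spinor μ) :=
  (diracGraph μ s ∅ W).comap (LinearMap.prod LinearMap.id (z • LinearMap.id))

lemma mem_solutions {z : ℂ} {v : Spinor μ} :
    v ∈ solutions μ s W z ↔ (v, z • v) ∈ diracGraph μ s ∅ W := Iff.rfl

/-- Grönwall: f' is bounded by M‖f‖ almost everywhere, so ‖f‖ ≤ M∫‖f‖ from the left end point. The
inequality is applied to this integral, which is differentiable everywhere. -/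
lemma IsRep.eq_zero_of_left_eq_zero {a b : ℝ} (hab : a < b) (hW : IsBddPotential W B) {z : ℂ}
    {v : Spinor (volume.restrict (Ioo a b))} {f g : ℝ → C2}
    (h : IsRep (volume.restrict (Ioo a b)) (Icc a b) bdry W (v, z • v) f g) (h0 : f a = 0) :
    v = 0 := by
  have hs := isIntervalMeasure_Icc hab
  have hB0 : 0 ≤ B := (abs_nonneg _).trans (hW.bound 0 0 0)
  have ha : a ∈ Icc a b := left_mem_Icc.2 hab.le
  have hb : b ∈ Icc a b := right_mem_Icc.2 hab.le
  have hp := h.prim a ha b hb hab.le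
  set M : ℝ := ‖z‖ + 4 * B with hM
  have hg : ∀ᵐ x ∂(volume.restrict (Icc a b)), ‖g x‖ ≤ M * ‖f x‖ := by
    rw [← hs.eq]
    filter_upwards [h.deriv_eq, h.fst, Lp.coeFn_smul z v] with x h1 h2 h3
    rw [h1, norm_neg, actJ_apply, norm_act_J]
    have h4 : (z • v) x = z • f x := by rw [h3, Pi.smul_apply, h2]
    refine (norm_sub_le _ _).trans ?_
    rw [h4, norm_smul, hM, add_mul]
    gcongr
    exact hW.norm_pot_le x _
  let F : ℝ → ℝ := fun x => ‖IccExtend hab.le ((Icc a b).domRestrict f) x‖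
  have hF : Continuous F := (hp.continuousOn.domRestrict.Icc_extend').norm
  have hFf : ∀ x ∈ Icc a b, F x = ‖f x‖ := fun x hx => by
    simp only [F]
    rw [IccExtend_of_mem hab.le _ hx]
    rfl
  have hle : ∀ x ∈ Icc a b, ‖f x‖ ≤ M * ∫ t in a..x, F t := by
    intro x hx
    have h1 := hp.eq x hx
    rw [h0, zero_add] at h1
    rw [h1, ← intervalIntegral.integral_const_mul]
    refine intervalIntegral.norm_integral_le_of_norm_le hx.1 ?_
      ((hF.const_mul M).intervalIntegrable _ _)
    filter_upwards [(ae_restrict_iff' measurableSet_Icc).1 hg] with t ht htm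
    have htm' : t ∈ Icc a b := ⟨htm.1.le, htm.2.trans hx.2⟩
    rw [hFf t htm']
    exact ht htm'
  have hzero := eq_zero_of_abs_deriv_le_mul_abs_self_of_eq_zero_right
    (f := fun x => ∫ t in a..x, F t) (f' := F) (K := M) (a := a) (b := b)
    (fun x _ => (hF.integral_hasStrictDerivAt a x).hasDerivAt.continuousAt.continuousWithinAt)
    (fun x _ => (hF.integral_hasStrictDerivAt a x).hasDerivAt.hasDerivWithinAt)
    intervalIntegral.integral_same (fun x hx => by
      rw [hFf x (Ico_subset_Icc_self hx), norm_norm]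
      refine (hle x (Ico_subset_Icc_self hx)).trans ?_
      gcongr
      exact le_abs_self _)
  have hf0 : ∀ x ∈ Icc a b, f x = 0 := fun x hx => by
    have := hle x hx
    rw [hzero x hx, mul_zero] at this
    exact norm_le_zero_iff.1 this
  refine Lp.ext ?_
  have hsm : ∀ᵐ x ∂(volume.restrict (Ioo a b)), x ∈ Icc a b := by
    rw [hs.eq]; exact ae_restrict_mem hs.measurableSet
  filter_upwards [h.fst, hsm, Lp.coeFn_zero C2 2 (volume.restrict (Ioo a b))] with x h1 h2 h3
  rw [show v x = f x from h1, hf0 x h2, h3]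
  rfl

/-- Evaluation at the left end point is an injection into ℂ². This bound gives both the rank 2 of
the difference of resolvents and the bound 2 on multiplicities. -/
lemma solutions_finite {a b : ℝ} (hab : a < b) (hW : IsBddPotential W B) (z : ℂ) :
    FiniteDimensional ℂ (solutions (volume.restrict (Ioo a b)) (Icc a b) W z) ∧
      Module.finrank ℂ (solutions (volume.restrict (Ioo a b)) (Icc a b) W z) ≤ 2 := by
  have hs := isIntervalMeasure_Icc hab
  have ha : a ∈ Icc a b := left_mem_Icc.2 hab.le
  choose f g hf using fun v : solutions (volume.restrict (Ioo a b)) (Icc a b) W z =>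
    exists_isRep hs (mem_solutions.1 v.2)
  let ev : solutions (volume.restrict (Ioo a b)) (Icc a b) W z →ₗ[ℂ] C2 :=
    { toFun := fun v => f v a
      map_add' := fun v w => by
        have h1 := (hf v).add_smul (hf w) 1
        have h2 := (hf (v + w)).eqOn hs h1 (by simp) ha
        simpa using h2
      map_smul' := fun c v => by
        have h1 := IsRep.zero.add_smul (hf v) c
        have h2 := (hf (c • v)).eqOn hs h1 (by simp) ha
        simpa using h2 }
  have hinj : Function.Injective ev := by
    rw [← LinearMap.ker_eq_bot, LinearMap.ker_eq_bot']
    intro v hv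
    exact Subtype.ext ((hf v).eq_zero_of_left_eq_zero hab hW hv)
  refine ⟨Module.Finite.of_injective ev hinj, ?_⟩
  have := LinearMap.finrank_le_finrank_of_injective hinj
  simpa using this

/-! ### Comparison of resolvents -/

lemma IsBddPotential.translate (hW : IsBddPotential W B) (t : ℝ) :
    IsBddPotential (fun x => W (x + t)) B :=
  ⟨fun _ => hW.symm _, fun i j => (hW.measurable i j).comp (measurable_add_const t),
    fun _ => hW.bound _⟩

lemma enorm_sq_le_of_im {a b D : ℝ} {y : ℝ} (hy : y ≠ 0) (ha : 0 ≤ a) (hb : 0 ≤ b)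
    (h : |y * a ^ 2 - y * b ^ 2| ≤ D) :
    ENNReal.ofReal a ^ 2 ≤ ENNReal.ofReal b ^ 2 + ENNReal.ofReal |y|⁻¹ * ENNReal.ofReal D := by
  have hD : 0 ≤ D := (abs_nonneg _).trans h
  rw [← ENNReal.ofReal_pow ha, ← ENNReal.ofReal_pow hb, ← ENNReal.ofReal_mul (by positivity),
    ← ENNReal.ofReal_add (by positivity) (by positivity)]
  refine ENNReal.ofReal_le_ofReal ?_
  rw [← mul_sub, abs_mul] at h
  have hy' := abs_pos.2 hy
  have h1 : |a ^ 2 - b ^ 2| ≤ |y|⁻¹ * D := by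
    rw [inv_mul_eq_div, le_div_iff₀ hy']; linarith
  linarith [le_abs_self (a ^ 2 - b ^ 2)]

/-- On a box contained in the domain of a Dirac operator, the local density of the resolvent
agrees with the one of the operator of the box up to a bounded error. -/
lemma density_comparison (hs : IsIntervalMeasure μ s) (hW : IsBddPotential W B)
    {A : Spinor μ →ₗ.[ℂ] Spinor μ} (hA : IsSelfAdjoint A) (hgr : A.graph = diracGraph μ s bdry W)
    {z : ℂ} (hz : z.im ≠ 0) {ℓ t : ℝ} (hℓ : 0 < ℓ) (hsub : Icc (t - ℓ / 2) (t + ℓ / 2) ⊆ s) :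
    density (resolv A (conj z)) (Icc (t - ℓ / 2) (t + ℓ / 2)) ≤
        hsq (resolv (diracBox ℓ fun x => W (x + t)) z) + ENNReal.ofReal (4 / z.im ^ 2) ∧
      hsq (resolv (diracBox ℓ fun x => W (x + t)) z) ≤
        density (resolv A (conj z)) (Icc (t - ℓ / 2) (t + ℓ / 2)) +
          ENNReal.ofReal (4 / z.im ^ 2) := by
  have hz' : (conj z).im ≠ 0 := by simpa using hz
  obtain ⟨ρ, hρ, hρn, hρρ⟩ := exists_restriction hs hsub
  obtain ⟨hbA, hbgr⟩ := diracBox_isSelfAdjoint (hW.translate t) hℓ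
  set R := resolv A z with hR
  set Rb := resolv (diracBox ℓ fun x => W (x + t)) z with hRb
  have hℓ' : -(ℓ / 2) < ℓ / 2 := by linarith
  obtain ⟨hfd, hrank⟩ := solutions_finite hℓ' (hW.translate t) z
  let F := solutions (boxMeasure ℓ) (Icc (-(ℓ / 2)) (ℓ / 2)) (fun x => W (x + t)) z
  -- ρRρ*x and Rb x solve the same inhomogeneous equation on the cell and differ only in their
  -- boundary values, so `D` maps into the homogeneous solutions.
  let D : Spinor (boxMeasure ℓ) →L[ℂ] Spinor (boxMeasure ℓ) :=
    ρ ∘L R ∘L ContinuousLinearMap.adjoint ρ - Rb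
  have hDapp : ∀ x, D x = ρ (R (ContinuousLinearMap.adjoint ρ x)) - Rb x := fun x => rfl
  have hDF : ∀ x, D x ∈ F := by
    intro x
    rw [mem_solutions]
    have h1 := (isResolvent_resolv hA hz).1 (ContinuousLinearMap.adjoint ρ x)
    rw [hgr] at h1
    obtain ⟨f, g, hf⟩ := exists_isRep hs h1
    have h2 := (hf.restriction hs hsub hρ).mem (isIntervalMeasure_Icc hℓ')
    have h3 := (isResolvent_resolv hbA hz).1 x
    rw [hbgr] at h3
    have h4 := Submodule.sub_mem _ h2 (diracGraph_mono (empty_subset _) h3)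
    convert h4 using 1
    ext1
    · rfl
    · simp only [map_add, map_smul, hρρ, Prod.snd_sub, hDapp, smul_sub]
      abel
  have hadjn : ‖ContinuousLinearMap.adjoint ρ‖ ≤ 1 := by
    rw [LinearIsometryEquiv.norm_map]
    exact ρ.opNorm_le_bound zero_le_one fun f => by rw [one_mul]; exact hρn f
  have hDn : ‖D‖ ≤ 2 * |z.im|⁻¹ := by
    refine D.opNorm_le_bound (by positivity) fun x => ?_
    rw [hDapp]
    refine (norm_sub_le _ _).trans ?_
    have h1 := (hρn (R (ContinuousLinearMap.adjoint ρ x))).trans (norm_resolv_apply_le hA hz _)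
    have h2 := norm_resolv_apply_le hbA hz x
    have h3 : ‖ContinuousLinearMap.adjoint ρ x‖ ≤ ‖x‖ :=
      ((ContinuousLinearMap.adjoint ρ).le_of_opNorm_le hadjn x).trans (by rw [one_mul])
    have h4 : |z.im|⁻¹ * ‖ContinuousLinearMap.adjoint ρ x‖ ≤ |z.im|⁻¹ * ‖x‖ := by gcongr
    linarith
  -- Rank at most 2 times norm at most 2/|Im z|.
  have htr : ∑' i, ‖inner ℂ (stdBasis (Spinor (boxMeasure ℓ)) i)
      (D (stdBasis (Spinor (boxMeasure ℓ)) i))‖ₑ ≤ ENNReal.ofReal (4 * |z.im|⁻¹) := by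
    refine (tsum_enorm_inner_le_of_range (stdBasis _) D F hDF).trans ?_
    have h1 : ENNReal.ofReal (4 * |z.im|⁻¹) = 2 * ENNReal.ofReal (2 * |z.im|⁻¹) := by
      rw [← ENNReal.ofReal_ofNat 2, ← ENNReal.ofReal_mul (by norm_num)]
      congr 1
      ring
    rw [h1]
    gcongr
    · exact_mod_cast hrank
    · rw [← ofReal_norm]
      exact ENNReal.ofReal_le_ofReal hDn
  -- The squared norms are imaginary parts of quadratic forms, so a trace norm bound on `D`, divided
  -- by |Im z|, compares the Hilbert–Schmidt norms.
  have him : ∀ x, |z.im * ‖R (ContinuousLinearMap.adjoint ρ x)‖ ^ 2 - z.im * ‖Rb x‖ ^ 2| ≤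
      ‖inner ℂ x (D x)‖ := by
    intro x
    rw [← im_inner_resolv hA hz, ← im_inner_resolv hbA hz, ContinuousLinearMap.adjoint_inner_left,
      ← Complex.sub_im, ← inner_sub_right]
    exact Complex.abs_im_le_norm _
  -- Passing to the adjoint puts the restriction on the left, where it localizes the density; this
  -- is where `conj z` comes from.
  have hdens : hsq (R ∘L ContinuousLinearMap.adjoint ρ) =
      density (resolv A (conj z)) (Icc (t - ℓ / 2) (t + ℓ / 2)) := by
    rw [← hsq_restriction hs hsub hρ, ← hsq_adjoint, ContinuousLinearMap.adjoint_comp,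
      ContinuousLinearMap.adjoint_adjoint, hR, adjoint_resolv hA hz]
  have herr : ENNReal.ofReal |z.im|⁻¹ * ENNReal.ofReal (4 * |z.im|⁻¹) =
      ENNReal.ofReal (4 / z.im ^ 2) := by
    rw [← ENNReal.ofReal_mul (by positivity)]
    congr 1
    rw [← sq_abs z.im]
    field_simp
  rw [← hdens]
  simp only [hsq, ContinuousLinearMap.comp_apply]
  rw [← herr]
  constructor
  · refine le_trans (ENNReal.tsum_le_tsum fun i => ?_) ((ENNReal.tsum_add (f := fun i =>
      ‖Rb (stdBasis (Spinor (boxMeasure ℓ)) i)‖ₑ ^ 2) (g := fun i => ENNReal.ofReal |z.im|⁻¹ *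
        ‖inner ℂ (stdBasis (Spinor (boxMeasure ℓ)) i)
          (D (stdBasis (Spinor (boxMeasure ℓ)) i))‖ₑ)).le.trans ?_)
    · have := enorm_sq_le_of_im hz (norm_nonneg _) (norm_nonneg _)
        (him (stdBasis (Spinor (boxMeasure ℓ)) i))
      simpa only [ofReal_norm] using this
    · rw [ENNReal.tsum_mul_left]
      gcongr
  · refine le_trans (ENNReal.tsum_le_tsum fun i => ?_) ((ENNReal.tsum_add (f := fun i =>
      ‖R (ContinuousLinearMap.adjoint ρ (stdBasis (Spinor (boxMeasure ℓ)) i))‖ₑ ^ 2)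
      (g := fun i => ENNReal.ofReal |z.im|⁻¹ *
        ‖inner ℂ (stdBasis (Spinor (boxMeasure ℓ)) i)
          (D (stdBasis (Spinor (boxMeasure ℓ)) i))‖ₑ)).le.trans ?_)
    · have h1 := him (stdBasis (Spinor (boxMeasure ℓ)) i)
      rw [abs_sub_comm] at h1
      have := enorm_sq_le_of_im hz (norm_nonneg _) (norm_nonneg _) h1
      simpa only [ofReal_norm] using this
    · rw [ENNReal.tsum_mul_left]
      gcongr

/-- The Hilbert-Schmidt norm of the resolvent of a Dirac operator on a box. -/
lemma hsq_resolv_box (hW : IsBddPotential W B) {L : ℝ} (hL : 0 < L) {z : ℂ} (hz : z.im ≠ 0) :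
    hsq (resolv (diracBox L W) z) =
      density (resolv (diracBox L W) (conj z)) (Icc (-(L / 2)) (L / 2)) := by
  rw [← hsq_adjoint, adjoint_resolv (diracBox_isSelfAdjoint hW hL).1 hz, hsq,
    density_apply _ measurableSet_Icc]
  refine tsum_congr fun i => ?_
  rw [enorm_sq_eq_lintegral]
  have hab : -(L / 2) < L / 2 := by linarith
  rw [(isIntervalMeasure_Icc hab).restrict measurableSet_Icc subset_rfl,
    ← (isIntervalMeasure_Icc hab).eq]

lemma adjoint_chi (L : ℝ) : ContinuousLinearMap.adjoint (chi L) = chi L := by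
  symm
  rw [ContinuousLinearMap.eq_adjoint_iff]
  intro f g
  rw [L2.inner_def, L2.inner_def]
  refine integral_congr_ae ?_
  filter_upwards [coeFn_chiFun L f, coeFn_chiFun L g] with x h1 h2
  change inner ℂ (chiFun L f x) _ = inner ℂ _ (chiFun L g x)
  rw [h1, h2]
  by_cases hx : x ∈ Icc (-(L / 2)) (L / 2)
  · rw [indicator_of_mem hx, indicator_of_mem hx]
  · rw [indicator_of_notMem hx, indicator_of_notMem hx, inner_zero_left, inner_zero_right]

lemma hsq_resolv_line (hW : IsBddPotential W B) (L : ℝ) {z : ℂ} (hz : z.im ≠ 0) :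
    hsq (resolv (diracLine W) z ∘L chi L) =
      density (resolv (diracLine W) (conj z)) (Icc (-(L / 2)) (L / 2)) := by
  rw [← hsq_adjoint, ContinuousLinearMap.adjoint_comp, adjoint_chi,
    adjoint_resolv (diracLine_isSelfAdjoint hW).1 hz, hsq, density_apply _ measurableSet_Icc]
  refine tsum_congr fun i => ?_
  rw [enorm_sq_eq_lintegral, ContinuousLinearMap.comp_apply,
    ← lintegral_indicator measurableSet_Icc]
  refine lintegral_congr_ae ?_
  filter_upwards [coeFn_chiFun L (resolv (diracLine W) (conj z) (stdBasis (Spinor volume) i))]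
    with x h1
  change ‖chiFun L _ x‖ₑ ^ 2 = _
  rw [h1]
  by_cases hx : x ∈ Icc (-(L / 2)) (L / 2)
  · rw [indicator_of_mem hx, indicator_of_mem hx]
  · rw [indicator_of_notMem hx, indicator_of_notMem hx]; simp

end Comparison
end RandomDirac
end

noncomputable section
set_option linter.unusedSectionVars false
namespace RandomDirac
open scoped ENNReal NNReal ComplexConjugate

/-! ### Trace measures and their Poisson integrals. -/

section TraceMeasure

variable {H K : Type*} [NormedAddCommGroup H] [InnerProductSpace ℂ H] [CompleteSpace H]
  [NormedAddCommGroup K] [InnerProductSpace ℂ K] [CompleteSpace K]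
variable {A : H →ₗ.[ℂ] H}

/-- The measure `t ↦ tr(X* 1_{A ≤ t} X)`. -/
def traceMeasure (A : H →ₗ.[ℂ] H) (X : K →L[ℂ] H) : Measure ℝ :=
  Measure.sum fun i => specMeasure A (X (stdBasis K i))

lemma lintegral_poisson_specMeasure (hA : IsSelfAdjoint A) (x : H) (s : ℝ) {y : ℝ} (hy : 0 < y) :
    ∫⁻ t, ENNReal.ofReal (poisson s y t) ∂(specMeasure A x) =
      ENNReal.ofReal y * ‖resolv A ⟨s, y⟩ x‖ₑ ^ 2 := by
  have hint : Integrable (poisson s y) (specMeasure A x) := by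
    have := (integrable_resolvent (z := ⟨s, y⟩) hy.ne' (specMeasure A x)).im
    simpa only [RCLike.im_to_complex, im_resolvent_eq_poisson] using this
  rw [← ofReal_integral_eq_lintegral_ofReal hint
    (ae_of_all _ fun t => (poisson_pos hy s t).le), integral_poisson_specMeasure hA x s hy,
    ENNReal.ofReal_mul hy.le, ENNReal.ofReal_pow (norm_nonneg _), ofReal_norm]

lemma lintegral_poisson_traceMeasure (hA : IsSelfAdjoint A) (X : K →L[ℂ] H) (s : ℝ) {y : ℝ}
    (hy : 0 < y) : ∫⁻ t, ENNReal.ofReal (poisson s y t) ∂(traceMeasure A X) =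
      ENNReal.ofReal y * hsq (resolv A ⟨s, y⟩ ∘L X) := by
  rw [traceMeasure, lintegral_sum_measure, hsq, ← ENNReal.tsum_mul_left]
  exact tsum_congr fun i => lintegral_poisson_specMeasure hA _ s hy

lemma integral_poisson_traceMeasure (hA : IsSelfAdjoint A) (X : K →L[ℂ] H) (s : ℝ) {y : ℝ}
    (hy : 0 < y) : ∫ t, poisson s y t ∂(traceMeasure A X) =
      y * (hsq (resolv A ⟨s, y⟩ ∘L X)).toReal := by
  rw [integral_eq_lintegral_of_nonneg_ae (ae_of_all _ fun t => (poisson_pos hy s t).le)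
    (continuous_poisson hy s).aestronglyMeasurable, lintegral_poisson_traceMeasure hA X s hy,
    ENNReal.toReal_mul, ENNReal.toReal_ofReal hy.le]

lemma measure_le_of_le_poisson {m : Measure ℝ} {s y c : ℝ} (hc : 0 ≤ c) {S : Set ℝ}
    (hS : MeasurableSet S) (h : ∀ t ∈ S, 1 ≤ c * poisson s y t) :
    m S ≤ ENNReal.ofReal c * ∫⁻ t, ENNReal.ofReal (poisson s y t) ∂m := by
  rw [← lintegral_const_mul' _ _ ENNReal.ofReal_ne_top, ← lintegral_indicator_one hS]
  refine lintegral_mono fun t => ?_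
  by_cases ht : t ∈ S
  · rw [indicator_of_mem ht, ← ENNReal.ofReal_mul hc]
    simpa using h t ht
  · rw [indicator_of_notMem ht]; exact bot_le

lemma measure_Ico_le (m : Measure ℝ) (k : ℝ) :
    m (Ico k (k + 1)) ≤ 2 * ∫⁻ t, ENNReal.ofReal (poisson k 1 t) ∂m := by
  have := measure_le_of_le_poisson (m := m) (s := k) (y := 1) (c := 2) (by norm_num)
    (measurableSet_Ico (a := k) (b := k + 1)) fun t ht => by
      rw [poisson, mul_one_div, le_div_iff₀ (by positivity)]
      nlinarith [ht.1, ht.2]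
  simpa using this

lemma measure_Ioo_le (m : Measure ℝ) (E : ℝ) {δ : ℝ} (hδ : 0 < δ) :
    m (Ioo (E - δ) (E + δ)) ≤
      ENNReal.ofReal (2 * δ) * ∫⁻ t, ENNReal.ofReal (poisson E δ t) ∂m := by
  refine measure_le_of_le_poisson (by positivity) measurableSet_Ioo fun t ht => ?_
  rw [poisson, mul_div_assoc', le_div_iff₀ (by positivity)]
  nlinarith [ht.1, ht.2, mul_pos (sub_pos.2 ht.1) (sub_pos.2 ht.2)]

lemma unitBound_of_hsq_le (hA : IsSelfAdjoint A) (X : K →L[ℂ] H) {m : Measure ℝ} {a : ℝ≥0∞}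
    (hm : m = a • traceMeasure A X) {C : ℝ≥0}
    (h : ∀ k : ℝ, 2 * (a * hsq (resolv A ⟨k, 1⟩ ∘L X)) ≤ C) : UnitBound C m := by
  intro k
  refine (measure_Ico_le m k).trans (le_trans ?_ (h k))
  rw [hm, lintegral_smul_measure, lintegral_poisson_traceMeasure hA X k one_pos, smul_eq_mul]
  simp

variable {φ : ℝ → ℂ}

lemma IsTestFunction.bounded (hφ : IsTestFunction φ) : ∃ C, ∀ t, ‖φ t‖ ≤ C := by
  obtain ⟨c, hc, h⟩ := hφ.decay
  have hc0 : ∀ k, 0 ≤ c k := fun k => by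
    have := h (k : ℝ); rw [Int.floor_intCast] at this; exact (norm_nonneg _).trans this
  exact ⟨∑' k, c k, fun t => (h t).trans (hc.le_tsum _ fun k _ => hc0 k)⟩

lemma IsTestFunction.isFunctionOf_borelFC (hφ : IsTestFunction φ) (hA : IsSelfAdjoint A) :
    IsFunctionOf A φ (borelFC A φ) := by
  obtain ⟨C, hC⟩ := hφ.bounded
  exact RandomDirac.isFunctionOf_borelFC hA hφ.measurable hC

lemma IsTestFunction.inner_borelFC (hφ : IsTestFunction φ) (hA : IsSelfAdjoint A) (x : H) :
    inner ℂ x (borelFC A φ x) = ∫ t, φ t ∂(specMeasure A x) := by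
  obtain ⟨C, hC⟩ := hφ.bounded
  exact RandomDirac.inner_borelFC hA hφ.measurable hC x

/-- `T` enters only through its quadratic form, so this covers both the compressed operator on the
line and the operator on the box. -/
lemma trace_eq_integral (hA : IsSelfAdjoint A) (hφ : IsTestFunction φ) (X : K →L[ℂ] H)
    {C : ℝ≥0} (hC : UnitBound C (traceMeasure A X)) (T : K →L[ℂ] K)
    (hT : ∀ x, inner ℂ x (T x) = inner ℂ (X x) (borelFC A φ (X x))) :
    trace T = ∫ t, φ t ∂(traceMeasure A X) := by
  obtain ⟨c, hc, h⟩ := hφ.decay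
  have hint : Integrable φ (traceMeasure A X) :=
    hC.integrable hφ.measurable.aestronglyMeasurable hc h
  have := hasSum_integral_measure hint
  refine Eq.trans (tsum_congr fun i => ?_) this.tsum_eq
  exact (hT _).trans (hφ.inner_borelFC hA _)

/-- On [k, k + 1) the Poisson kernel at k + i is at least 1/2, so |⟨x, Tx⟩| ≤ 2∑ c_k ‖(A - k -
i)⁻¹Xx‖². The decay of φ and the bound on the Hilbert–Schmidt norms, uniform in `k`, make this
summable. -/
lemma isTraceClass_of_hsq_le (hA : IsSelfAdjoint A) (hφ : IsTestFunction φ) (X : K →L[ℂ] H)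
    {C : ℝ≥0} (hC : ∀ k : ℝ, hsq (resolv A ⟨k, 1⟩ ∘L X) ≤ C) (T : K →L[ℂ] K)
    (hT : ∀ x, inner ℂ x (T x) = inner ℂ (X x) (borelFC A φ (X x))) : IsTraceClass T := by
  obtain ⟨c, hc, h⟩ := hφ.decay
  have hc0 : ∀ k, 0 ≤ c k := fun k => by
    have := h (k : ℝ); rw [Int.floor_intCast] at this; exact (norm_nonneg _).trans this
  refine isTraceClass_of_quadratic T (fun k : ℤ => 2 * ENNReal.ofReal (c k))
    (fun k : ℤ => resolv A ⟨k, 1⟩ ∘L X) (fun x => ?_) ?_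
  · rw [hT, hφ.inner_borelFC hA]
    refine (enorm_integral_le_lintegral_enorm _).trans ?_
    rw [← setLIntegral_univ, ← iUnion_Ico_intCast ℝ,
      lintegral_iUnion (fun _ => measurableSet_Ico) (pairwise_disjoint_Ico_intCast ℝ)]
    refine ENNReal.tsum_le_tsum fun k => ?_
    calc ∫⁻ t in Ico (k : ℝ) (k + 1), ‖φ t‖ₑ ∂(specMeasure A (X x))
        ≤ ∫⁻ _ in Ico (k : ℝ) (k + 1), ENNReal.ofReal (c k) ∂(specMeasure A (X x)) := by
          refine setLIntegral_mono measurable_const fun t ht => ?_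
          have h1 := h t
          rw [Int.floor_eq_iff.2 ht, ← ofReal_norm] at *
          exact ENNReal.ofReal_le_ofReal h1
      _ = ENNReal.ofReal (c k) * specMeasure A (X x) (Ico (k : ℝ) (k + 1)) :=
          setLIntegral_const _ _
      _ ≤ ENNReal.ofReal (c k) * (2 * (ENNReal.ofReal 1 * ‖resolv A ⟨k, 1⟩ (X x)‖ₑ ^ 2)) := by
          gcongr
          exact (measure_Ico_le _ _).trans
            (by rw [lintegral_poisson_specMeasure hA _ _ one_pos])
      _ = 2 * ENNReal.ofReal (c k) * ‖(resolv A ⟨k, 1⟩ ∘L X) x‖ₑ ^ 2 := by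
          rw [ENNReal.ofReal_one, one_mul, ContinuousLinearMap.comp_apply]; ring
  · refine ne_top_of_le_ne_top (b := ∑' k, 2 * ENNReal.ofReal (c k) * C) ?_
      (ENNReal.tsum_le_tsum fun k => mul_le_mul' le_rfl (hC k))
    rw [ENNReal.tsum_mul_right, ENNReal.tsum_mul_left, ← ENNReal.ofReal_tsum_of_nonneg hc0 hc]
    finiteness

/-! ### Point masses -/

/-- The mass at `E` is the trace of the spectral projection, a contraction with values in the
eigenspace. -/
lemma traceMeasure_singleton_le (hA : IsSelfAdjoint A) (E : ℝ) (F : Submodule ℂ H)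
    [FiniteDimensional ℂ F] (hF : ∀ x, (x, (E : ℂ) • x) ∈ A.graph → x ∈ F) :
    traceMeasure A (ContinuousLinearMap.id ℂ H) {E} ≤ Module.finrank ℂ F := by
  have h1 := tsum_enorm_inner_le_of_range (stdBasis H) (pointProj A E) F
    fun x => hF _ (pointProj_mem_graph hA E x)
  have h2 : ‖pointProj A E‖ₑ ≤ 1 := by
    rw [← ofReal_norm, ← ENNReal.ofReal_one]
    exact ENNReal.ofReal_le_ofReal (norm_pointProj_le hA E)
  rw [traceMeasure, Measure.sum_apply _ (measurableSet_singleton E)]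
  refine le_trans (le_of_eq (tsum_congr fun i => ?_)) (h1.trans (mul_le_of_le_one_right' h2))
  rw [inner_pointProj_self hA, ContinuousLinearMap.id_apply, ← ofReal_norm, Complex.norm_real,
    Real.norm_of_nonneg measureReal_nonneg, Measure.real, ENNReal.ofReal_toReal (by finiteness)]

/-- The left side is the integral of y²/((t - E)² + y²), which decreases to the indicator of `E` as
y → 0 and is dominated by its value at y = 1. -/
lemma tendsto_sq_mul_hsq (hA : IsSelfAdjoint A) (X : K →L[ℂ] H) (E : ℝ)
    (hfin : hsq (resolv A ⟨E, 1⟩ ∘L X) ≠ ∞) :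
    Tendsto (fun n : ℕ => ENNReal.ofReal ((1 / ((n : ℝ) + 1)) ^ 2) *
      hsq (resolv A ⟨E, 1 / ((n : ℝ) + 1)⟩ ∘L X)) atTop (𝓝 (traceMeasure A X {E})) := by
  have hn : ∀ n : ℕ, (0 : ℝ) < 1 / ((n : ℝ) + 1) := fun n => by positivity
  have hn1 : ∀ n : ℕ, 1 / ((n : ℝ) + 1) ≤ 1 := fun n => by
    rw [div_le_one (by positivity)]; linarith [(Nat.cast_nonneg n : (0 : ℝ) ≤ n)]
  have h1 : ∀ n : ℕ, ENNReal.ofReal ((1 / ((n : ℝ) + 1)) ^ 2) *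
      hsq (resolv A ⟨E, 1 / ((n : ℝ) + 1)⟩ ∘L X) =
      ∫⁻ t, ENNReal.ofReal (1 / ((n : ℝ) + 1) * poisson E (1 / ((n : ℝ) + 1)) t)
        ∂(traceMeasure A X) := fun n => by
    simp_rw [ENNReal.ofReal_mul (hn n).le]
    rw [lintegral_const_mul' _ _ ENNReal.ofReal_ne_top,
      lintegral_poisson_traceMeasure hA X E (hn n), ← mul_assoc,
      ← ENNReal.ofReal_mul (hn n).le, ← sq]
  simp_rw [h1]
  have h2 : traceMeasure A X {E} = ∫⁻ t, indicator {E} 1 t ∂(traceMeasure A X) :=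
    (lintegral_indicator_one (measurableSet_singleton E)).symm
  rw [h2]
  refine tendsto_lintegral_of_dominated_convergence
    (fun t => ENNReal.ofReal (poisson E 1 t)) (fun n => ?_) (fun n => ae_of_all _ fun t => ?_) ?_
    (ae_of_all _ fun t => ?_)
  · exact ((continuous_poisson (hn n) E).measurable.const_mul _).ennreal_ofReal
  · refine ENNReal.ofReal_le_ofReal ?_
    have hδ := hn n
    have hδ1 := hn1 n
    set δ := 1 / ((n : ℝ) + 1)
    rw [poisson, poisson, mul_div_assoc', div_le_div_iff₀ (by positivity) (by positivity)]
    nlinarith [mul_nonneg (sq_nonneg (t - E)) (sub_nonneg.2 (pow_le_one₀ hδ.le hδ1 (n := 2)))]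
  · rw [lintegral_poisson_traceMeasure hA X E one_pos]
    finiteness
  · have h0 : Tendsto (fun n : ℕ => 1 / ((n : ℝ) + 1)) atTop (𝓝 0) :=
      tendsto_one_div_add_atTop_nhds_zero_nat
    by_cases ht : t = E
    · rw [indicator_of_mem (by exact ht)]
      refine tendsto_const_nhds.congr fun n => ?_
      have := (hn n).ne'
      rw [ht, poisson, sub_self, zero_pow two_ne_zero, zero_add, mul_div_assoc', ← sq,
        div_self (pow_ne_zero 2 this), ENNReal.ofReal_one]
      rfl
    · rw [indicator_of_notMem (by exact ht)]
      have h3 : (t - E) ^ 2 ≠ 0 := pow_ne_zero 2 (sub_ne_zero.2 ht)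
      have h4 : Tendsto (fun δ : ℝ => δ * poisson E δ t) (𝓝 0) (𝓝 (0 * (0 / ((t - E) ^ 2 + 0 ^ 2)))) := by
        refine tendsto_id.mul (tendsto_id.div ((tendsto_id.pow 2).const_add _) ?_)
        simpa using sub_ne_zero.2 ht
      rw [zero_mul] at h4
      have h5 := ENNReal.tendsto_ofReal (h4.comp h0)
      rw [ENNReal.ofReal_zero] at h5
      exact h5

end TraceMeasure
end RandomDirac
end

noncomputable section
set_option linter.unusedSectionVars false
namespace RandomDirac
open scoped ENNReal NNReal ComplexConjugate

/-! ### The potential -/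

section Potential

variable {Vper u : ℝ → Matrix (Fin 2) (Fin 2) ℝ}

/-- The support of `u` is a closed interval, so at half-integers two neighbouring translates may
overlap; hence two indices. -/
lemma eq_zero_of_notMem_pair (hsupp : ∀ x, x ∉ Icc (-1 / 2 : ℝ) (1 / 2) → u x = 0) (x : ℝ) (n : ℤ)
    (hn : n ∉ ({⌊x + 1 / 2⌋ - 1, ⌊x + 1 / 2⌋} : Finset ℤ)) : u (x - n) = 0 := by
  refine hsupp _ fun h => hn ?_
  have h1 := Int.floor_le (x + 1 / 2)
  have h2 := Int.lt_floor_add_one (x + 1 / 2)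
  have h3 : (n : ℝ) ≤ x + 1 / 2 := by linarith [h.1]
  have h4 : x + 1 / 2 ≤ n + 1 := by linarith [h.2]
  have h5 : n ≤ ⌊x + 1 / 2⌋ := Int.le_floor.2 h3
  have h6 : ⌊x + 1 / 2⌋ ≤ n + 1 := by
    have : (⌊x + 1 / 2⌋ : ℝ) ≤ ((n + 1 : ℤ) : ℝ) := by push_cast; linarith
    exact_mod_cast this
  simp only [Finset.mem_insert, Finset.mem_singleton]
  omega

lemma potential_eq (hsupp : ∀ x, x ∉ Icc (-1 / 2 : ℝ) (1 / 2) → u x = 0) (lam : ℤ → ℝ) (x : ℝ) :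
    potential Vper u lam x = Vper x +
      (lam (⌊x + 1 / 2⌋ - 1) • u (x - (⌊x + 1 / 2⌋ - 1 : ℤ)) +
        lam ⌊x + 1 / 2⌋ • u (x - (⌊x + 1 / 2⌋ : ℤ))) := by
  rw [potential, tsum_eq_sum (s := {⌊x + 1 / 2⌋ - 1, ⌊x + 1 / 2⌋}), Finset.sum_pair (by omega)]
  intro n hn
  rw [eq_zero_of_notMem_pair hsupp x n hn, smul_zero]

lemma exists_isBddPotential (hV : IsPotential Vper) (hu : IsPotential u)
    (hsupp : ∀ x, x ∉ Icc (-1 / 2 : ℝ) (1 / 2) → u x = 0) (M : ℝ) :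
    ∃ B, ∀ lam : ℤ → ℝ, (∀ n, |lam n| ≤ M) → IsBddPotential (potential Vper u lam) B := by
  obtain ⟨C₁, hC₁⟩ := hV.bounded
  obtain ⟨C₂, hC₂⟩ := hu.bounded
  refine ⟨C₁ + (M * C₂ + M * C₂), fun lam hlam => ⟨fun x => ?_, fun i j => ?_, fun x i j => ?_⟩⟩
  · rw [potential_eq hsupp]
    exact (hV.symm _).add (((hu.symm _).smul _).add ((hu.symm _).smul _))
  · simp_rw [potential_eq hsupp]
    simp only [Matrix.add_apply, Matrix.smul_apply, smul_eq_mul]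
    have hfl : Measurable fun x : ℝ => ⌊x + 1 / 2⌋ :=
      Int.measurable_floor.comp (measurable_id.add_const _)
    have hl : ∀ f : ℤ → ℝ, Measurable f := fun f => measurable_from_top
    refine (hV.measurable i j).add (Measurable.add ?_ ?_)
    · exact ((hl fun k => lam (k - 1)).comp hfl).mul ((hu.measurable i j).comp
        (measurable_id.sub ((hl fun k => ((k - 1 : ℤ) : ℝ)).comp hfl)))
    · exact ((hl lam).comp hfl).mul ((hu.measurable i j).comp
        (measurable_id.sub ((hl fun k => (k : ℝ)).comp hfl)))
  · have hM : 0 ≤ M := (abs_nonneg _).trans (hlam 0)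
    rw [potential_eq hsupp]
    simp only [Matrix.add_apply, Matrix.smul_apply, smul_eq_mul]
    have h1 : ∀ n y, |lam n * u y i j| ≤ M * C₂ := fun n y => by
      rw [abs_mul]
      exact mul_le_mul (hlam n) (hC₂ _ _ _) (abs_nonneg _) hM
    exact (abs_add_le _ _).trans (add_le_add (hC₁ _ _ _) ((abs_add_le _ _).trans
      (add_le_add (h1 _ _) (h1 _ _))))

lemma potential_sub_le (hu : IsPotential u)
    (hsupp : ∀ x, x ∉ Icc (-1 / 2 : ℝ) (1 / 2) → u x = 0) :
    ∃ C, 0 ≤ C ∧ ∀ (lam lam' : ℤ → ℝ) (δ : ℝ), (∀ n, |lam n - lam' n| ≤ δ) → ∀ x i j,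
      |potential Vper u lam x i j - potential Vper u lam' x i j| ≤ C * δ := by
  obtain ⟨C₂, hC₂⟩ := hu.bounded
  have hC0 : 0 ≤ C₂ := (abs_nonneg _).trans (hC₂ 0 0 0)
  refine ⟨2 * C₂, by positivity, fun lam lam' δ h x i j => ?_⟩
  have hδ : 0 ≤ δ := (abs_nonneg _).trans (h 0)
  rw [potential_eq hsupp, potential_eq hsupp]
  simp only [Matrix.add_apply, Matrix.smul_apply, smul_eq_mul]
  have h1 : ∀ n y, |(lam n - lam' n) * u y i j| ≤ δ * C₂ := fun n y => by
    rw [abs_mul]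
    exact mul_le_mul (h n) (hC₂ _ _ _) (abs_nonneg _) hδ
  have h2 := (abs_add_le _ _).trans (add_le_add
    (h1 (⌊x + 1 / 2⌋ - 1) (x - (⌊x + 1 / 2⌋ - 1 : ℤ))) (h1 ⌊x + 1 / 2⌋ (x - (⌊x + 1 / 2⌋ : ℤ))))
  refine le_trans (le_of_eq ?_) (h2.trans (le_of_eq (by ring)))
  congr 1
  ring

lemma potential_translate (hper : Function.Periodic Vper 1) (lam : ℤ → ℝ) (x : ℝ) (k : ℤ) :
    potential Vper u lam (x + k) = potential Vper u (fun n => lam (n + k)) x := by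
  rw [potential, potential]
  congr 1
  · have := hper.int_mul k x
    rwa [mul_one] at this
  · rw [← (Equiv.addRight k).tsum_eq]
    refine tsum_congr fun n => ?_
    simp only [Equiv.coe_addRight]
    congr 2
    push_cast; ring

/-- In the open interval only the translates of `u` by 0, …, ℓ - 1 are seen; the supports of the
others reach at most its end points. -/
lemma potential_congr_of_mem_Ioo (hsupp : ∀ x, x ∉ Icc (-1 / 2 : ℝ) (1 / 2) → u x = 0)
    {lam lam' : ℤ → ℝ} {ℓ : ℕ} (h : ∀ n : ℤ, 0 ≤ n → n < ℓ → lam n = lam' n) {x : ℝ}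
    (hx : x ∈ Ioo (-1 / 2 : ℝ) (ℓ - 1 / 2)) : potential Vper u lam x = potential Vper u lam' x := by
  rw [potential, potential]
  congr 1
  refine tsum_congr fun n => ?_
  by_cases hn : 0 ≤ n ∧ n < ℓ
  · rw [h n hn.1 hn.2]
  · have : u (x - n) = 0 := by
      refine hsupp _ fun hm => hn ⟨?_, ?_⟩
      · have h1 : ((-1 : ℤ) : ℝ) < n := by push_cast; linarith [hm.2, hx.1]
        have := Int.cast_lt.1 h1
        omega
      · have h1 : (n : ℝ) < (ℓ : ℤ) := by push_cast; linarith [hm.1, hx.2]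
        exact Int.cast_lt.1 h1
    rw [this, smul_zero, smul_zero]

end Potential

/-! ### Dependence of the resolvent on the potential -/

section Dependence

variable {W W' : ℝ → Matrix (Fin 2) (Fin 2) ℝ} {B B' : ℝ}

lemma diracBox_congr {L : ℝ} (h : ∀ x ∈ Ioo (-(L / 2)) (L / 2), W x = W' x) :
    diracBox L W = diracBox L W' := by
  have hae : ∀ᵐ x ∂(boxMeasure L), W x = W' x :=
    (ae_restrict_mem measurableSet_Ioo).mono h
  rw [diracBox, diracBox]
  congr 1
  ext p
  constructor
  · rintro ⟨f, g, h1, h2, h3, h4⟩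
    refine ⟨f, g, h1, h2, h3, ?_⟩
    filter_upwards [h4, hae] with x hx hx'
    rw [hx, hx']
  · rintro ⟨f, g, h1, h2, h3, h4⟩
    refine ⟨f, g, h1, h2, h3, ?_⟩
    filter_upwards [h4, hae] with x hx hx'
    rw [hx, hx']

/-- The second resolvent identity R - R' = -R(W - W')R'; the two operators have the same domain. -/
lemma norm_resolv_sub_le (hW : IsBddPotential W B) (hW' : IsBddPotential W' B') {L : ℝ}
    (hL : 0 < L) {z : ℂ} (hz : z.im ≠ 0) {δ : ℝ} (h : ∀ x i j, |W x i j - W' x i j| ≤ δ)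
    (v : Spinor (boxMeasure L)) :
    ‖resolv (diracBox L W) z v - resolv (diracBox L W') z v‖ ≤
      |z.im|⁻¹ * (4 * δ * (|z.im|⁻¹ * ‖v‖)) := by
  have hab : -(L / 2) < L / 2 := by linarith
  have hs := isIntervalMeasure_Icc hab
  obtain ⟨hA, hgr⟩ := diracBox_isSelfAdjoint hW hL
  obtain ⟨hA', hgr'⟩ := diracBox_isSelfAdjoint hW' hL
  set R := resolv (diracBox L W) z
  set R' := resolv (diracBox L W') z
  have h1 := (isResolvent_resolv hA' hz).1 v
  rw [hgr'] at h1
  obtain ⟨f, g, hf⟩ := exists_isRep hs h1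
  let D : ℝ → Matrix (Fin 2) (Fin 2) ℝ := fun x => W x - W' x
  have hD : IsBddPotential D δ :=
    ⟨fun x => (hW.symm x).sub (hW'.symm x),
      fun i j => (hW.measurable i j).sub (hW'.measurable i j), h⟩
  have hmem : MemLp (fun x => pot D x (R' v x)) 2 (boxMeasure L) := memLp_pot hD (Lp.memLp _)
  have hδ : 0 ≤ δ := (abs_nonneg _).trans (h 0 0 0)
  have hw : ‖hmem.toLp _‖ ≤ 4 * δ * ‖R' v‖ := by
    refine Lp.norm_le_mul_norm_of_ae_le_mul ?_
    filter_upwards [hmem.coeFn_toLp] with x hx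
    rw [hx]
    exact hD.norm_pot_le x _
  have h2 : (R' v, v + z • R' v + hmem.toLp _) ∈ (diracBox L W).graph := by
    rw [hgr]
    refine IsRep.mem hs (f := f) (g := g) ⟨hf.fst, hf.memLp, hf.prim, hf.bdry, ?_⟩
    filter_upwards [hf.fst, hf.snd, hmem.coeFn_toLp, Lp.coeFn_add (v + z • R' v) (hmem.toLp _)]
      with x e1 e2 e3 e4
    rw [e4, Pi.add_apply, e3, show (v + z • R' v) x = _ from e2, show R' v x = f x from e1,
      add_assoc]
    congr 1
    ext i
    simp only [PiLp.add_apply, pot_apply_coord, D, Matrix.sub_apply, Complex.ofReal_sub]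
    ring
  have h3 := (isResolvent_resolv hA hz).2 _ h2
  simp only at h3
  have h4 : v + z • R' v + hmem.toLp _ - z • R' v = v + hmem.toLp _ := by abel
  rw [h4, map_add] at h3
  have h5 : R v - R' v = -R (hmem.toLp _) := by
    rw [eq_neg_iff_add_eq_zero, sub_add_eq_add_sub, sub_eq_zero]; exact h3
  rw [h5, norm_neg]
  refine (norm_resolv_apply_le hA hz _).trans ?_
  gcongr
  exact hw.trans (by gcongr; exact norm_resolv_apply_le hA' hz v)

end Dependence
end RandomDirac
end

noncomputable section
set_option linter.unusedSectionVars false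
namespace RandomDirac
open scoped ENNReal NNReal ComplexConjugate

section Cells

/-! ### Cells of the random operator -/

variable {Vper u : ℝ → Matrix (Fin 2) (Fin 2) ℝ} {ℓ : ℕ}

/-- The extension by zero of a finite family of coupling constants. -/
def extendZero (θ : Fin ℓ → ℝ) (n : ℤ) : ℝ :=
  if h : 0 ≤ n ∧ n < ℓ then θ ⟨n.toNat, by omega⟩ else 0

lemma abs_extendZero_le {θ : Fin ℓ → ℝ} {M : ℝ} (hM : 0 ≤ M) (h : ∀ i, |θ i| ≤ M) (n : ℤ) :
    |extendZero θ n| ≤ M := by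
  rw [extendZero]
  split_ifs
  · exact h _
  · rwa [abs_zero]

lemma abs_extendZero_sub_le (θ θ' : Fin ℓ → ℝ) (n : ℤ) :
    |extendZero θ n - extendZero θ' n| ≤ dist θ θ' := by
  rw [extendZero, extendZero]
  split_ifs
  · exact dist_le_pi_dist θ θ' _
  · simp

/-- The operator on the cell of length `ℓ` with the coupling constants `θ`. -/
def cellOp (Vper u : ℝ → Matrix (Fin 2) (Fin 2) ℝ) (θ : Fin ℓ → ℝ) :
    Spinor (boxMeasure ℓ) →ₗ.[ℂ] Spinor (boxMeasure ℓ) :=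
  -- The shift places the cell at (-1/2, ℓ - 1/2), inside which exactly the couplings 0, …, ℓ - 1
  -- act.
  diracBox ℓ fun x => potential Vper u (extendZero θ) (x + ((ℓ : ℝ) - 1) / 2)

/-- By periodicity and the support condition, the operator on each cell is one fixed function of its
own block of couplings; this is what makes the cells independent and identically distributed. -/
lemma cellOp_eq (hper : Function.Periodic Vper 1)
    (hsupp : ∀ x, x ∉ Icc (-1 / 2 : ℝ) (1 / 2) → u x = 0) (lam : ℤ → ℝ) (j : ℤ) :
    (diracBox ℓ fun x => potential Vper u lam (x + (j * ℓ + ((ℓ : ℝ) - 1) / 2))) =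
      cellOp Vper u fun i : Fin ℓ => lam (j * ℓ + i) := by
  refine diracBox_congr fun x hx => ?_
  have h1 : x + (j * ℓ + ((ℓ : ℝ) - 1) / 2) = (x + ((ℓ : ℝ) - 1) / 2) + ((j * ℓ : ℤ) : ℝ) := by
    push_cast; ring
  rw [h1, potential_translate hper]
  refine potential_congr_of_mem_Ioo (ℓ := ℓ) hsupp (fun n hn hn' => ?_) ?_
  · rw [extendZero, dif_pos ⟨hn, hn'⟩]
    simp only
    congr 1
    rw [Int.toNat_of_nonneg hn]; ring
  · constructor <;> linarith [hx.1, hx.2]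

lemma isBddPotential_cell (hV : IsPotential Vper) (hu : IsPotential u)
    (hsupp : ∀ x, x ∉ Icc (-1 / 2 : ℝ) (1 / 2) → u x = 0) (θ : Fin ℓ → ℝ) :
    ∃ B, IsBddPotential (fun x => potential Vper u (extendZero θ) (x + ((ℓ : ℝ) - 1) / 2)) B := by
  obtain ⟨B, hB⟩ := exists_isBddPotential hV hu hsupp ‖θ‖
  exact ⟨B, (hB _ (abs_extendZero_le (norm_nonneg _) fun i => norm_le_pi_norm θ i)).translate _⟩

/-- Each term of the series is continuous in the couplings, so the sum is lower semicontinuous. -/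
lemma measurable_hsq_resolv_cellOp (hV : IsPotential Vper) (hu : IsPotential u)
    (hsupp : ∀ x, x ∉ Icc (-1 / 2 : ℝ) (1 / 2) → u x = 0) (hℓ : 0 < ℓ) {z : ℂ} (hz : z.im ≠ 0) :
    Measurable fun θ : Fin ℓ → ℝ => hsq (resolv (cellOp Vper u θ) z) := by
  refine LowerSemicontinuous.measurable (lowerSemicontinuous_tsum fun i =>
    Continuous.lowerSemicontinuous ?_)
  refine (ENNReal.continuous_pow 2).comp (continuous_enorm.comp ?_)
  obtain ⟨C, hC0, hC⟩ := potential_sub_le (Vper := Vper) hu hsupp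
  refine (LipschitzWith.of_dist_le_mul (K := Real.toNNReal (|z.im|⁻¹ * (4 * C * (|z.im|⁻¹ *
    ‖stdBasis (Spinor (boxMeasure ℓ)) i‖)))) fun θ θ' => ?_).continuous
  obtain ⟨B, hB⟩ := isBddPotential_cell hV hu hsupp θ
  obtain ⟨B', hB'⟩ := isBddPotential_cell hV hu hsupp θ'
  rw [dist_eq_norm]
  refine (norm_resolv_sub_le hB hB' (by exact_mod_cast hℓ) hz
    (fun x i j => hC _ _ _ (abs_extendZero_sub_le θ θ') _ i j) _).trans (le_of_eq ?_)
  rw [Real.coe_toNNReal _ (by positivity)]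
  ring

lemma hsq_resolv_cellOp_le (hV : IsPotential Vper) (hu : IsPotential u)
    (hsupp : ∀ x, x ∉ Icc (-1 / 2 : ℝ) (1 / 2) → u x = 0) (hℓ : 0 < ℓ) {M : ℝ} (hM : 0 ≤ M) :
    ∃ C : ℝ, 0 ≤ C ∧ ∀ (E y : ℝ) (θ : Fin ℓ → ℝ), y ≠ 0 → (∀ i, |θ i| ≤ M) →
      hsq (resolv (cellOp Vper u θ) ⟨E, y⟩) ≤ ENNReal.ofReal (C * (1 + (y ^ 2)⁻¹)) := by
  obtain ⟨B, hB⟩ := exists_isBddPotential hV hu hsupp M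
  have hL : (0 : ℝ) < ℓ := by exact_mod_cast hℓ
  have hB0 : 0 ≤ B := (abs_nonneg _).trans ((hB 0 fun _ => by simpa using hM).bound 0 0 0)
  refine ⟨2 * ((1 + (1 + 8 * B) * ℓ) + 4 * ℓ), by positivity, fun E y θ hy hθ => ?_⟩
  have hW := (hB _ (abs_extendZero_le hM hθ)).translate (((ℓ : ℝ) - 1) / 2)
  have hab : -((ℓ : ℝ) / 2) < ℓ / 2 := by linarith
  obtain ⟨hA, hgr⟩ := diracBox_isSelfAdjoint hW hL
  rw [cellOp, hsq_resolv_box hW hL (z := ⟨E, y⟩) hy]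
  refine (density_resolv_le (isIntervalMeasure_Icc hab) hW hA hgr E (neg_ne_zero.2 hy)
    (left_mem_Icc.2 hab.le) (right_mem_Icc.2 hab.le) hab).trans (ENNReal.ofReal_le_ofReal ?_)
  rw [neg_sq, sub_neg_eq_add, add_halves]
  have h1 : 0 ≤ (y ^ 2)⁻¹ := by positivity
  have h2 : 0 ≤ (1 + 8 * B) * ℓ := by positivity
  nlinarith [mul_nonneg hL.le h1]

end Cells

/-! ### The strong law for blocks of couplings. -/

section Blocks

variable {Ω : Type*} [MeasurableSpace Ω] {P : Measure Ω} [IsProbabilityMeasure P]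
  {lam : ℤ → Ω → ℝ} {ℓ : ℕ}

/-- The strong law of large numbers for functions of disjoint blocks of independent identically
distributed random variables. -/
lemma strong_law_blocks (hmeas : ∀ n, Measurable (lam n)) (hindep : iIndepFun lam P)
    (hident : ∀ n, IdentDistrib (lam n) (lam 0) P P) {G : (Fin ℓ → ℝ) → ℝ} (hG : Measurable G)
    (hint : Integrable (fun ω => G fun i => lam i ω) P) {k : ℕ → ℤ} (hk : Function.Injective k) :
    ∀ᵐ ω ∂P, Tendsto (fun n : ℕ =>
      (∑ j ∈ Finset.range n, G fun i => lam (k j * ℓ + i) ω) / n) atTop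
        (𝓝 (∫ ω, G fun i => lam i ω ∂P)) := by
  have hvec : ∀ a : ℤ, Measurable fun ω (i : Fin ℓ) => lam (a + i) ω := fun a =>
    measurable_pi_lambda _ fun i => hmeas _
  have hdist : ∀ a : ℤ, IdentDistrib (fun ω (i : Fin ℓ) => lam (a + i) ω)
      (fun ω (i : Fin ℓ) => lam i ω) P P := by
    have h1 : ∀ a : ℤ, P.map (fun ω (i : Fin ℓ) => lam (a + i) ω) =
        Measure.pi fun _ : Fin ℓ => P.map (lam 0) := by
      intro a
      have h2 := hindep.precomp (g := fun i : Fin ℓ => a + (i : ℤ)) fun i j hij => by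
        simpa [Fin.ext_iff] using hij
      rw [(iIndepFun_iff_map_fun_eq_pi_map fun i => (hmeas _).aemeasurable).1 h2]
      congr 1
      ext1 i
      exact (hident _).map_eq
    intro a
    refine ⟨(hvec a).aemeasurable, (by simpa using hvec 0 : Measurable _).aemeasurable, ?_⟩
    rw [h1 a]
    simpa using (h1 0).symm
  have hX : ∀ j, IdentDistrib (fun ω => G fun i => lam (k j * ℓ + i) ω)
      (fun ω => G fun i => lam i ω) P P := fun j => (hdist _).comp hG
  have h3 := strong_law_ae_real (μ := P) (fun j ω => G fun i => lam (k j * ℓ + i) ω)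
    ((hX 0).integrable_iff.2 hint) ?_ fun j => (hX j).trans (hX 0).symm
  · rwa [(hX 0).integral_eq] at h3
  · intro j j' hj
    -- The strong law needs only pairwise independence, which holds since distinct values of `k`
    -- give disjoint blocks.
    let S : ℤ → Finset ℤ := fun a => Finset.Ico (a * ℓ) (a * ℓ + ℓ)
    have hmem : ∀ a (i : Fin ℓ), a * ℓ + (i : ℤ) ∈ S a := fun a i =>
      Finset.mem_Ico.2 ⟨by omega, by have := i.2; omega⟩
    have hdisj : Disjoint (S (k j)) (S (k j')) := by
      rw [Finset.disjoint_left]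
      intro n hn hn'
      rw [Finset.mem_Ico] at hn hn'
      have hne := hk.ne hj
      rcases lt_or_gt_of_ne hne with h | h
      · have : (k j + 1) * (ℓ : ℤ) ≤ k j' * ℓ := by gcongr; omega
        linarith [hn.2, hn'.1]
      · have : (k j' + 1) * (ℓ : ℤ) ≤ k j * ℓ := by gcongr; omega
        linarith [hn.1, hn'.2]
    have hI := hindep.indepFun_finset _ _ hdisj hmeas
    let r : ∀ a, (S a → ℝ) → ℝ := fun a v => G fun i => v ⟨a * ℓ + i, hmem a i⟩
    have hr : ∀ a, Measurable (r a) := fun a =>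
      hG.comp (measurable_pi_lambda _ fun i => measurable_pi_apply _)
    exact hI.comp (hr (k j)) (hr (k j'))

end Blocks
end RandomDirac
end

noncomputable section
set_option linter.unusedSectionVars false
namespace RandomDirac
open scoped ENNReal NNReal ComplexConjugate

section Counting

/-! ### Decomposition of an interval into cells -/

instance {H : Type*} [NormedAddCommGroup H] [InnerProductSpace ℂ H] [CompleteSpace H]
    {μ : Measure ℝ} [IsLocallyFiniteMeasure μ] [NullSingletonClass μ] (T : H →L[ℂ] Spinor μ) : NullSingletonClass (density T) :=
  ⟨fun x => by
    rw [density_apply T (measurableSet_singleton x), ENNReal.tsum_eq_zero]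
    exact fun i => setLIntegral_measure_zero _ _ (measure_singleton x)⟩

variable {ν : Measure ℝ} {ℓ : ℕ}

/-- Pairing the cells j and -1 - j turns the two-sided decomposition into sums over ℕ, the form
required by the strong law. -/
lemma measure_Ico_eq_sum_cells (ν : Measure ℝ) (ℓ n : ℕ) :
    ν (Ico (-(n * ℓ : ℝ) - 1 / 2) (n * ℓ - 1 / 2)) = ∑ j ∈ Finset.range n,
      (ν (Ico (j * ℓ - 1 / 2) ((j + 1) * ℓ - 1 / 2)) +
        ν (Ico ((-1 - j : ℝ) * ℓ - 1 / 2) ((-1 - j + 1 : ℝ) * ℓ - 1 / 2))) := by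
  induction n with
  | zero => simp
  | succ n ih =>
    have hℓ : (0 : ℝ) ≤ ℓ := Nat.cast_nonneg _
    have hn : (0 : ℝ) ≤ n * ℓ := by positivity
    rw [Finset.sum_range_succ, ← ih]
    push_cast
    have h1 : Ico (-((n + 1 : ℝ) * ℓ) - 1 / 2) ((n + 1) * ℓ - 1 / 2) =
        Ico (-(n * ℓ : ℝ) - 1 / 2) (n * ℓ - 1 / 2) ∪
          (Ico (n * ℓ - 1 / 2) ((n + 1) * ℓ - 1 / 2) ∪
            Ico ((-1 - n : ℝ) * ℓ - 1 / 2) ((-1 - n + 1 : ℝ) * ℓ - 1 / 2)) := by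
      ext x
      simp only [mem_Ico, mem_union]
      constructor
      · rintro ⟨h1, h2⟩
        by_cases h3 : x < -(n * ℓ : ℝ) - 1 / 2
        · right; right; constructor <;> linarith
        · by_cases h4 : x < n * ℓ - 1 / 2
          · left; constructor <;> linarith
          · right; left; constructor <;> linarith
      · rintro (⟨h1, h2⟩ | ⟨h1, h2⟩ | ⟨h1, h2⟩) <;> constructor <;> linarith
    rw [h1, measure_union _ (measurableSet_Ico.union measurableSet_Ico),
      measure_union _ measurableSet_Ico]
    · rw [disjoint_left]
      rintro x ⟨h1, h2⟩ ⟨h3, h4⟩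
      linarith
    · rw [disjoint_left]
      rintro x ⟨h1, h2⟩ (⟨h3, h4⟩ | ⟨h3, h4⟩) <;> linarith

/-- Comparison of the mass of an interval with approximate masses of the cells. -/
lemma measure_Icc_cells [NullSingletonClass ν] (hℓ : 0 < ℓ) {L : ℝ} (hL : ℓ + 1 ≤ L) {D K : ℝ≥0∞}
    (hK : ∀ c d, -(L / 2) ≤ c → d ≤ L / 2 → d - c = ℓ + 1 → ν (Icc c d) ≤ K) {X : ℤ → ℝ≥0∞}
    (hX : ∀ j : ℤ, -(L / 2) ≤ j * ℓ - 1 / 2 → ((j : ℝ) + 1) * ℓ - 1 / 2 ≤ L / 2 →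
      ν (Icc (j * ℓ - 1 / 2) ((j + 1) * ℓ - 1 / 2)) ≤ X j + D ∧
        X j ≤ ν (Icc (j * ℓ - 1 / 2) ((j + 1) * ℓ - 1 / 2)) + D) :
    ν (Icc (-(L / 2)) (L / 2)) ≤ ∑ j ∈ Finset.range ⌊(2 * (ℓ : ℝ))⁻¹ * (L - 1)⌋₊,
        (X j + X (-1 - j)) + (2 * ⌊(2 * (ℓ : ℝ))⁻¹ * (L - 1)⌋₊ * D + 2 * K) ∧
      ∑ j ∈ Finset.range ⌊(2 * (ℓ : ℝ))⁻¹ * (L - 1)⌋₊, (X j + X (-1 - j)) ≤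
        ν (Icc (-(L / 2)) (L / 2)) + 2 * ⌊(2 * (ℓ : ℝ))⁻¹ * (L - 1)⌋₊ * D := by
  have hℓ' : (0 : ℝ) < ℓ := by exact_mod_cast hℓ
  -- The largest `n` with nℓ + 1/2 ≤ L/2. The extra 1/2 accounts for the cells being centred around
  -- -1/2 rather than 0.
  set n := ⌊(2 * (ℓ : ℝ))⁻¹ * (L - 1)⌋₊ with hn
  have h1 : (n : ℝ) * ℓ ≤ (L - 1) / 2 := by
    have : (n : ℝ) ≤ (2 * (ℓ : ℝ))⁻¹ * (L - 1) :=
      Nat.floor_le (mul_nonneg (by positivity) (by linarith))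
    calc (n : ℝ) * ℓ ≤ (2 * (ℓ : ℝ))⁻¹ * (L - 1) * ℓ := by gcongr
      _ = (L - 1) / 2 := by field_simp
  have h2 : (L - 1) / 2 < (n + 1) * ℓ := by
    have : (2 * (ℓ : ℝ))⁻¹ * (L - 1) < n + 1 := Nat.lt_floor_add_one _
    calc (L - 1) / 2 = (2 * (ℓ : ℝ))⁻¹ * (L - 1) * ℓ := by field_simp
      _ < _ := by gcongr
  have hnℓ : (0 : ℝ) ≤ n * ℓ := by positivity
  have hcell : ∀ j ∈ Finset.range n, (-(L / 2) ≤ ((j : ℤ) : ℝ) * ℓ - 1 / 2 ∧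
      (((j : ℤ) : ℝ) + 1) * ℓ - 1 / 2 ≤ L / 2) ∧ (-(L / 2) ≤ ((-1 - j : ℤ) : ℝ) * ℓ - 1 / 2 ∧
      (((-1 - j : ℤ) : ℝ) + 1) * ℓ - 1 / 2 ≤ L / 2) := by
    intro j hj
    have hj' : ((j : ℝ) + 1) * ℓ ≤ n * ℓ := by
      gcongr
      exact_mod_cast Finset.mem_range.1 hj
    have hj0 : 0 ≤ (j : ℝ) * ℓ := by positivity
    push_cast
    refine ⟨⟨by linarith, by linarith⟩, by linarith, by linarith⟩
  have hsum := measure_Ico_eq_sum_cells ν ℓ n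
  have hcard : ∀ D : ℝ≥0∞, ∑ j ∈ Finset.range n, (D + D) = 2 * n * D := fun D => by
    rw [Finset.sum_const, Finset.card_range, nsmul_eq_mul]; ring
  constructor
  · have hcov : Icc (-(L / 2)) (L / 2) ⊆ Ico (-(n * ℓ : ℝ) - 1 / 2) (n * ℓ - 1 / 2) ∪
        (Icc (-(L / 2)) (-(L / 2) + (ℓ + 1)) ∪ Icc (L / 2 - (ℓ + 1)) (L / 2)) := by
      rintro x ⟨hx1, hx2⟩
      by_cases h3 : x < -(n * ℓ : ℝ) - 1 / 2
      · right; left; constructor <;> linarith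
      · by_cases h4 : x < n * ℓ - 1 / 2
        · left; constructor <;> linarith
        · right; right; constructor <;> linarith
    refine (measure_mono hcov).trans ((measure_union_le _ _).trans ?_)
    rw [hsum, ← hcard, two_mul K, ← add_assoc (Finset.sum _ _) (Finset.sum _ _),
      ← Finset.sum_add_distrib]
    refine add_le_add (Finset.sum_le_sum fun j hj => ?_) ((measure_union_le _ _).trans
      (add_le_add (hK _ _ le_rfl (by linarith) (by ring))
        (hK _ _ (by linarith) le_rfl (by ring))))
    obtain ⟨⟨a1, a2⟩, b1, b2⟩ := hcell j hj
    have c1 := (hX _ a1 a2).1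
    have c2 := (hX _ b1 b2).1
    push_cast at c1 c2
    rw [add_add_add_comm]
    exact add_le_add ((measure_mono Ico_subset_Icc_self).trans c1)
      ((measure_mono Ico_subset_Icc_self).trans c2)
  · have hsub : Ico (-(n * ℓ : ℝ) - 1 / 2) (n * ℓ - 1 / 2) ⊆ Icc (-(L / 2)) (L / 2) := by
      rintro x ⟨hx1, hx2⟩
      constructor <;> linarith
    refine le_trans ?_ (add_le_add (measure_mono hsub) le_rfl)
    rw [hsum, ← hcard, ← Finset.sum_add_distrib]
    refine Finset.sum_le_sum fun j hj => ?_
    obtain ⟨⟨a1, a2⟩, b1, b2⟩ := hcell j hj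
    have c1 := (hX _ a1 a2).2
    have c2 := (hX _ b1 b2).2
    push_cast at c1 c2
    rw [add_add_add_comm, measure_congr (Ico_ae_eq_Icc (μ := ν)),
      measure_congr (Ico_ae_eq_Icc (μ := ν))]
    exact add_le_add c1 c2

lemma abs_toReal_sub_le {N S : ℝ≥0∞} {a b : ℝ} (ha : 0 ≤ a) (hab : a ≤ b) (hS : S ≠ ∞)
    (h1 : N ≤ S + ENNReal.ofReal b) (h2 : S ≤ N + ENNReal.ofReal a) :
    |N.toReal - S.toReal| ≤ b := by
  have hN : N ≠ ∞ := ne_top_of_le_ne_top (by finiteness) h1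
  have h3 := ENNReal.toReal_mono (by finiteness) h1
  have h4 := ENNReal.toReal_mono (by finiteness) h2
  rw [ENNReal.toReal_add (by finiteness) (by finiteness),
    ENNReal.toReal_ofReal (by linarith)] at h3 h4
  rw [abs_le]
  constructor <;> linarith

variable {μ : Measure ℝ} {s bdry : Set ℝ} {W : ℝ → Matrix (Fin 2) (Fin 2) ℝ} {B : ℝ}

/-- Each of the 2n cells contributes one comparison error 4/(Im z)², and each end one term bounded
by `density_resolv_le` on an interval of length ℓ + 1. -/
lemma abs_density_sub_sum_cells_le [IsLocallyFiniteMeasure μ] [NullSingletonClass μ]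
    (hs : IsIntervalMeasure μ s) (hW : IsBddPotential W B)
    {A : Spinor μ →ₗ.[ℂ] Spinor μ} (hA : IsSelfAdjoint A) (hgr : A.graph = diracGraph μ s bdry W)
    {z : ℂ} (hz : z.im ≠ 0) (hℓ : 0 < ℓ) {L : ℝ} (hL : ℓ + 1 ≤ L)
    (hsub : Icc (-(L / 2)) (L / 2) ⊆ s) {x : ℤ → ℝ}
    (hx : ∀ j : ℤ, x j =
      (hsq (resolv (diracBox ℓ fun t => W (t + (j * ℓ + ((ℓ : ℝ) - 1) / 2))) z)).toReal) :
    |(density (resolv A (conj z)) (Icc (-(L / 2)) (L / 2))).toReal -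
      ∑ j ∈ Finset.range ⌊(2 * (ℓ : ℝ))⁻¹ * (L - 1)⌋₊, (x j + x (-1 - j))| ≤
    2 * ⌊(2 * (ℓ : ℝ))⁻¹ * (L - 1)⌋₊ * (4 / z.im ^ 2) +
      2 * (2 * ((1 + (1 + 8 * B) * (ℓ + 1)) * (z.im ^ 2)⁻¹ + 4 * (ℓ + 1))) := by
  have hB0 : 0 ≤ B := (abs_nonneg _).trans (hW.bound 0 0 0)
  have hℓ' : (0 : ℝ) < ℓ := by exact_mod_cast hℓ
  set n := ⌊(2 * (ℓ : ℝ))⁻¹ * (L - 1)⌋₊ with hn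
  set X : ℤ → ℝ≥0∞ := fun j =>
    hsq (resolv (diracBox ℓ fun t => W (t + (j * ℓ + ((ℓ : ℝ) - 1) / 2))) z) with hXdef
  have hfin : ∀ j, X j ≠ ∞ := by
    intro j
    have hW' := hW.translate (j * ℓ + ((ℓ : ℝ) - 1) / 2)
    have hab : -((ℓ : ℝ) / 2) < ℓ / 2 := by linarith
    obtain ⟨hA', hgr'⟩ := diracBox_isSelfAdjoint hW' hℓ'
    rw [hXdef]
    simp only
    rw [hsq_resolv_box hW' hℓ' hz]
    exact ne_top_of_le_ne_top ENNReal.ofReal_ne_top (density_resolv_le (isIntervalMeasure_Icc hab)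
      hW' hA' hgr' z.re (neg_ne_zero.2 hz) (left_mem_Icc.2 hab.le) (right_mem_Icc.2 hab.le) hab)
  have hsumfin : ∑ j ∈ Finset.range n, (X j + X (-1 - j)) ≠ ∞ :=
    ENNReal.sum_ne_top.2 fun j _ => ENNReal.add_ne_top.2 ⟨hfin _, hfin _⟩
  have hsum : ∑ j ∈ Finset.range n, (x j + x (-1 - j)) =
      (∑ j ∈ Finset.range n, (X j + X (-1 - j))).toReal := by
    rw [ENNReal.toReal_sum fun j _ => ENNReal.add_ne_top.2 ⟨hfin _, hfin _⟩]
    refine Finset.sum_congr rfl fun j _ => ?_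
    rw [hx, hx, ENNReal.toReal_add (hfin _) (hfin _)]
  have hmain := measure_Icc_cells (ν := density (resolv A (conj z))) hℓ hL
    (D := ENNReal.ofReal (4 / z.im ^ 2))
    (K := ENNReal.ofReal (2 * ((1 + (1 + 8 * B) * (ℓ + 1)) * (z.im ^ 2)⁻¹ + 4 * (ℓ + 1))))
    (X := X) (fun c d hc hd hcd => ?_) (fun j hj hj' => ?_)
  · rw [hsum]
    have e1 : 2 * (n : ℝ≥0∞) * ENNReal.ofReal (4 / z.im ^ 2) =
        ENNReal.ofReal (2 * n * (4 / z.im ^ 2)) := by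
      rw [ENNReal.ofReal_mul (by positivity), ENNReal.ofReal_mul (by positivity)]
      simp
    refine abs_toReal_sub_le (a := 2 * n * (4 / z.im ^ 2)) (by positivity)
      (le_add_of_nonneg_right (by positivity)) hsumfin ?_ ?_
    · refine hmain.1.trans (le_of_eq ?_)
      rw [ENNReal.ofReal_add (by positivity) (by positivity), e1]
      congr 2
      rw [ENNReal.ofReal_mul (p := 2) (by positivity)]
      simp
    · rw [← e1]; exact hmain.2
  · have h := density_resolv_le hs hW hA hgr z.re (neg_ne_zero.2 hz)
      (hsub ⟨hc, by linarith⟩) (hsub ⟨by linarith, hd⟩) (by linarith : c < d)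
    rwa [hcd, neg_sq] at h
  · have e1 : (j * ℓ + ((ℓ : ℝ) - 1) / 2) - ℓ / 2 = j * ℓ - 1 / 2 := by ring
    have e2 : (j * ℓ + ((ℓ : ℝ) - 1) / 2) + ℓ / 2 = (j + 1) * ℓ - 1 / 2 := by ring
    have h := density_comparison hs hW hA hgr hz (t := j * ℓ + ((ℓ : ℝ) - 1) / 2) hℓ'
      (by rw [e1, e2]; exact (Icc_subset_Icc hj hj').trans hsub)
    rwa [e1, e2] at h

/-- Averages over long intervals are determined by averages over cells, up to a small error. -/
lemma eventually_abs_div_sub_le (hℓ : 0 < ℓ) {N : ℝ → ℝ} {x : ℤ → ℝ} {D K m : ℝ}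
    (hD : 0 < D)
    (h : ∀ L : ℝ, ℓ + 1 ≤ L →
      |N L - ∑ j ∈ Finset.range ⌊(2 * (ℓ : ℝ))⁻¹ * (L - 1)⌋₊, (x j + x (-1 - j))| ≤
        2 * ⌊(2 * (ℓ : ℝ))⁻¹ * (L - 1)⌋₊ * D + K)
    (h1 : Tendsto (fun n : ℕ => (∑ j ∈ Finset.range n, x j) / n) atTop (𝓝 m))
    (h2 : Tendsto (fun n : ℕ => (∑ j ∈ Finset.range n, x (-1 - j)) / n) atTop (𝓝 m)) :
    ∀ᶠ L in atTop, |N L / L - m / ℓ| ≤ 2 * D / ℓ := by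
  have hℓ' : (0 : ℝ) < ℓ := by exact_mod_cast hℓ
  set n : ℝ → ℕ := fun L => ⌊(2 * (ℓ : ℝ))⁻¹ * (L - 1)⌋₊ with hn
  have hsub1 : Tendsto (fun L : ℝ => L - 1) atTop atTop := tendsto_atTop_add_const_right _ _ tendsto_id
  have hnL : Tendsto (fun L => (n L : ℝ) / L) atTop (𝓝 (2 * (ℓ : ℝ))⁻¹) := by
    have h3 : Tendsto (fun L => (n L : ℝ) / (L - 1)) atTop (𝓝 (2 * (ℓ : ℝ))⁻¹) :=
      (tendsto_nat_floor_mul_div_atTop (a := (2 * (ℓ : ℝ))⁻¹) (by positivity)).comp hsub1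
    have h4 : Tendsto (fun L : ℝ => 1 - L⁻¹) atTop (𝓝 (1 - 0)) :=
      tendsto_const_nhds.sub tendsto_inv_atTop_zero
    have h5 := h3.mul h4
    rw [sub_zero, mul_one] at h5
    refine h5.congr' ?_
    filter_upwards [eventually_gt_atTop 1] with L hL
    have h6 : L - 1 ≠ 0 := by linarith
    have h7 : L ≠ 0 := by linarith
    field_simp
  have hnat : Tendsto n atTop atTop :=
    tendsto_nat_floor_atTop.comp (hsub1.const_mul_atTop (by positivity))
  have hS : Tendsto (fun L => (∑ j ∈ Finset.range (n L), (x j + x (-1 - j))) / L) atTop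
      (𝓝 (m / ℓ)) := by
    have h3 := ((h1.add h2).comp hnat).mul hnL
    have e : (m + m) * (2 * (ℓ : ℝ))⁻¹ = m / ℓ := by field_simp; ring
    rw [e] at h3
    refine h3.congr' ?_
    filter_upwards [eventually_gt_atTop 0] with L hL
    simp only [Function.comp_apply, Finset.sum_add_distrib]
    rcases Nat.eq_zero_or_pos (n L) with h0 | h0
    · simp [h0]
    · have : (0 : ℝ) < n L := by exact_mod_cast h0
      field_simp
  have hE : Tendsto (fun L => (2 * n L * D + K) / L) atTop (𝓝 (D / ℓ)) := by
    have h3 := (hnL.const_mul (2 * D)).add (tendsto_inv_atTop_zero.const_mul K)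
    have e : 2 * D * (2 * (ℓ : ℝ))⁻¹ + K * 0 = D / ℓ := by field_simp; ring
    rw [e] at h3
    refine h3.congr fun L => ?_
    ring
  have hlim := hE.add (hS.sub_const (m / ℓ)).abs
  rw [sub_self, abs_zero, add_zero] at hlim
  -- The limiting error is D/ℓ; doubling it leaves room for an eventual inequality.
  have hlt : D / ℓ < 2 * D / ℓ := by gcongr; linarith
  filter_upwards [hlim.eventually_le_const hlt, eventually_ge_atTop ((ℓ : ℝ) + 1)] with L hL hL'
  have hL0 : 0 < L := by linarith
  refine le_trans ?_ hL
  have e : N L / L - m / ℓ = (N L - ∑ j ∈ Finset.range (n L), (x j + x (-1 - j))) / L +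
      ((∑ j ∈ Finset.range (n L), (x j + x (-1 - j))) / L - m / ℓ) := by ring
  rw [e]
  refine (abs_add_le _ _).trans ?_
  gcongr
  rw [abs_div, abs_of_pos hL0]
  gcongr
  exact h L hL'

end Counting
end RandomDirac
end

noncomputable section
set_option linter.unusedSectionVars false
namespace RandomDirac
open scoped ENNReal NNReal ComplexConjugate

/-! ### Point masses of the cell operators. -/

section Atoms

variable {Vper u : ℝ → Matrix (Fin 2) (Fin 2) ℝ} {ℓ : ℕ}

/-- Eigenvectors are solutions of the homogeneous equation; the boundary conditions are simply
dropped. -/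
lemma traceMeasure_cellOp_singleton_le (hV : IsPotential Vper) (hu : IsPotential u)
    (hsupp : ∀ x, x ∉ Icc (-1 / 2 : ℝ) (1 / 2) → u x = 0) (hℓ : 0 < ℓ) (θ : Fin ℓ → ℝ) (E : ℝ) :
    traceMeasure (cellOp Vper u θ) (ContinuousLinearMap.id ℂ _) {E} ≤ 2 := by
  obtain ⟨B, hB⟩ := isBddPotential_cell hV hu hsupp θ
  have hL : (0 : ℝ) < ℓ := by exact_mod_cast hℓ
  have hab : -((ℓ : ℝ) / 2) < ℓ / 2 := by linarith
  obtain ⟨hA, hgr⟩ := diracBox_isSelfAdjoint hB hL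
  obtain ⟨hfd, hrank⟩ := solutions_finite hab hB E
  refine (traceMeasure_singleton_le hA E _ fun x hx => ?_).trans (by exact_mod_cast hrank)
  rw [hgr] at hx
  exact mem_solutions.2 (diracGraph_mono (empty_subset _) hx)

variable {Ω : Type*} [MeasurableSpace Ω] {P : Measure Ω} [IsProbabilityMeasure P]
  {lam : ℤ → Ω → ℝ}

lemma measurable_toReal_hsq_cellOp (hV : IsPotential Vper) (hu : IsPotential u)
    (hsupp : ∀ x, x ∉ Icc (-1 / 2 : ℝ) (1 / 2) → u x = 0) (hmeas : ∀ n, Measurable (lam n))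
    (hℓ : 0 < ℓ) {z : ℂ} (hz : z.im ≠ 0) :
    Measurable fun ω => (hsq (resolv (cellOp Vper u fun i : Fin ℓ => lam i ω) z)).toReal :=
  ((measurable_hsq_resolv_cellOp hV hu hsupp hℓ hz).comp
    (measurable_pi_lambda _ fun _ => hmeas _)).ennreal_toReal

lemma integrable_toReal_hsq_cellOp (hV : IsPotential Vper) (hu : IsPotential u)
    (hsupp : ∀ x, x ∉ Icc (-1 / 2 : ℝ) (1 / 2) → u x = 0) (hmeas : ∀ n, Measurable (lam n))
    {M : ℝ} (hM : 0 ≤ M) (hbdd : ∀ᵐ ω ∂P, ∀ n, |lam n ω| ≤ M) (hℓ : 0 < ℓ) {z : ℂ}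
    (hz : z.im ≠ 0) :
    Integrable (fun ω => (hsq (resolv (cellOp Vper u fun i : Fin ℓ => lam i ω) z)).toReal) P := by
  obtain ⟨C, hC0, hC⟩ := hsq_resolv_cellOp_le hV hu hsupp hℓ hM
  refine Integrable.of_bound
    (measurable_toReal_hsq_cellOp hV hu hsupp hmeas hℓ hz).aestronglyMeasurable
    (C * (1 + (z.im ^ 2)⁻¹)) ?_
  filter_upwards [hbdd] with ω hω
  rw [Real.norm_of_nonneg ENNReal.toReal_nonneg]
  exact ENNReal.toReal_le_of_le_ofReal (by positivity) (hC z.re z.im _ hz fun i => hω _)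

/-- The average number of eigenvalues of a cell close to a given energy is bounded, independently
of the length of the cell. -/
lemma exists_sq_mul_integral_le (hV : IsPotential Vper) (hu : IsPotential u)
    (hsupp : ∀ x, x ∉ Icc (-1 / 2 : ℝ) (1 / 2) → u x = 0) (hmeas : ∀ n, Measurable (lam n))
    {M : ℝ} (hM : 0 ≤ M) (hbdd : ∀ᵐ ω ∂P, ∀ n, |lam n ω| ≤ M) (hℓ : 0 < ℓ) (E : ℝ) :
    ∃ n : ℕ, (1 / ((n : ℝ) + 1)) ^ 2 * ∫ ω, (hsq (resolv
      (cellOp Vper u fun i : Fin ℓ => lam i ω) ⟨E, 1 / ((n : ℝ) + 1)⟩)).toReal ∂P ≤ 3 := by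
  obtain ⟨C, hC0, hC⟩ := hsq_resolv_cellOp_le hV hu hsupp hℓ hM
  have hL : (0 : ℝ) < ℓ := by exact_mod_cast hℓ
  have hn : ∀ n : ℕ, (0 : ℝ) < 1 / ((n : ℝ) + 1) := fun n => by positivity
  have hn1 : ∀ n : ℕ, 1 / ((n : ℝ) + 1) ≤ 1 := fun n => by
    rw [div_le_one (by positivity)]; linarith [(Nat.cast_nonneg n : (0 : ℝ) ≤ n)]
  let f : Ω → ℝ := fun ω => (traceMeasure (cellOp Vper u fun i : Fin ℓ => lam i ω)
    (ContinuousLinearMap.id ℂ _) {E}).toReal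
  have hlim : Tendsto (fun n : ℕ => ∫ ω, (1 / ((n : ℝ) + 1)) ^ 2 * (hsq (resolv
      (cellOp Vper u fun i : Fin ℓ => lam i ω) ⟨E, 1 / ((n : ℝ) + 1)⟩)).toReal ∂P) atTop
      (𝓝 (∫ ω, f ω ∂P)) := by
    -- With δ = 1/(n+1) ≤ 1, the energy-independent bound gives δ²·C(1 + δ⁻²) ≤ 2C.
    refine tendsto_integral_of_dominated_convergence (fun _ => 2 * C) (fun n => ?_)
      (integrable_const _) (fun n => ?_) ?_
    · exact ((measurable_toReal_hsq_cellOp hV hu hsupp hmeas hℓ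
        (z := ⟨E, 1 / ((n : ℝ) + 1)⟩) (hn n).ne').const_mul _).aestronglyMeasurable
    · filter_upwards [hbdd] with ω hω
      have h1 := ENNReal.toReal_le_of_le_ofReal (by positivity)
        (hC E (1 / ((n : ℝ) + 1)) (fun i : Fin ℓ => lam i ω) (hn n).ne' fun i => hω _)
      have hδ := hn n
      have hδ1 := hn1 n
      set δ := 1 / ((n : ℝ) + 1)
      rw [Real.norm_of_nonneg (mul_nonneg (by positivity) ENNReal.toReal_nonneg)]
      calc _ ≤ δ ^ 2 * (C * (1 + (δ ^ 2)⁻¹)) := by gcongr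
        _ = C * (δ ^ 2 + 1) := by field_simp
        _ ≤ C * (1 + 1) := by gcongr; exact pow_le_one₀ hδ.le hδ1
        _ = 2 * C := by ring
    · filter_upwards [hbdd] with ω hω
      obtain ⟨B, hB⟩ := isBddPotential_cell hV hu hsupp fun i : Fin ℓ => lam i ω
      have h2 := tendsto_sq_mul_hsq (diracBox_isSelfAdjoint hB hL).1
        (ContinuousLinearMap.id ℂ _) E (ne_top_of_le_ne_top ENNReal.ofReal_ne_top
          (hC E 1 (fun i : Fin ℓ => lam i ω) one_ne_zero fun i => hω _))
      have h3 := (ENNReal.tendsto_toReal (ne_top_of_le_ne_top (by norm_num)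
        (traceMeasure_cellOp_singleton_le hV hu hsupp hℓ (fun i : Fin ℓ => lam i ω) E))).comp h2
      refine h3.congr fun n => ?_
      rw [Function.comp_apply, ENNReal.toReal_mul, ENNReal.toReal_ofReal (by positivity)]
      rfl
  -- The limit is at most 2, so the strict bound 3 is reached at some finite `n`.
  have hle : ∫ ω, f ω ∂P < 3 := by
    have h1 : ∫ ω, f ω ∂P ≤ ∫ _, (2 : ℝ) ∂P := by
      refine integral_mono_of_nonneg (ae_of_all _ fun ω => ENNReal.toReal_nonneg)
        (integrable_const _) (ae_of_all _ fun ω => ?_)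
      exact ENNReal.toReal_le_of_le_ofReal (by norm_num) (by
        simpa using traceMeasure_cellOp_singleton_le hV hu hsupp hℓ (fun i : Fin ℓ => lam i ω) E)
    have h2 : ∫ _, (2 : ℝ) ∂P = 2 := by simp
    linarith
  obtain ⟨n, hn⟩ := (hlim.eventually_le_const hle).exists
  exact ⟨n, by rwa [integral_const_mul] at hn⟩

end Atoms
end RandomDirac
end

noncomputable section
set_option linter.unusedSectionVars false
namespace RandomDirac
open scoped ENNReal NNReal ComplexConjugate

section FiniteVolume

/-! ### Finite volume approximations of the density of states -/

variable {W : ℝ → Matrix (Fin 2) (Fin 2) ℝ} {B : ℝ}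

/-- The measures `φ ↦ tr (χ_L φ(H) χ_L)` (if `b` is true) and `φ ↦ tr (φ(H_L))` (otherwise). -/
def countMeasure (W : ℝ → Matrix (Fin 2) (Fin 2) ℝ) (b : Bool) (L : ℝ) : Measure ℝ :=
  bif b then traceMeasure (diracLine W) (chi L)
  else traceMeasure (diracBox L W) (ContinuousLinearMap.id ℂ _)

/-- The squared Hilbert-Schmidt norms of the resolvents belonging to `countMeasure`. -/
def countHsq (W : ℝ → Matrix (Fin 2) (Fin 2) ℝ) (b : Bool) (L : ℝ) (z : ℂ) : ℝ≥0∞ :=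
  bif b then hsq (resolv (diracLine W) z ∘L chi L)
  else hsq (resolv (diracBox L W) z ∘L ContinuousLinearMap.id ℂ _)

lemma countHsq_le_of_im (hW : IsBddPotential W B) (b : Bool) {L : ℝ} (hL : 0 < L) (E : ℝ) {y : ℝ}
    (hy : y ≠ 0) : countHsq W b L ⟨E, y⟩ ≤
      ENNReal.ofReal (2 * ((1 + (1 + 8 * B) * L) * (y ^ 2)⁻¹ + 4 * L)) := by
  have hab : -(L / 2) < L / 2 := by linarith
  have e : L / 2 - -(L / 2) = L := by ring
  cases b with
  | true =>
    obtain ⟨hA, hgr⟩ := diracLine_isSelfAdjoint hW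
    rw [countHsq, cond_true, hsq_resolv_line hW L (z := ⟨E, y⟩) hy]
    have h := density_resolv_le isIntervalMeasure_univ hW hA hgr E (neg_ne_zero.2 hy)
      (mem_univ _) (mem_univ _) hab
    rwa [e, neg_sq] at h
  | false =>
    obtain ⟨hA, hgr⟩ := diracBox_isSelfAdjoint hW hL
    rw [countHsq, cond_false, ContinuousLinearMap.comp_id, hsq_resolv_box hW hL (z := ⟨E, y⟩) hy]
    have h := density_resolv_le (isIntervalMeasure_Icc hab) hW hA hgr E (neg_ne_zero.2 hy)
      (left_mem_Icc.2 hab.le) (right_mem_Icc.2 hab.le) hab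
    rwa [e, neg_sq] at h

lemma countHsq_le (hW : IsBddPotential W B) (b : Bool) {L : ℝ} (hL : 0 < L) (E : ℝ) :
    countHsq W b L ⟨E, 1⟩ ≤ ENNReal.ofReal (2 + (10 + 16 * B) * L) := by
  convert countHsq_le_of_im hW b hL E one_ne_zero using 2
  norm_num
  ring

lemma lintegral_poisson_countMeasure (hW : IsBddPotential W B) (b : Bool) {L : ℝ} (hL : 0 < L)
    (s : ℝ) {y : ℝ} (hy : 0 < y) :
    ∫⁻ t, ENNReal.ofReal (poisson s y t) ∂(countMeasure W b L) =
      ENNReal.ofReal y * countHsq W b L ⟨s, y⟩ := by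
  cases b with
  | true => exact lintegral_poisson_traceMeasure (diracLine_isSelfAdjoint hW).1 _ s hy
  | false => exact lintegral_poisson_traceMeasure (diracBox_isSelfAdjoint hW hL).1 _ s hy

lemma integral_poisson_countMeasure (hW : IsBddPotential W B) (b : Bool) {L : ℝ} (hL : 0 < L)
    (s : ℝ) {y : ℝ} (hy : 0 < y) :
    ∫ t, poisson s y t ∂(countMeasure W b L) = y * (countHsq W b L ⟨s, y⟩).toReal := by
  cases b with
  | true => exact integral_poisson_traceMeasure (diracLine_isSelfAdjoint hW).1 _ s hy
  | false => exact integral_poisson_traceMeasure (diracBox_isSelfAdjoint hW hL).1 _ s hy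

lemma unitBound_countMeasure (hW : IsBddPotential W B) (b : Bool) {L : ℝ} (hL : 0 < L)
    {a : ℝ≥0∞} {C : ℝ≥0} (hC : 2 * (a * ENNReal.ofReal (2 + (10 + 16 * B) * L)) ≤ C) :
    UnitBound C (a • countMeasure W b L) := by
  have h : ∀ k : ℝ, 2 * (a * countHsq W b L ⟨k, 1⟩) ≤ C := fun k =>
    le_trans (by gcongr; exact countHsq_le hW b hL k) hC
  cases b with
  | true => exact unitBound_of_hsq_le (diracLine_isSelfAdjoint hW).1 (chi L) rfl h
  | false =>
    exact unitBound_of_hsq_le (diracBox_isSelfAdjoint hW hL).1 (ContinuousLinearMap.id ℂ _) rfl h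

lemma exists_unitBound_countMeasure (hW : IsBddPotential W B) (b : Bool) {L : ℝ} (hL : 0 < L) :
    ∃ C : ℝ≥0, UnitBound C (countMeasure W b L) := by
  refine ⟨Real.toNNReal (2 * (2 + (10 + 16 * B) * L)), ?_⟩
  rw [← one_smul ℝ≥0∞ (countMeasure W b L)]
  refine unitBound_countMeasure hW b hL (le_of_eq ?_)
  rw [one_mul, ← ENNReal.ofReal, ENNReal.ofReal_mul zero_le_two, ENNReal.ofReal_ofNat]

lemma abs_countHsq_sub_sum_le (hW : IsBddPotential W B) (b : Bool) {z : ℂ} (hz : z.im ≠ 0)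
    {ℓ : ℕ} (hℓ : 0 < ℓ) {L : ℝ} (hL : ℓ + 1 ≤ L) {x : ℤ → ℝ}
    (hx : ∀ j : ℤ, x j =
      (hsq (resolv (diracBox ℓ fun t => W (t + (j * ℓ + ((ℓ : ℝ) - 1) / 2))) z)).toReal) :
    |(countHsq W b L z).toReal -
      ∑ j ∈ Finset.range ⌊(2 * (ℓ : ℝ))⁻¹ * (L - 1)⌋₊, (x j + x (-1 - j))| ≤
    2 * ⌊(2 * (ℓ : ℝ))⁻¹ * (L - 1)⌋₊ * (4 / z.im ^ 2) +
      2 * (2 * ((1 + (1 + 8 * B) * (ℓ + 1)) * (z.im ^ 2)⁻¹ + 4 * (ℓ + 1))) := by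
  have hℓ' : (0 : ℝ) < ℓ := by exact_mod_cast hℓ
  have hL0 : 0 < L := by linarith
  have hab : -(L / 2) < L / 2 := by linarith
  cases b with
  | true =>
    obtain ⟨hA, hgr⟩ := diracLine_isSelfAdjoint hW
    rw [countHsq, cond_true, hsq_resolv_line hW L hz]
    exact abs_density_sub_sum_cells_le isIntervalMeasure_univ hW hA hgr hz hℓ hL
      (subset_univ _) hx
  | false =>
    obtain ⟨hA, hgr⟩ := diracBox_isSelfAdjoint hW hL0
    rw [countHsq, cond_false, ContinuousLinearMap.comp_id, hsq_resolv_box hW hL0 hz]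
    exact abs_density_sub_sum_cells_le (isIntervalMeasure_Icc hab) hW hA hgr hz hℓ hL
      subset_rfl hx

variable {φ : ℝ → ℂ}

lemma inner_chi_borelFC (φ : ℝ → ℂ) (L : ℝ) (x : Spinor volume) :
    inner ℂ x ((chi L ∘L borelFC (diracLine W) φ ∘L chi L) x) =
      inner ℂ (chi L x) (borelFC (diracLine W) φ (chi L x)) := by
  conv_rhs => rw [← adjoint_chi L, ContinuousLinearMap.adjoint_inner_left, adjoint_chi]
  rfl

lemma isTraceClass_line (hW : IsBddPotential W B) (hφ : IsTestFunction φ) {L : ℝ} (hL : 0 < L) :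
    IsTraceClass (chi L ∘L borelFC (diracLine W) φ ∘L chi L) :=
  isTraceClass_of_hsq_le (diracLine_isSelfAdjoint hW).1 hφ (chi L)
    (C := Real.toNNReal (2 + (10 + 16 * B) * L)) (countHsq_le hW true hL) _
    (inner_chi_borelFC φ L)

lemma isTraceClass_box (hW : IsBddPotential W B) (hφ : IsTestFunction φ) {L : ℝ} (hL : 0 < L) :
    IsTraceClass (borelFC (diracBox L W) φ) :=
  isTraceClass_of_hsq_le (diracBox_isSelfAdjoint hW hL).1 hφ (ContinuousLinearMap.id ℂ _)
    (C := Real.toNNReal (2 + (10 + 16 * B) * L)) (countHsq_le hW false hL) _ fun _ => rfl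

lemma trace_line (hW : IsBddPotential W B) (hφ : IsTestFunction φ) {L : ℝ} (hL : 0 < L) :
    trace (chi L ∘L borelFC (diracLine W) φ ∘L chi L) = ∫ t, φ t ∂(countMeasure W true L) := by
  obtain ⟨C, hC⟩ := exists_unitBound_countMeasure hW true hL
  exact trace_eq_integral (diracLine_isSelfAdjoint hW).1 hφ (chi L) hC _ (inner_chi_borelFC φ L)

lemma trace_box (hW : IsBddPotential W B) (hφ : IsTestFunction φ) {L : ℝ} (hL : 0 < L) :
    trace (borelFC (diracBox L W) φ) = ∫ t, φ t ∂(countMeasure W false L) := by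
  obtain ⟨C, hC⟩ := exists_unitBound_countMeasure hW false hL
  exact trace_eq_integral (diracBox_isSelfAdjoint hW hL).1 hφ (ContinuousLinearMap.id ℂ _) hC _
    fun _ => rfl

end FiniteVolume

/-! ### Typical couplings and the common limit. -/

section DensityOfStates

variable {Vper u : ℝ → Matrix (Fin 2) (Fin 2) ℝ}

/-- The values of the coupling constants for which the density of states is shown to exist: they
are bounded by `M`, and the averages over blocks converge to the means `m`. -/
structure IsTypical (Vper u : ℝ → Matrix (Fin 2) (Fin 2) ℝ) (M : ℝ) (S : Set ℝ)
    (m : ℕ → ℂ → ℝ) (lam : ℤ → ℝ) : Prop where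
  bound : ∀ n, |lam n| ≤ M
  right : ∀ s ∈ S, ∀ n ℓ : ℕ, 0 < ℓ → Tendsto (fun N : ℕ => (∑ j ∈ Finset.range N,
    (hsq (resolv (cellOp Vper u fun i : Fin ℓ => lam ((j : ℤ) * ℓ + i))
      ⟨s, 1 / ((n : ℝ) + 1)⟩)).toReal) / N) atTop (𝓝 (m ℓ ⟨s, 1 / ((n : ℝ) + 1)⟩))
  left : ∀ s ∈ S, ∀ n ℓ : ℕ, 0 < ℓ → Tendsto (fun N : ℕ => (∑ j ∈ Finset.range N,
    (hsq (resolv (cellOp Vper u fun i : Fin ℓ => lam ((-1 - j : ℤ) * ℓ + i))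
      ⟨s, 1 / ((n : ℝ) + 1)⟩)).toReal) / N) atTop (𝓝 (m ℓ ⟨s, 1 / ((n : ℝ) + 1)⟩))

/-- The comparison value `m ℓ z / ℓ` depends neither on the couplings nor on `b`. This yields a
deterministic limit, equal for the line and for the box. -/
lemma IsTypical.eventually_abs_sub_le {M : ℝ} {S : Set ℝ} {m : ℕ → ℂ → ℝ} {lam : ℤ → ℝ}
    (h : IsTypical Vper u M S m lam) (hper : Function.Periodic Vper 1)
    (hsupp : ∀ x, x ∉ Icc (-1 / 2 : ℝ) (1 / 2) → u x = 0) {B : ℝ}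
    (hW : IsBddPotential (potential Vper u lam) B) (b : Bool) {s : ℝ} (hs : s ∈ S) (n : ℕ) {ℓ : ℕ}
    (hℓ : 0 < ℓ) :
    ∀ᶠ L in atTop, |(countHsq (potential Vper u lam) b L ⟨s, 1 / ((n : ℝ) + 1)⟩).toReal / L -
      m ℓ ⟨s, 1 / ((n : ℝ) + 1)⟩ / ℓ| ≤ 2 * (4 / (1 / ((n : ℝ) + 1)) ^ 2) / ℓ := by
  have hy : (0 : ℝ) < 1 / ((n : ℝ) + 1) := by positivity
  let x : ℤ → ℝ := fun j => (hsq (resolv (cellOp Vper u fun i : Fin ℓ => lam (j * ℓ + i))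
      ⟨s, 1 / ((n : ℝ) + 1)⟩)).toReal
  refine eventually_abs_div_sub_le hℓ (x := x) (by positivity) (fun L hL =>
    abs_countHsq_sub_sum_le hW b (z := ⟨s, 1 / ((n : ℝ) + 1)⟩) hy.ne' hℓ hL fun j => ?_)
    (h.right s hs n ℓ hℓ) (h.left s hs n ℓ hℓ)
  rw [cellOp_eq hper hsupp]

variable {Ω : Type*} [MeasurableSpace Ω] {P : Measure Ω} [IsProbabilityMeasure P]
  {lam : ℤ → Ω → ℝ}

/-- Countability of `S` lets the strong laws for all energies, heights, cell lengths and both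
directions hold simultaneously. -/
lemma ae_isTypical (hV : IsPotential Vper) (hu : IsPotential u)
    (hsupp : ∀ x, x ∉ Icc (-1 / 2 : ℝ) (1 / 2) → u x = 0) (hmeas : ∀ n, Measurable (lam n))
    (hindep : iIndepFun lam P) (hident : ∀ n, IdentDistrib (lam n) (lam 0) P P)
    {M : ℝ} (hM : 0 ≤ M) (hbdd : ∀ᵐ ω ∂P, ∀ n, |lam n ω| ≤ M) {S : Set ℝ} (hS : S.Countable) :
    ∀ᵐ ω ∂P, IsTypical Vper u M S (fun ℓ z => ∫ ω, (hsq (resolv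
      (cellOp Vper u fun i : Fin ℓ => lam i ω) z)).toReal ∂P) fun n => lam n ω := by
  have h1 : ∀ {k : ℕ → ℤ}, Function.Injective k → ∀ᵐ ω ∂P, ∀ s ∈ S, ∀ n ℓ : ℕ, 0 < ℓ →
      Tendsto (fun N : ℕ => (∑ j ∈ Finset.range N,
        (hsq (resolv (cellOp Vper u fun i : Fin ℓ => lam (k j * ℓ + i) ω)
          ⟨s, 1 / ((n : ℝ) + 1)⟩)).toReal) / N) atTop (𝓝 (∫ ω, (hsq (resolv
      (cellOp Vper u fun i : Fin ℓ => lam i ω) ⟨s, 1 / ((n : ℝ) + 1)⟩)).toReal ∂P)) := by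
    intro k hk
    refine (ae_ball_iff hS).2 fun s _ => ae_all_iff.2 fun n => ae_all_iff.2 fun ℓ =>
      eventually_imp_distrib_left.2 fun hℓ => ?_
    have hy : (⟨s, 1 / ((n : ℝ) + 1)⟩ : ℂ).im ≠ 0 := by
      have : (0 : ℝ) < 1 / ((n : ℝ) + 1) := by positivity
      exact this.ne'
    exact strong_law_blocks hmeas hindep hident
      (measurable_hsq_resolv_cellOp hV hu hsupp hℓ hy).ennreal_toReal
      (integrable_toReal_hsq_cellOp hV hu hsupp hmeas hM hbdd hℓ hy) hk
  filter_upwards [hbdd, h1 (k := fun j => (j : ℤ)) Nat.cast_injective,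
    h1 (k := fun j => -1 - (j : ℤ)) fun a b hab => by simpa using hab] with ω a1 a2 a3
  exact ⟨a1, a2, a3⟩

/-- The integrated density of states: there is a number which is the limit for all typical values
of the coupling constants. -/
lemma exists_tendsto_of_isTypical (hV : IsPotential Vper) (hper : Function.Periodic Vper 1)
    (hu : IsPotential u) (hsupp : ∀ x, x ∉ Icc (-1 / 2 : ℝ) (1 / 2) → u x = 0) {φ : ℝ → ℂ}
    (hφ : IsTestFunction φ) {M : ℝ} {S : Set ℝ} (hS : Dense S) (hS' : {x | ¬ ContinuousAt φ x} ⊆ S)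
    (hSZ : range ((↑) : ℤ → ℝ) ⊆ S) {m : ℕ → ℂ → ℝ} (hm : ∀ E, ∀ ℓ : ℕ, 0 < ℓ → ∃ n : ℕ,
      (1 / ((n : ℝ) + 1)) ^ 2 * m ℓ ⟨E, 1 / ((n : ℝ) + 1)⟩ ≤ 3) :
    ∃ ν : ℂ, ∀ lam : ℤ → ℝ, IsTypical Vper u M S m lam → ∀ b, Tendsto (fun L : ℝ =>
      1 / (L : ℂ) * ∫ t, φ t ∂(countMeasure (potential Vper u lam) b L)) atTop (𝓝 ν) := by
  obtain ⟨B, hB⟩ := exists_isBddPotential hV hu hsupp M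
  let ι := {lam : ℤ → ℝ // IsTypical Vper u M S m lam} × Bool
  have hW : ∀ p : ι, IsBddPotential (potential Vper u p.1.1) B := fun p => hB _ p.1.2.bound
  -- Convergence along the supremum of these filters is convergence L → ∞ to one and the same limit
  -- for every typical sequence and for both values of `b`. Running the argument once along `F`
  -- therefore yields both the independence of ω and the equality of the two limits.
  let F : Filter (ι × ℝ) := ⨆ p : ι, map (fun L => (p, L)) atTop
  have hF : ∀ {q : ι × ℝ → Prop}, (∀ p, ∀ᶠ L in atTop, q (p, L)) → ∀ᶠ i in F, q i := fun h =>
    eventually_iSup.2 fun p => h p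
  let mes : ι × ℝ → Measure ℝ := fun i =>
    ENNReal.ofReal (1 / i.2) • countMeasure (potential Vper u i.1.1.1) i.1.2 i.2
  have hint : ∀ (i : ι × ℝ) {E : Type} [NormedAddCommGroup E] [NormedSpace ℝ E] (f : ℝ → E),
      0 < i.2 → ∫ t, f t ∂(mes i) =
        (1 / i.2) • ∫ t, f t ∂(countMeasure (potential Vper u i.1.1.1) i.1.2 i.2) := by
    intro i E _ _ f hi
    rw [integral_smul_measure, ENNReal.toReal_ofReal (by positivity)]
  have hUB : ∃ C : ℝ≥0, ∀ᶠ i in F, UnitBound C (mes i) := by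
    refine ⟨Real.toNNReal (2 * (2 + (10 + 16 * B))), hF fun p => ?_⟩
    have hB0 : 0 ≤ B := (abs_nonneg _).trans ((hW p).bound 0 0 0)
    filter_upwards [eventually_ge_atTop 1] with L hL
    have hL0 : 0 < L := by linarith
    refine unitBound_countMeasure (hW p) p.2 hL0 ?_
    rw [← ENNReal.ofReal_mul (by positivity), ← ENNReal.ofReal_ofNat 2,
      ← ENNReal.ofReal_mul (by positivity)]
    refine ENNReal.ofReal_le_ofReal (mul_le_mul_of_nonneg_left ?_ zero_le_two)
    rw [one_div, inv_mul_le_iff₀ hL0]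
    nlinarith
  obtain ⟨C, hC⟩ := hUB
  have hP : ∀ s ∈ S, ∀ n : ℕ, ∃ ν, Tendsto (fun i => ∫ t, poisson s (1 / ((n : ℝ) + 1)) t ∂(mes i)) F
      (𝓝 ν) := by
    intro s hs n
    set y : ℝ := 1 / ((n : ℝ) + 1) with hy
    have hy0 : 0 < y := by positivity
    refine exists_tendsto_of_approx fun ε hε => ?_
    -- The Poisson integral is within y·2(4/y²)/ℓ of its cell mean; ℓ is chosen to make this less
    -- than ε.
    obtain ⟨ℓ, hℓ⟩ := exists_nat_gt (y * (2 * (4 / y ^ 2)) / ε)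
    have hℓ0 : (0 : ℝ) < ℓ := lt_of_le_of_lt (by positivity) hℓ
    refine ⟨y * (m ℓ ⟨s, y⟩ / ℓ), hF fun p => ?_⟩
    filter_upwards [p.1.2.eventually_abs_sub_le hper hsupp (hW p) p.2 hs n
      (by exact_mod_cast hℓ0 : 0 < ℓ), eventually_gt_atTop 0] with L hL hL0
    rw [hint _ _ hL0, integral_poisson_countMeasure (hW p) p.2 hL0 s hy0, smul_eq_mul]
    rw [← hy] at hL
    have e : 1 / L * (y * (countHsq (potential Vper u p.1.1) p.2 L ⟨s, y⟩).toReal) -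
        y * (m ℓ ⟨s, y⟩ / ℓ) = y * ((countHsq (potential Vper u p.1.1) p.2 L ⟨s, y⟩).toReal / L -
          m ℓ ⟨s, y⟩ / ℓ) := by ring
    rw [Real.norm_eq_abs, e, abs_mul, abs_of_pos hy0]
    calc _ ≤ y * (2 * (4 / y ^ 2) / ℓ) := by gcongr
      _ = y * (2 * (4 / y ^ 2)) / ℓ := by ring
      _ ≤ ε := by
        rw [div_le_iff₀ hℓ0]
        rw [div_lt_iff₀ hε] at hℓ
        linarith
  have hatom : ∀ E, (¬ ContinuousAt φ E ∨ E ∈ range ((↑) : ℤ → ℝ)) → ∀ ε > 0, ∃ δ > 0,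
      ∀ᶠ i in F, mes i (Ioo (E - δ) (E + δ)) ≤ ENNReal.ofReal ε := by
    intro E hE ε hε
    have hES : E ∈ S := hE.elim (fun h => hS' h) fun h => hSZ h
    -- The mass of (E - y, E + y) is at most 2y²(m/ℓ + 8/(y²ℓ)) with y²m ≤ 3, that is (6 + 16)/ℓ.
    -- First ℓ is fixed, then y depends on ℓ.
    obtain ⟨ℓ, hℓ⟩ := exists_nat_gt (22 / ε)
    have hℓ0 : (0 : ℝ) < ℓ := lt_of_le_of_lt (by positivity) hℓ
    have hℓ0' : 0 < ℓ := by exact_mod_cast hℓ0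
    obtain ⟨n, hn⟩ := hm E ℓ hℓ0'
    set y : ℝ := 1 / ((n : ℝ) + 1) with hy
    have hy0 : 0 < y := by positivity
    refine ⟨y, hy0, hF fun p => ?_⟩
    filter_upwards [p.1.2.eventually_abs_sub_le hper hsupp (hW p) p.2 hES n hℓ0',
      eventually_gt_atTop 0] with L hL hL0
    rw [← hy] at hL
    refine (measure_Ioo_le _ E hy0).trans ?_
    rw [lintegral_smul_measure, lintegral_poisson_countMeasure (hW p) p.2 hL0 E hy0, smul_eq_mul]
    have hfin := ne_top_of_le_ne_top ENNReal.ofReal_ne_top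
      (countHsq_le_of_im (hW p) p.2 hL0 E hy0.ne')
    set H := countHsq (potential Vper u p.1.1) p.2 L ⟨E, y⟩
    rw [← ENNReal.ofReal_toReal hfin, ← ENNReal.ofReal_mul hy0.le,
      ← ENNReal.ofReal_mul (by positivity), ← ENNReal.ofReal_mul (by positivity)]
    refine ENNReal.ofReal_le_ofReal ?_
    have h1 : H.toReal / L ≤ m ℓ ⟨E, y⟩ / ℓ + 2 * (4 / y ^ 2) / ℓ := by linarith [(abs_le.1 hL).2]
    calc 2 * y * (1 / L * (y * H.toReal)) = 2 * y ^ 2 * (H.toReal / L) := by ring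
      _ ≤ 2 * y ^ 2 * (m ℓ ⟨E, y⟩ / ℓ + 2 * (4 / y ^ 2) / ℓ) := by gcongr
      _ = (2 * (y ^ 2 * m ℓ ⟨E, y⟩) + 16) / ℓ := by field_simp; ring
      _ ≤ 22 / ℓ := by gcongr; linarith
      _ ≤ ε := by
        rw [div_le_iff₀ hℓ0]
        rw [div_lt_iff₀ hε] at hℓ
        linarith
  obtain ⟨ν, hν⟩ := hφ.exists_tendsto_integral mes C hC S hS (fun n : ℕ => 1 / ((n : ℝ) + 1))
    (fun n => by positivity) tendsto_one_div_add_atTop_nhds_zero_nat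
    hP hatom
  refine ⟨ν, fun lam hlam b => ?_⟩
  have h1 := tendsto_iSup.1 hν (⟨lam, hlam⟩, b)
  rw [tendsto_map'_iff] at h1
  refine h1.congr' ?_
  filter_upwards [eventually_gt_atTop 0] with L hL
  rw [Function.comp_apply, hint _ _ hL, Complex.real_smul]
  push_cast
  rfl

end DensityOfStates
end RandomDirac
end

/-! ### Assembly of the theorem. -/

theorem mainTheorem10 {Ω : Type*} [MeasurableSpace Ω] (P : Measure Ω) [IsProbabilityMeasure P]
    (Vper u : ℝ → Matrix (Fin 2) (Fin 2) ℝ)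
    (hVper : RandomDirac.IsPotential Vper) (hper : Function.Periodic Vper 1)
    (hu : RandomDirac.IsPotential u) (hsupp : ∀ x, x ∉ Icc (-1 / 2 : ℝ) (1 / 2) → u x = 0)
    (lam : ℤ → Ω → ℝ) (hmeas : ∀ n, Measurable (lam n)) (hindep : iIndepFun lam P)
    (hident : ∀ n, IdentDistrib (lam n) (lam 0) P P)
    (hbdd : ∃ M : ℝ, ∀ᵐ ω ∂P, |lam 0 ω| ≤ M)
    (φ : ℝ → ℂ) (hφ : RandomDirac.IsTestFunction φ) :
    ∃ ν : ℂ, ∀ᵐ ω ∂P,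
      let W := RandomDirac.potential Vper u (fun n => lam n ω)
      let A := RandomDirac.borelFC (RandomDirac.diracLine W) φ
      let B := fun L : ℝ => RandomDirac.borelFC (RandomDirac.diracBox L W) φ
      RandomDirac.IsFunctionOf (RandomDirac.diracLine W) φ A ∧
      (∀ L > 0, RandomDirac.IsFunctionOf (RandomDirac.diracBox L W) φ (B L)) ∧
      (∀ L > 0, RandomDirac.IsTraceClass
        (RandomDirac.chi L ∘L A ∘L RandomDirac.chi L)) ∧
      (∀ L > 0, RandomDirac.IsTraceClass (B L)) ∧
      Tendsto (fun L : ℝ => 1 / (L : ℂ) * RandomDirac.trace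
        (RandomDirac.chi L ∘L A ∘L RandomDirac.chi L)) atTop (𝓝 ν) ∧
      Tendsto (fun L : ℝ => 1 / (L : ℂ) * RandomDirac.trace (B L)) atTop (𝓝 ν) := by
  obtain ⟨M, hM⟩ := hbdd
  have hM0 : 0 ≤ M := by
    obtain ⟨ω, hω⟩ := hM.exists
    exact (abs_nonneg _).trans hω
  have hall : ∀ᵐ ω ∂P, ∀ n, |lam n ω| ≤ M := ae_all_iff.2 fun n =>
    (hident n).symm.ae_snd (p := fun x => |x| ≤ M)
      (measurableSet_le continuous_abs.measurable measurable_const) hM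
  -- The rationals make `S` dense, as the Poisson argument requires; the discontinuities of φ and
  -- the integers are the points where masses must be controlled. All three are countable.
  let S : Set ℝ := range ((↑) : ℚ → ℝ) ∪ ({x | ¬ ContinuousAt φ x} ∪ range ((↑) : ℤ → ℝ))
  have hS : S.Countable := (countable_range _).union
    (hφ.countable_discontinuities.union (countable_range _))
  obtain ⟨ν, hν⟩ := RandomDirac.exists_tendsto_of_isTypical hVper hper hu hsupp hφ (M := M)
    (S := S)
    (m := fun ℓ z => ∫ ω, (RandomDirac.hsq (RandomDirac.resolv
      (RandomDirac.cellOp Vper u fun i : Fin ℓ => lam i ω) z)).toReal ∂P) (Rat.denseRange_cast.mono subset_union_left)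
    (subset_union_left.trans subset_union_right) (subset_union_right.trans subset_union_right)
    fun E ℓ hℓ => RandomDirac.exists_sq_mul_integral_le hVper hu hsupp hmeas hM0 hall hℓ E
  refine ⟨ν, ?_⟩
  obtain ⟨B, hB⟩ := RandomDirac.exists_isBddPotential hVper hu hsupp M
  filter_upwards [RandomDirac.ae_isTypical hVper hu hsupp hmeas hindep hident hM0 hall hS]
    with ω hω
  have hW := hB _ hω.bound
  refine ⟨hφ.isFunctionOf_borelFC (RandomDirac.diracLine_isSelfAdjoint hW).1,
    fun L hL => hφ.isFunctionOf_borelFC (RandomDirac.diracBox_isSelfAdjoint hW hL).1,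
    fun L hL => RandomDirac.isTraceClass_line hW hφ hL,
    fun L hL => RandomDirac.isTraceClass_box hW hφ hL,
    (hν _ hω true).congr' ?_, (hν _ hω false).congr' ?_⟩
  · filter_upwards [eventually_gt_atTop 0] with L hL
    rw [RandomDirac.trace_line hW hφ hL]
  · filter_upwards [eventually_gt_atTop 0] with L hL
    rw [RandomDirac.trace_box hW hφ hL]
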